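/- Let $k$ be a field, let $Q$ be a finite quiver and let $I$ be an ideal of the path algebra $kQ$. Write $\beta\alpha$ for the path "first $\alpha$, then $\beta$", and for an admissible $I$ let $A=kQ/I$. Definitions. $A=kQ/I$ is *gentle* if $Q$ is connected, $I$ is admissible and generated by paths of length two, every vertex of $Q$ has at most two incoming and at most two outgoing arrows, and for each arrow $\alpha$ there is at most one arrow $\beta$ with $\beta\alpha\notin I$, at most one arrow $\gamma$ with $\alpha\gamma\notin I$, at most one arrow $\beta'$ with $0\neq\alpha\beta'\in I$, and at most one arrow $\gamma'$ with $0\neq\gamma'\alpha\in I$. A *string* of length $d\ge 1$ is a word $w=\gamma_d^{\epsilon_d}\cdots\gamma_1^{\epsilon_1}$ in arrows and formal inverses of arrows such that consecutive letters are composable and are not inverse to each other, and neither $w$ nor $w^{-1}$ contains a subpath that lies in $I$; $w$ is *uniserial* (serial) if $w$ or $w^{-1}$ is a directed path. A *band* is a string $w$ of positive length such that $w^m$ is a string for all $m\ge 1$ and $w$ is not a power of a strictly shorter string. For a band $w$ let $e_w$ be the sum of the idempotents $e_x$ over the vertices $x$ visited by $w$. The *weak reduction* of $A$ via $w$ is $A/\langle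 1-e_w\rangle$, and the *reduction* of $A$ via $w$ is the quotient of $A$ by the ideal generated by all arrows $\gamma$ such that neither $\gamma$ nor $\gamma^{-1}$ occurs in $w$. A gentle algebra $A$ is *fully reduced* if it is representation-infinite (it has infinitely many isomorphism classes of finitely generated indecomposable modules) and, for every band $w$, both the weak reduction and the reduction of $A$ via $w$ are equal to $A$ (that is, the ideals factored out are zero). Proposition. $A=kQ/I$ is a fully reduced gentle algebra if and only if one of the following holds: 1. $I=0$ and $Q$ is an acyclic orientation (no oriented cycles) of the graph $\widetilde{\mathbb A}_n$, the cycle with $n+1$ vertices and $n+1$ edges, for some $n\ge 0$ (in fact $n\geq 1$, because a loop is an oriented cycle). 2. $(Q,I)$ is a generalized barbell bound quiver: there are vertices $x,y$ and arrows $\alpha,\beta,\gamma,\delta$, a cyclic string $C_L=\alpha\cdots\beta$ of positive length which starts at $x$ with the arrow $\beta$ and ends at $x$ with the arrow $\alpha$ (possibly $\alpha=\beta$), a cyclic string $C_R=\gamma\cdots\delta$ of positive length which starts at $y$ with the arrow $\delta$ and ends at $y$ with the arrow $\gamma$ (possibly $\gamma=\delta$), and a walk $\mathfrak b$ of length $\ge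 0$ from $x$ to $y$ (the bar, a copy of some $\mathbb A_m$), such that $C_L$, $C_R$ and $\mathfrak b$ do not repeat a vertex (except that $C_L$ and $C_R$ return to their starting points) or an arrow, they share no arrows and share no vertices other than $x$ (common to $C_L$ and $\mathfrak b$) and $y$ (common to $C_R$ and $\mathfrak b$), where $x=y$ if and only if $\mathfrak b$ has length $0$, they together contain all vertices and arrows of $Q$, and $I=\langle\beta\alpha,\delta\gamma\rangle$; moreover $C_RC_L$ is not a uniserial string in $(Q,I)$ (that is, if $\mathfrak b$ has length $0$, then $C_L$ and $C_R$ are not both directed paths). The arrows not named above may have any orientation. -/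

import Mathlib

universe u v w

namespace BoundQuiver

open CategoryTheory

noncomputable section

/-! ### Path algebras -/

/-- All paths of the quiver `V` (including the lazy ones), with varying start and end. -/
abbrev PathIdx (V : Type u) [Quiver.{v} V] : Type max u v :=
  Σ a : V, Σ b : V, Quiver.Path a b

/-- The path algebra `k V`: the `k`-vector space with basis the set of all paths of `V`. -/
def PathAlgebra (k : Type w) (V : Type u) [Field k] [Quiver.{v} V] : Type max u v w :=
  PathIdx V →₀ k

namespace PathAlgebra

variable (k : Type w) {V : Type u} [Field k] [Quiver.{v} V]

instance : AddCommGroup (PathAlgebra k V) := inferInstanceAs (AddCommGroup (PathIdx V →₀ k))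

instance : Module k (PathAlgebra k V) := inferInstanceAs (Module k (PathIdx V →₀ k))

/-- The basis element of the path algebra given by a path. -/
def ofPath (p : PathIdx V) : PathAlgebra k V := Finsupp.single p 1

open Classical in
/-- Product of two paths: `p * q` means first `q`, then `p`; it is `0` if `q` does not end where
`p` starts. -/
def pathMul (p q : PathIdx V) : PathAlgebra k V :=
  if h : p.1 = q.2.1 then ofPath k ⟨q.1, p.2.1, q.2.2.comp (p.2.2.cast h rfl)⟩ else 0

/-- The bilinear extension of `pathMul`. -/
def mulHom : PathAlgebra k V →ₗ[k] PathAlgebra k V →ₗ[k] PathAlgebra k V :=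
  Finsupp.linearCombination k (fun p : PathIdx V =>
    (Finsupp.linearCombination k (fun q : PathIdx V => pathMul k p q) :
      (PathIdx V →₀ k) →ₗ[k] PathAlgebra k V))

instance : Mul (PathAlgebra k V) := ⟨fun f g => mulHom k f g⟩

/-- The idempotent `e_x`, i.e. the lazy path at `x`. -/
def idem (x : V) : PathAlgebra k V := ofPath k ⟨x, x, Quiver.Path.nil⟩

instance [Fintype V] : One (PathAlgebra k V) := ⟨∑ x : V, idem k x⟩

variable {k}

theorem mul_def (f g : PathAlgebra k V) : f * g = mulHom k f g := rfl

theorem ofPath_mul_ofPath (p q : PathIdx V) : ofPath k p * ofPath k q = pathMul k p q := by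
  rw [mul_def]
  unfold mulHom
  have h1 : (Finsupp.linearCombination k (fun p : PathIdx V =>
    (Finsupp.linearCombination k (fun q : PathIdx V => pathMul k p q) :
      (PathIdx V →₀ k) →ₗ[k] PathAlgebra k V))) (Finsupp.single p 1) =
      Finsupp.linearCombination k (fun q : PathIdx V => pathMul k p q) := by
    rw [Finsupp.linearCombination_single, one_smul]
  have h2 : (Finsupp.linearCombination k (fun q : PathIdx V => pathMul k p q))
      (Finsupp.single q 1) = pathMul k p q := by
    rw [Finsupp.linearCombination_single, one_smul]
  exact (congrArg (fun L : (PathIdx V →₀ k) →ₗ[k] PathAlgebra k V => L (Finsupp.single q 1))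
    h1).trans h2

/-- Linear maps out of the path algebra agree if they agree on paths. -/
theorem hom_ext {M : Type*} [AddCommMonoid M] [Module k M] {F G : PathAlgebra k V →ₗ[k] M}
    (h : ∀ p, F (ofPath k p) = G (ofPath k p)) : F = G := by
  have : ∀ (F G : (PathIdx V →₀ k) →ₗ[k] M),
      (∀ p, F (Finsupp.single p 1) = G (Finsupp.single p 1)) → F = G := by
    intro F G h
    refine Finsupp.lhom_ext' fun p => LinearMap.ext_ring (h p)
  exact this F G h

theorem pathMul_assoc (p q r : PathIdx V) :
    mulHom k (pathMul k p q) (ofPath k r) = mulHom k (ofPath k p) (pathMul k q r) := by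
  obtain ⟨a, b, p⟩ := p
  obtain ⟨c, d, q⟩ := q
  obtain ⟨e, f, r⟩ := r
  by_cases h1 : a = d
  · subst h1
    by_cases h2 : c = f
    · subst h2
      have e1 : pathMul k (⟨a, b, p⟩ : PathIdx V) ⟨c, a, q⟩ = ofPath k ⟨c, b, q.comp p⟩ := by
        simp [pathMul]
      have e2 : pathMul k (⟨c, a, q⟩ : PathIdx V) ⟨e, c, r⟩ = ofPath k ⟨e, a, r.comp q⟩ := by
        simp [pathMul]
      rw [e1, e2, ← mul_def, ← mul_def, ofPath_mul_ofPath, ofPath_mul_ofPath]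
      simp [pathMul, Quiver.Path.comp_assoc]
    · have e1 : pathMul k (⟨a, b, p⟩ : PathIdx V) ⟨c, a, q⟩ = ofPath k ⟨c, b, q.comp p⟩ := by
        simp [pathMul]
      have e2 : pathMul k (⟨c, a, q⟩ : PathIdx V) ⟨e, f, r⟩ = 0 := by
        simp [pathMul, h2]
      rw [e1, e2, map_zero, ← mul_def, ofPath_mul_ofPath]
      simp [pathMul, h2]
  · have e1 : pathMul k (⟨a, b, p⟩ : PathIdx V) ⟨c, d, q⟩ = 0 := by
      simp [pathMul, h1]
    rw [e1, map_zero, LinearMap.zero_apply]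
    by_cases h2 : c = f
    · subst h2
      have e2 : pathMul k (⟨c, d, q⟩ : PathIdx V) ⟨e, c, r⟩ = ofPath k ⟨e, d, r.comp q⟩ := by
        simp [pathMul]
      rw [e2, ← mul_def, ofPath_mul_ofPath]
      simp [pathMul, h1]
    · have e2 : pathMul k (⟨c, d, q⟩ : PathIdx V) ⟨e, f, r⟩ = 0 := by
        simp [pathMul, h2]
      rw [e2, map_zero]

theorem mul_assoc' (f g h : PathAlgebra k V) : f * g * h = f * (g * h) := by
  -- both sides are trilinear, so it is enough to compare them on paths
  have key : (mulHom k).compr₂ (mulHom k) =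
      ((LinearMap.llcomp k (PathAlgebra k V) (PathAlgebra k V) (PathAlgebra k V)).flip.comp
        (mulHom k)).flip.comp (mulHom k) := by
    refine hom_ext fun p => hom_ext fun q => hom_ext fun r => ?_
    simp only [LinearMap.compr₂_apply, LinearMap.comp_apply, LinearMap.flip_apply,
      LinearMap.llcomp_apply]
    rw [← mul_def (ofPath k p) (ofPath k q), ofPath_mul_ofPath,
      ← mul_def (ofPath k q) (ofPath k r), ofPath_mul_ofPath]
    exact pathMul_assoc p q r
  have := congrArg (fun F => F f g h) key
  exact this

theorem one_mul' [Fintype V] (f : PathAlgebra k V) : 1 * f = f := by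
  have key : mulHom k (1 : PathAlgebra k V) = LinearMap.id := by
    refine hom_ext fun p => ?_
    obtain ⟨a, b, p⟩ := p
    have : (1 : PathAlgebra k V) = ∑ x : V, idem k x := rfl
    rw [this, map_sum, LinearMap.sum_apply, Finset.sum_eq_single b]
    · rw [← mul_def, idem, ofPath_mul_ofPath]
      simp [pathMul]
    · intro x _ hx
      rw [← mul_def, idem, ofPath_mul_ofPath]
      simp [pathMul, hx]
    · simp
  exact congrArg (fun F => F f) key

theorem mul_one' [Fintype V] (f : PathAlgebra k V) : f * 1 = f := by
  have key : (mulHom k).flip (1 : PathAlgebra k V) = LinearMap.id := by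
    refine hom_ext fun p => ?_
    obtain ⟨a, b, p⟩ := p
    have : (1 : PathAlgebra k V) = ∑ x : V, idem k x := rfl
    rw [this, LinearMap.flip_apply, map_sum, Finset.sum_eq_single a]
    · rw [← mul_def, idem, ofPath_mul_ofPath]
      simp [pathMul]
    · intro x _ hx
      rw [← mul_def, idem, ofPath_mul_ofPath]
      simp [pathMul, Ne.symm hx]
    · simp
  exact congrArg (fun F => F f) key

instance [Fintype V] : Ring (PathAlgebra k V) where
  __ := (inferInstance : AddCommGroup (PathAlgebra k V))
  mul_assoc := mul_assoc'
  one_mul := one_mul'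
  mul_one := mul_one'
  left_distrib f g h := (mulHom k f).map_add g h
  right_distrib f g h := by
    change mulHom k (f + g) h = mulHom k f h + mulHom k g h
    rw [map_add, LinearMap.add_apply]
  zero_mul f := by
    change mulHom k 0 f = 0
    rw [map_zero, LinearMap.zero_apply]
  mul_zero f := (mulHom k f).map_zero

instance [Fintype V] : Algebra k (PathAlgebra k V) :=
  Algebra.ofModule
    (fun c f g => by
      change mulHom k (c • f) g = c • mulHom k f g
      rw [map_smul, LinearMap.smul_apply])
    (fun c f g => (mulHom k f).map_smul c g)

variable (k)

/-- The element of the path algebra given by an arrow. -/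
def ofArrow (a : Quiver.Total V) : PathAlgebra k V := ofPath k ⟨a.left, a.right, a.hom.toPath⟩

end PathAlgebra

open PathAlgebra

/-! ### Bound quivers, gentle algebras -/

section Ideals

variable {k : Type w} {V : Type u} [Field k] [Quiver.{v} V] [Fintype V]

/-- The algebra `k V / I`. -/
abbrev BoundAlgebra (I : TwoSidedIdeal (PathAlgebra k V)) : Type max u v w := I.ringCon.Quotient

variable (k V) in
/-- The arrow ideal `R` of the path algebra. -/
def arrowIdeal : TwoSidedIdeal (PathAlgebra k V) := TwoSidedIdeal.span (Set.range (ofArrow k))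

/-- `I` is admissible: `R ^ m ⊆ I ⊆ R ^ 2` for some `m ≥ 2`. -/
def IsAdmissible (I : TwoSidedIdeal (PathAlgebra k V)) : Prop :=
  ∃ m : ℕ, 2 ≤ m ∧ (arrowIdeal k V).asIdeal ^ m ≤ I.asIdeal ∧
    I.asIdeal ≤ (arrowIdeal k V).asIdeal ^ 2

variable (V) in
/-- The underlying graph of the quiver is (nonempty and) connected. -/
def IsConnectedQuiver : Prop :=
  Nonempty V ∧ ∀ x y : V, Nonempty (@Quiver.Path (Quiver.Symmetrify V) _ x y)

/-- Conditions (B1) and (B2) on the bound quiver of a special biserial algebra. -/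
def IsSpecialBiserial (I : TwoSidedIdeal (PathAlgebra k V)) : Prop :=
  (∀ x : V, {a : Quiver.Total V | a.right = x}.encard ≤ 2 ∧
    {a : Quiver.Total V | a.left = x}.encard ≤ 2) ∧
  ∀ a : Quiver.Total V,
    {b : Quiver.Total V | ofArrow k b * ofArrow k a ∉ I}.Subsingleton ∧
    {c : Quiver.Total V | ofArrow k a * ofArrow k c ∉ I}.Subsingleton

/-- `I` is an admissible ideal of the path algebra of a connected quiver such that `k V / I` is
gentle: special biserial, with `I` generated by paths of length two, and satisfying (G). -/
def IsGentle (I : TwoSidedIdeal (PathAlgebra k V)) : Prop :=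
  IsConnectedQuiver V ∧ IsAdmissible I ∧ IsSpecialBiserial I ∧
  (∃ S : Set (PathIdx V), (∀ p ∈ S, p.2.2.length = 2) ∧
    I = TwoSidedIdeal.span (ofPath k '' S)) ∧
  ∀ a : Quiver.Total V,
    {b : Quiver.Total V | ofArrow k a * ofArrow k b ≠ 0 ∧
      ofArrow k a * ofArrow k b ∈ I}.Subsingleton ∧
    {c : Quiver.Total V | ofArrow k c * ofArrow k a ≠ 0 ∧
      ofArrow k c * ofArrow k a ∈ I}.Subsingleton

end Ideals

/-- A ring is representation-infinite if no finite list of modules contains, up to isomorphism, all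
finitely generated indecomposable (left) modules. -/
def IsRepInfinite (A : Type u) [Ring A] : Prop :=
  ¬ ∃ (n : ℕ) (M : Fin n → ModuleCat.{u} A), ∀ N : ModuleCat.{u} A,
    Module.Finite A N → Indecomposable N → ∃ i, Nonempty (N ≅ M i)

/-! ### Words -/

section Strings

variable {V : Type u} [Quiver.{v} V]

/-- A letter: an arrow `γ` (`dir = true`) or its formal inverse `γ⁻¹` (`dir = false`). -/
structure Letter (V : Type u) [Quiver.{v} V] where
  arrow : Quiver.Total V
  dir : Bool

namespace Letter

/-- Start of a letter. -/
def src (l : Letter V) : V := if l.dir then l.arrow.left else l.arrow.right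

/-- End of a letter. -/
def tgt (l : Letter V) : V := if l.dir then l.arrow.right else l.arrow.left

/-- Formal inverse of a letter. -/
def inv (l : Letter V) : Letter V := ⟨l.arrow, !l.dir⟩

end Letter

/-- Words of positive length are nonempty lists of letters, listed in the order in which they are
traversed: the word `γ_k ⋯ γ_1` is the list `[γ_1, …, γ_k]`. -/
abbrev Word (V : Type u) [Quiver.{v} V] : Type max u v := List (Letter V)

namespace Word

/-- The inverse word. -/
def inv (w : Word V) : Word V := (w.map Letter.inv).reverse

/-- The `m`-th power of a word. -/
def pow (w : Word V) (m : ℕ) : Word V := (List.replicate m w).flatten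

/-- `w` visits the vertex `x`. -/
def Visits (w : Word V) (x : V) : Prop := ∃ l ∈ w, l.src = x ∨ l.tgt = x

/-- `w` supports the arrow `a`: `a` or its inverse occurs in `w`. -/
def Supports (w : Word V) (a : Quiver.Total V) : Prop := ∃ l ∈ w, l.arrow = a

/-- `w` or its inverse is a direct path. -/
def IsSerial (w : Word V) : Prop := (∀ l ∈ w, l.dir = true) ∨ ∀ l ∈ w, l.dir = false

/-- `w` is a walk from `x` to `y`. -/
def IsWalk : V → Word V → V → Prop
  | x, [], y => x = y
  | x, l :: w, y => l.src = x ∧ IsWalk l.tgt w y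

end Word

/-! ### Type `Ã_n` -/

variable (V) in
/-- The underlying graph of the quiver is the cycle with `n + 1` vertices and `n + 1` edges (type
`Ã_n`), and there is no oriented cycle. -/
def IsAcyclicAffineA (n : ℕ) : Prop :=
  (∃ (φ : ZMod (n + 1) ≃ V) (ψ : ZMod (n + 1) ≃ Quiver.Total V), ∀ i,
    ((ψ i).left = φ i ∧ (ψ i).right = φ (i + 1)) ∨
      ((ψ i).left = φ (i + 1) ∧ (ψ i).right = φ i)) ∧
  ∀ (x : V) (p : Quiver.Path x x), p.length = 0

/-! ### Strings and bands of a bound quiver -/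

variable {k : Type w} [Field k] [Fintype V]

variable (k) in
/-- The product `γ_k ⋯ γ_1` in the path algebra of a list `[γ_1, …, γ_k]` of arrows. -/
def arrowsProd (p : List (Quiver.Total V)) : PathAlgebra k V := (p.reverse.map (ofArrow k)).prod

/-- No direct subword of `w` lies in `I`. -/
def AvoidsIdeal (I : TwoSidedIdeal (PathAlgebra k V)) (w : Word V) : Prop :=
  ∀ p : List (Quiver.Total V), p ≠ [] → (p.map fun a => (⟨a, true⟩ : Letter V)) <:+: w →
    arrowsProd k p ∉ I

/-- `w` is a string in `(V, I)`: conditions (S1) and (S2). The strings of length zero, attached to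
the vertices, are not represented by words. -/
def IsString (I : TwoSidedIdeal (PathAlgebra k V)) (w : Word V) : Prop :=
  w ≠ [] ∧ w.IsChain (fun l l' => l'.src = l.tgt ∧ l' ≠ l.inv) ∧
    AvoidsIdeal I w ∧ AvoidsIdeal I w.inv

/-- `w` is a band in `(V, I)`. -/
def IsBand (I : TwoSidedIdeal (PathAlgebra k V)) (w : Word V) : Prop :=
  (∀ m : ℕ, 1 ≤ m → IsString I (w.pow m)) ∧
    ¬ ∃ (u : Word V) (m : ℕ), IsString I u ∧ u.length < w.length ∧ w = u.pow m

/-! ### Weak reduction, reduction, fully reduced algebras -/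

variable (k) in
open Classical in
/-- The idempotent `e_w`: the sum of `e_x` over the vertices `x` visited by `w`. -/
def wordIdem (w : Word V) : PathAlgebra k V := ∑ x : V, if w.Visits x then idem k x else 0

/-- The ideal `⟨1 - e_w⟩` of `A = k V / I`; the weak reduction of `A` via `w` is the quotient
of `A` by it, so weak reduction does not change `A` if and only if this ideal is zero. -/
def weakReductionIdeal (I : TwoSidedIdeal (PathAlgebra k V)) (w : Word V) :
    TwoSidedIdeal (BoundAlgebra I) :=
  TwoSidedIdeal.span {1 - I.ringCon.mk' (wordIdem k w)}

/-- The ideal of `A = k V / I` generated by the arrows that `w` does not support; the reduction of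
`A` via `w` is the quotient of `A` by it, so reduction does not change `A` if and only if this ideal
is zero. -/
def reductionIdeal (I : TwoSidedIdeal (PathAlgebra k V)) (w : Word V) :
    TwoSidedIdeal (BoundAlgebra I) :=
  TwoSidedIdeal.span {f | ∃ a : Quiver.Total V, ¬ w.Supports a ∧ f = I.ringCon.mk' (ofArrow k a)}

/-- `k V / I` is reduced. -/
def IsReduced (I : TwoSidedIdeal (PathAlgebra k V)) : Prop :=
  IsRepInfinite (BoundAlgebra I) ∧ ∀ w : Word V, IsBand I w → weakReductionIdeal I w = ⊥

/-- `k V / I` is fully reduced. -/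
def IsFullyReduced (I : TwoSidedIdeal (PathAlgebra k V)) : Prop :=
  IsReduced I ∧ ∀ w : Word V, IsBand I w → reductionIdeal I w = ⊥

/-! ### Generalized barbells -/

/-- `(V, I)` is a generalized barbell bound quiver: `C_L` is a cyclic string at `x` beginning with
the arrow `β` and ending with the arrow `α`, `C_R` is a cyclic string at `y` beginning with the arrow
`δ` and ending with the arrow `γ`, and `b` (the bar) is a walk from `x` to `y`. Apart from their
end points these three are simple and pairwise disjoint, together they exhaust the quiver, and
`I = ⟨βα, δγ⟩`. Moreover `C_R C_L` is not a uniserial string. -/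
def IsGeneralizedBarbell (I : TwoSidedIdeal (PathAlgebra k V)) : Prop :=
  ∃ (x y : V) (CL b CR : Word V) (α β γ δ : Quiver.Total V),
    CL.IsWalk x x ∧ b.IsWalk x y ∧ CR.IsWalk y y ∧
    CL.head? = some ⟨β, true⟩ ∧ CL.getLast? = some ⟨α, true⟩ ∧
    CR.head? = some ⟨δ, true⟩ ∧ CR.getLast? = some ⟨γ, true⟩ ∧
    -- the vertices: those of `C_L` other than `x`, those of `b`, those of `C_R` other than `y`
    (CL.tail.map Letter.src ++ (x :: b.map Letter.tgt) ++ CR.tail.map Letter.src).Nodup ∧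
    (∀ z : V, z ∈ CL.tail.map Letter.src ++ (x :: b.map Letter.tgt) ++ CR.tail.map Letter.src) ∧
    -- the arrows
    ((CL ++ b ++ CR).map Letter.arrow).Nodup ∧
    (∀ a : Quiver.Total V, a ∈ (CL ++ b ++ CR).map Letter.arrow) ∧
    I = TwoSidedIdeal.span {ofArrow k β * ofArrow k α, ofArrow k δ * ofArrow k γ} ∧
    IsString I CL ∧ IsString I CR ∧
    ¬ (IsString I (CL ++ CR) ∧ Word.IsSerial (CL ++ CR))

end Strings

end

end BoundQuiver

/-! A gentle ideal is encoded by a `Polarization`: the arrow ends at each vertex are distributed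
over two sides, with at most one incoming and one outgoing arrow per side, so that the product
"first α, then β" is a relation exactly when α ends and β starts on the same side of the middle
vertex (`IsGentle.exists_polarization`). A string is then a walk that leaves every vertex on the
side opposite to the one by which it entered, that is, a path in the finite graph of states
(`isString_iff`). Bands are closed walks, and every nonempty closed walk contains the letters of a
band (`exists_band`).

The algebra is representation-infinite exactly when there is a nonempty closed walk. If there is
one, the string modules of its powers are indecomposable of different dimensions
(`isRepInfinite_of_walk`). If there is none, there are only finitely many walks, and a functorial
filtration by word subspaces splits a string module off every nonzero module (`Rep.exists_retract`),
so the indecomposables are string modules (`not_isRepInfinite`).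

Since no arrow lies in the ideal, trivial reductions force `Covering`: every nonempty closed walk
runs through all arrows. Conversely `Covering` makes both kinds of reduction trivial. Admissibility
amounts to the absence of directed closed walks.

What remains is combinatorics. Follow a closed walk up to its first repeated vertex. If it comes
back in the same state, it is a simple cycle, which by covering is the whole quiver, without
relations. If it comes back on the other side, it has closed a left loop. Going on to the next
repeated vertex closes a right loop, since any other way of closing up gives a closed walk that
misses an arrow; this is a barbell (`Covering.cycle_or_barbell`). For the converse, polarizations
are built on cycles and barbells, and a closed walk is seen to have no freedom except the direction
in which it runs through a loop (`CycleWalk.covering`, `BarbellWalk.closed_walk`). -/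

namespace BoundQuiver

open CategoryTheory PathAlgebra

noncomputable section

/-! ### Polarizations and walks -/

/-- A state: a vertex together with one of its two sides. -/
abbrev State (V : Type u) : Type u := V × Bool

/-- The same vertex, seen from the other side. -/
def State.bar {V : Type u} (p : State V) : State V := (p.1, !p.2)

@[simp] theorem State.bar_bar {V : Type u} (p : State V) : p.bar.bar = p := by simp [State.bar]

@[simp] theorem State.bar_fst {V : Type u} (p : State V) : p.bar.1 = p.1 := rfl

@[simp] theorem State.bar_snd {V : Type u} (p : State V) : p.bar.2 = !p.2 := rfl

theorem State.bar_ne {V : Type u} (p : State V) : p.bar ≠ p := by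
  intro h
  have := congrArg Prod.snd h
  simp at this

theorem State.bar_inj {V : Type u} {p q : State V} : p.bar = q.bar ↔ p = q :=
  ⟨fun h => by rw [← p.bar_bar, h, q.bar_bar], fun h => by rw [h]⟩

theorem State.eq_or_eq_bar {V : Type u} {p q : State V} (h : p.1 = q.1) : p = q ∨ p = q.bar := by
  obtain ⟨x, s⟩ := p
  obtain ⟨y, t⟩ := q
  obtain rfl : x = y := h
  cases s <;> cases t <;> simp [State.bar]

/-- A polarization of a quiver attaches the ends of the arrows to the sides of the vertices, in such
a way that on each side there is at most one incoming and at most one outgoing arrow. -/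
structure Polarization (V : Type u) [Quiver.{v} V] where
  srcSign : Quiver.Total V → Bool
  tgtSign : Quiver.Total V → Bool
  src_inj : ∀ a b, a.left = b.left → srcSign a = srcSign b → a = b
  tgt_inj : ∀ a b, a.right = b.right → tgtSign a = tgtSign b → a = b

namespace Letter

variable {V : Type u} [Quiver.{v} V]

@[simp] theorem inv_inv (l : Letter V) : l.inv.inv = l := by simp [inv]

@[simp] theorem inv_arrow (l : Letter V) : l.inv.arrow = l.arrow := rfl

@[simp] theorem inv_dir (l : Letter V) : l.inv.dir = !l.dir := rfl

@[simp] theorem inv_src (l : Letter V) : l.inv.src = l.tgt := by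
  obtain ⟨a, d⟩ := l
  cases d <;> rfl

@[simp] theorem inv_tgt (l : Letter V) : l.inv.tgt = l.src := by
  obtain ⟨a, d⟩ := l
  cases d <;> rfl

theorem inv_ne (l : Letter V) : l.inv ≠ l := by
  intro h
  have := congrArg Letter.dir h
  simp at this

theorem eq_or_eq_inv {l m : Letter V} (h : l.arrow = m.arrow) : l = m ∨ l = m.inv := by
  obtain ⟨a, d⟩ := l
  obtain ⟨b, e⟩ := m
  obtain rfl : a = b := h
  cases d <;> cases e <;> simp [inv]

end Letter

namespace Polarization

variable {V : Type u} [Quiver.{v} V] (P : Polarization V)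

/-- The zero relations of a polarized quiver: `b` after `a` is a relation if both are attached to
the same side of the vertex in the middle. -/
def Rel (a b : Quiver.Total V) : Prop := a.right = b.left ∧ P.tgtSign a = P.srcSign b

/-- The state from which a letter leaves. -/
def lsrc (l : Letter V) : State V :=
  if l.dir then (l.arrow.left, P.srcSign l.arrow) else (l.arrow.right, P.tgtSign l.arrow)

/-- The state from which a walk goes on after a letter. -/
def ltgt (l : Letter V) : State V := (P.lsrc l.inv).bar

theorem lsrc_inv (l : Letter V) : P.lsrc l.inv = (P.ltgt l).bar := by simp [ltgt]

theorem ltgt_inv (l : Letter V) : P.ltgt l.inv = (P.lsrc l).bar := by simp [ltgt]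

@[simp] theorem lsrc_fst (l : Letter V) : (P.lsrc l).1 = l.src := by
  obtain ⟨a, d⟩ := l
  cases d <;> rfl

@[simp] theorem ltgt_fst (l : Letter V) : (P.ltgt l).1 = l.tgt := by
  simp [ltgt]

/-- From a state at most two letters leave: one arrow and one inverse arrow. This is what makes
walks nearly deterministic. -/
theorem lsrc_inj {l m : Letter V} (hd : l.dir = m.dir) (h : P.lsrc l = P.lsrc m) : l = m := by
  obtain ⟨a, d⟩ := l
  obtain ⟨b, e⟩ := m
  obtain rfl : d = e := hd
  cases d
  · simp only [lsrc, Bool.false_eq_true, if_false, Prod.mk.injEq] at h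
    rw [P.tgt_inj a b h.1 h.2]
  · simp only [lsrc, if_true, Prod.mk.injEq] at h
    rw [P.src_inj a b h.1 h.2]

/-- A relation is a composable pair that a walk cannot take, because it would have to leave on the
side by which it has entered. -/
theorem rel_iff_lsrc (a b : Quiver.Total V) :
    P.Rel a b ↔ P.ltgt ⟨a, true⟩ = (P.lsrc ⟨b, true⟩).bar := by
  simp [Rel, ltgt, lsrc, State.bar, Letter.inv]

/-- `w` is a walk from the state `p` to the state `q`. -/
def Walk : State V → Word V → State V → Prop
  | p, [], q => p = q
  | p, l :: w, q => P.lsrc l = p ∧ Walk (P.ltgt l) w q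

@[simp] theorem walk_nil {p q : State V} : P.Walk p [] q ↔ p = q := Iff.rfl

@[simp] theorem walk_cons {p q : State V} {l : Letter V} {w : Word V} :
    P.Walk p (l :: w) q ↔ P.lsrc l = p ∧ P.Walk (P.ltgt l) w q := Iff.rfl

theorem walk_append {p r : State V} {w w' : Word V} :
    P.Walk p (w ++ w') r ↔ ∃ q, P.Walk p w q ∧ P.Walk q w' r := by
  induction w generalizing p with
  | nil => simp
  | cons l w ih => simp [ih, and_assoc]

theorem Walk.append {P : Polarization V} {p q r : State V} {w w' : Word V} (h : P.Walk p w q)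
    (h' : P.Walk q w' r) : P.Walk p (w ++ w') r := P.walk_append.2 ⟨q, h, h'⟩

theorem Walk.end_unique {P : Polarization V} {p q r : State V} {w : Word V} (h : P.Walk p w q)
    (h' : P.Walk p w r) : q = r := by
  induction w generalizing p with
  | nil => exact h.symm.trans h'
  | cons l w ih => exact ih h.2 h'.2

theorem Walk.start_unique {P : Polarization V} {p q r s : State V} {w : Word V} (hw : w ≠ [])
    (h : P.Walk p w q) (h' : P.Walk r w s) : p = r := by
  cases w with
  | nil => exact absurd rfl hw
  | cons l w => exact h.1.symm.trans h'.1

theorem Walk.inv {P : Polarization V} {p q : State V} {w : Word V} (h : P.Walk p w q) :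
    P.Walk q.bar (Word.inv w) p.bar := by
  induction w generalizing p with
  | nil => simpa [Word.inv, State.bar_inj] using Eq.symm h
  | cons l w ih =>
    have h1 := ih h.2
    have : Word.inv (l :: w) = Word.inv w ++ [l.inv] := by simp [Word.inv]
    rw [this]
    refine h1.append ⟨P.lsrc_inv l, ?_⟩
    rw [walk_nil, P.ltgt_inv, h.1]

theorem Walk.isWalk {P : Polarization V} {p q : State V} {w : Word V} (h : P.Walk p w q) :
    Word.IsWalk p.1 w q.1 := by
  induction w generalizing p with
  | nil => exact congrArg Prod.fst h
  | cons l w ih => exact ⟨by rw [← h.1, lsrc_fst], by simpa using ih h.2⟩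

theorem exists_walk_iff_isChain {w : Word V} (hw : w ≠ []) :
    (∃ p q, P.Walk p w q) ↔ w.IsChain (fun l l' => P.lsrc l' = P.ltgt l) := by
  induction w with
  | nil => exact absurd rfl hw
  | cons l w ih =>
    cases w with
    | nil => simp
    | cons m w =>
      rw [List.isChain_cons_cons, ← ih (List.cons_ne_nil _ _)]
      constructor
      · rintro ⟨p, q, h1, h2⟩
        exact ⟨h2.1, _, q, h2⟩
      · rintro ⟨h1, p, q, h2⟩
        exact ⟨_, q, rfl, h1, h2.2⟩

variable (k : Type w) [Field k] [Fintype V]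

/-- The ideal of the path algebra generated by the zero relations. -/
def ideal : TwoSidedIdeal (PathAlgebra k V) :=
  TwoSidedIdeal.span {f | ∃ a b, P.Rel a b ∧ f = ofArrow k b * ofArrow k a}

end Polarization

/-! ### Representations of polarized quivers -/

section PathAlgebraFacts

variable {k : Type w} [Field k] {V : Type u} [Quiver.{v} V]

theorem ofPath_cons {a b c : V} (p : Quiver.Path a b) (e : b ⟶ c) :
    (ofPath k ⟨a, c, p.cons e⟩ : PathAlgebra k V) = ofArrow k ⟨b, c, e⟩ * ofPath k ⟨a, b, p⟩ := by
  rw [ofArrow, ofPath_mul_ofPath]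
  simp [pathMul, Quiver.Path.comp_toPath_eq_cons]

theorem ofArrow_mul_ofPath_ne {a b : V} (p : Quiver.Path a b) (c : Quiver.Total V)
    (h : c.left ≠ b) : ofArrow k c * ofPath k ⟨a, b, p⟩ = 0 := by
  rw [ofArrow, ofPath_mul_ofPath]
  simp [pathMul, h]

theorem ofArrow_mul_ofArrow {a b : Quiver.Total V} (h : a.right = b.left) :
    ∃ p : Quiver.Path a.left b.right, p.length = 2 ∧
      ofArrow k b * ofArrow k a = ofPath k ⟨_, _, p⟩ := by
  obtain ⟨x, y, e⟩ := a
  obtain ⟨y', z, f⟩ := b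
  obtain rfl : y = y' := h
  exact ⟨(e.toPath).cons f, rfl, (ofPath_cons _ _).symm⟩

theorem ofPath_ne_zero (p : PathIdx V) : ofPath k p ≠ 0 :=
  (Finsupp.single_ne_zero (M := k)).2 one_ne_zero

theorem ofArrow_mul_ofArrow_ne_zero {a b : Quiver.Total V} :
    ofArrow k b * ofArrow k a ≠ 0 ↔ a.right = b.left := by
  constructor
  · intro h
    by_contra h'
    exact h (ofArrow_mul_ofPath_ne _ _ (Ne.symm h'))
  · intro h
    obtain ⟨p, -, hp⟩ := ofArrow_mul_ofArrow (k := k) h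
    rw [hp]
    exact ofPath_ne_zero _

theorem idem_mul_idem (x : V) : idem k x * idem k x = idem k x := by
  simp [idem, ofPath_mul_ofPath, pathMul]

theorem idem_mul_idem_ne {x y : V} (h : x ≠ y) : idem k x * idem k y = 0 := by
  simp [idem, ofPath_mul_ofPath, pathMul, h]

theorem ofArrow_mul_idem (a : Quiver.Total V) : ofArrow k a * idem k a.left = ofArrow k a := by
  simp [idem, ofArrow, ofPath_mul_ofPath, pathMul]
  rfl

theorem idem_mul_ofArrow (a : Quiver.Total V) : idem k a.right * ofArrow k a = ofArrow k a := by
  simp [idem, ofArrow, ofPath_mul_ofPath, pathMul]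

theorem one_eq_sum_idem [Fintype V] : (1 : PathAlgebra k V) = ∑ x : V, idem k x := rfl

/-- Induction on elements of the path algebra. -/
theorem pathAlgebra_induction {C : PathAlgebra k V → Prop} (f : PathAlgebra k V)
    (zero : C 0) (add : ∀ f g, C f → C g → C (f + g)) (smul : ∀ (c : k) f, C f → C (c • f))
    (path : ∀ p, C (ofPath k p)) : C f := by
  refine Finsupp.induction_linear (M := k) (motive := C) f zero add fun p c => ?_
  have h : (Finsupp.single p c : PathIdx V →₀ k) = c • Finsupp.single p 1 := by simp
  rw [h]
  exact smul c _ (path p)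

end PathAlgebraFacts

/-- A representation of a polarized quiver on the vector space `U`. -/
structure Rep {V : Type u} [Quiver.{v} V] [Fintype V] (P : Polarization V) (k : Type w) [Field k]
    (U : Type*) [AddCommGroup U] [Module k U] where
  e : V → Module.End k U
  r : Quiver.Total V → Module.End k U
  e_mul_e : ∀ x, e x * e x = e x
  e_mul_e_ne : ∀ x y, x ≠ y → e x * e y = 0
  e_sum : ∑ x, e x = 1
  r_mul_e : ∀ a, r a * e a.left = r a
  e_mul_r : ∀ a, e a.right * r a = r a
  rel : ∀ a b, P.Rel a b → r b * r a = 0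

namespace Rep

variable {V : Type u} [Quiver.{v} V] [Fintype V] {P : Polarization V} {k : Type w} [Field k]
  {U : Type*} [AddCommGroup U] [Module k U] (R : Rep P k U)

/-- The action of a path. -/
def path {a : V} : {b : V} → Quiver.Path a b → Module.End k U
  | _, Quiver.Path.nil => R.e a
  | _, Quiver.Path.cons p e => R.r ⟨_, _, e⟩ * path p

theorem e_mul_path {a b : V} (p : Quiver.Path a b) : R.e b * R.path p = R.path p := by
  cases p with
  | nil => exact R.e_mul_e _
  | cons p e =>
    rw [path, ← mul_assoc]
    exact congrArg (· * R.path p) (R.e_mul_r ⟨_, _, e⟩)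

theorem path_mul_e {a b : V} (p : Quiver.Path a b) : R.path p * R.e a = R.path p := by
  induction p with
  | nil => exact R.e_mul_e _
  | cons p e ih => rw [path, mul_assoc, ih]

theorem path_comp {a b c : V} (p : Quiver.Path a b) (q : Quiver.Path b c) :
    R.path (p.comp q) = R.path q * R.path p := by
  induction q with
  | nil => exact (R.e_mul_path p).symm
  | cons q e ih => rw [Quiver.Path.comp_cons, path, path, ih, mul_assoc]

/-- The action of the path algebra, as a linear map. -/
def toLin : PathAlgebra k V →ₗ[k] Module.End k U :=
  (Finsupp.linearCombination k (fun p : PathIdx V => R.path p.2.2) :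
    (PathIdx V →₀ k) →ₗ[k] Module.End k U)

theorem toLin_ofPath (p : PathIdx V) : R.toLin (ofPath k p) = R.path p.2.2 := by
  change (Finsupp.linearCombination k (fun p : PathIdx V => R.path p.2.2)) (Finsupp.single p 1) = _
  rw [Finsupp.linearCombination_single, one_smul]

theorem toLin_mul (f g : PathAlgebra k V) : R.toLin (f * g) = R.toLin f * R.toLin g := by
  have key : (mulHom k).compr₂ R.toLin = (LinearMap.mul k (Module.End k U)).compl₁₂ R.toLin R.toLin := by
    refine hom_ext fun p => hom_ext fun q => ?_
    obtain ⟨a, b, p⟩ := p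
    obtain ⟨c, d, q⟩ := q
    rw [LinearMap.compr₂_apply, LinearMap.compl₁₂_apply, ← mul_def, ofPath_mul_ofPath,
      toLin_ofPath, toLin_ofPath, LinearMap.mul_apply']
    by_cases h : a = d
    · subst h
      simp [pathMul, toLin_ofPath, path_comp]
    · rw [pathMul, dif_neg h, map_zero]
      dsimp only
      rw [← R.path_mul_e p, ← R.e_mul_path q, mul_assoc, ← mul_assoc (R.e a), R.e_mul_e_ne _ _ h,
        zero_mul, mul_zero]
  exact congrArg (fun F => F f g) key

/-- The action of the path algebra. -/
def toAlgHom : PathAlgebra k V →ₐ[k] Module.End k U :=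
  AlgHom.ofLinearMap R.toLin
    (by
      rw [one_eq_sum_idem, map_sum, ← R.e_sum]
      exact Finset.sum_congr rfl fun x _ => R.toLin_ofPath _)
    R.toLin_mul

theorem toAlgHom_idem (x : V) : R.toAlgHom (idem k x) = R.e x := R.toLin_ofPath _

theorem toAlgHom_ofArrow (a : Quiver.Total V) : R.toAlgHom (ofArrow k a) = R.r a := by
  refine (R.toLin_ofPath _).trans ?_
  exact R.r_mul_e a

theorem ideal_le_ker : P.ideal k ≤ TwoSidedIdeal.ker R.toAlgHom := by
  refine TwoSidedIdeal.span_le.2 ?_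
  rintro _ ⟨a, b, h, rfl⟩
  change _ ∈ TwoSidedIdeal.ker R.toAlgHom
  rw [TwoSidedIdeal.mem_ker, map_mul, toAlgHom_ofArrow, toAlgHom_ofArrow, R.rel a b h]

theorem toAlgHom_eq_zero {f : PathAlgebra k V} (h : f ∈ P.ideal k) : R.toAlgHom f = 0 :=
  (TwoSidedIdeal.mem_ker _).1 (R.ideal_le_ker h)

/-- The action of the bound quiver algebra. -/
def toRingHom : BoundAlgebra (P.ideal k) →+* Module.End k U :=
  (P.ideal k).ringCon.lift (R.toAlgHom : PathAlgebra k V →+* Module.End k U) fun {f g} h => by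
    have := R.toAlgHom_eq_zero ((TwoSidedIdeal.rel_iff _ _ _).1 h)
    rw [map_sub, sub_eq_zero] at this
    exact this

end Rep

/-! ### Homomorphisms of representations -/

namespace Rep

variable {V : Type u} [Quiver.{v} V] [Fintype V] {P : Polarization V} {k : Type w} [Field k]
  {U U₁ U₂ : Type*} [AddCommGroup U] [Module k U] [AddCommGroup U₁] [Module k U₁]
  [AddCommGroup U₂] [Module k U₂]

/-- A linear map that is a homomorphism of representations. -/
def IsHom (R : Rep P k U) (R' : Rep P k U₁) (φ : U →ₗ[k] U₁) : Prop :=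
  (∀ x u, φ (R.e x u) = R'.e x (φ u)) ∧ ∀ a u, φ (R.r a u) = R'.r a (φ u)

theorem IsHom.comp {R : Rep P k U} {R' : Rep P k U₁} {R'' : Rep P k U₂} {φ : U →ₗ[k] U₁}
    {ψ : U₁ →ₗ[k] U₂} (hψ : IsHom R' R'' ψ) (hφ : IsHom R R' φ) : IsHom R R'' (ψ ∘ₗ φ) :=
  ⟨fun x u => by simp [hφ.1, hψ.1], fun x u => by simp [hφ.2, hψ.2]⟩

theorem e_apply_ne (R : Rep P k U) {x y : V} (h : x ≠ y) (u : U) : R.e x (R.e y u) = 0 :=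
  LinearMap.congr_fun (R.e_mul_e_ne x y h) u

theorem e_apply_e (R : Rep P k U) (x : V) (u : U) : R.e x (R.e x u) = R.e x u :=
  LinearMap.congr_fun (R.e_mul_e x) u

theorem r_apply_e (R : Rep P k U) (a : Quiver.Total V) (u : U) : R.r a (R.e a.left u) = R.r a u :=
  LinearMap.congr_fun (R.r_mul_e a) u

theorem e_apply_r (R : Rep P k U) (a : Quiver.Total V) (u : U) : R.e a.right (R.r a u) = R.r a u :=
  LinearMap.congr_fun (R.e_mul_r a) u

theorem r_apply_r (R : Rep P k U) {a b : Quiver.Total V} (h : P.Rel a b) (u : U) :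
    R.r b (R.r a u) = 0 :=
  LinearMap.congr_fun (R.rel a b h) u

theorem r_apply_e_ne (R : Rep P k U) {a : Quiver.Total V} {x : V} (h : a.left ≠ x) (u : U) :
    R.r a (R.e x u) = 0 := by
  rw [← R.r_apply_e, R.e_apply_ne h, map_zero]

theorem e_apply_r_ne (R : Rep P k U) {a : Quiver.Total V} {x : V} (h : x ≠ a.right) (u : U) :
    R.e x (R.r a u) = 0 := by
  rw [← R.e_apply_r, R.e_apply_ne h]

end Rep

/-! ### Representations given by graphs -/

/-- A graph over a polarized quiver: from each side of each position there is at most one step, which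
is labelled by a letter leaving from that side. -/
structure StepGraph {V : Type u} [Quiver.{v} V] (P : Polarization V) (ι : Type*) where
  v : ι → V
  Step : ι → Letter V → ι → Prop
  symm : ∀ i l j, Step i l j → Step j l.inv i
  src : ∀ i l j, Step i l j → l.src = v i
  unique : ∀ i l j l' j', Step i l j → Step i l' j' → P.lsrc l = P.lsrc l' → l = l' ∧ j = j'

namespace StepGraph

variable {V : Type u} [Quiver.{v} V] {P : Polarization V} {ι : Type*} (G : StepGraph P ι)

theorem target_unique {i j j' : ι} {l : Letter V} (h : G.Step i l j) (h' : G.Step i l j') :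
    j = j' :=
  (G.unique _ _ _ _ _ h h' rfl).2

theorem source_unique {i i' j : ι} {l : Letter V} (h : G.Step i l j) (h' : G.Step i' l j) :
    i = i' :=
  (G.unique _ _ _ _ _ (G.symm _ _ _ h) (G.symm _ _ _ h') rfl).2

theorem tgt {i j : ι} {l : Letter V} (h : G.Step i l j) : l.tgt = G.v j := by
  rw [← G.src _ _ _ (G.symm _ _ _ h), Letter.inv_src]

/-- If `a` and `b` met on one side, `a⁻¹` and `b` would be two steps from the same side of `j`.
Hence graph representations satisfy the zero relations. -/
theorem not_rel {i j m : ι} {a b : Quiver.Total V} (h : G.Step i ⟨a, true⟩ j)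
    (h' : G.Step j ⟨b, true⟩ m) : ¬ P.Rel a b := by
  intro hr
  have h1 := (G.unique _ _ _ _ _ (G.symm _ _ _ h) h'
    (by rw [P.lsrc_inv, (P.rel_iff_lsrc a b).1 hr, State.bar_bar])).1
  exact absurd (congrArg Letter.dir h1) (by simp [Letter.inv])

/-- The word `c` is read off when walking from the position `i` in the direction of the state `p`
as far as possible. -/
def Tail : ι → State V → Word V → Prop
  | i, p, [] => ¬ ∃ l j, G.Step i l j ∧ P.lsrc l = p
  | i, p, l :: c => P.lsrc l = p ∧ ∃ j, G.Step i l j ∧ Tail j (P.ltgt l) c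

/-- The rank of a letter. -/
def _root_.BoundQuiver.Letter.rank (l : Letter V) : ℕ := if l.dir then 2 else 0

/-- Words that start from the same state are compared lexicographically by their ranks, the end of
the word having rank one. -/
def _root_.BoundQuiver.Word.ranks (c : Word V) : List ℕ := c.map Letter.rank ++ [1]

/-- The state and the direction determine the next letter, so a word is recovered from its starting
state and its directions. -/
theorem Tail.eq_of_ranks {i j : ι} {p : State V} {c d : Word V} (hc : G.Tail i p c)
    (hd : G.Tail j p d) (h : Word.ranks c = Word.ranks d) : c = d := by
  induction c generalizing i j p d with
  | nil =>
    cases d with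
    | nil => rfl
    | cons m d => simp [Word.ranks] at h
  | cons l c ih =>
    cases d with
    | nil => simp [Word.ranks] at h
    | cons m d =>
      simp only [Word.ranks, List.map_cons, List.cons_append, List.cons.injEq] at h
      have hdir : l.dir = m.dir := by
        have := h.1
        simp only [Letter.rank] at this
        revert this
        cases l.dir <;> cases m.dir <;> simp
      obtain rfl := P.lsrc_inj hdir (hc.1.trans hd.1.symm)
      obtain ⟨-, i', -, hc⟩ := hc
      obtain ⟨-, j', -, hd⟩ := hd
      rw [ih hc hd h.2]

variable (k : Type w) [Field k]

open Classical in
/-- The action of an arrow on functions on the graph. -/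
def arrowEnd (a : Quiver.Total V) : Module.End k (ι → k) where
  toFun g j := if h : ∃ i, G.Step i ⟨a, true⟩ j then g h.choose else 0
  map_add' g g' := by
    funext j
    by_cases h : ∃ i, G.Step i ⟨a, true⟩ j <;> simp [h]
  map_smul' c g := by
    funext j
    by_cases h : ∃ i, G.Step i ⟨a, true⟩ j <;> simp [h]

open Classical in
/-- The action of a vertex on functions on the graph. -/
def vertexEnd (x : V) : Module.End k (ι → k) where
  toFun g j := if G.v j = x then g j else 0
  map_add' g g' := by
    funext j
    by_cases h : G.v j = x <;> simp [h]
  map_smul' c g := by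
    funext j
    by_cases h : G.v j = x <;> simp [h]

variable {k}

theorem arrowEnd_apply {a : Quiver.Total V} {i j : ι} (h : G.Step i ⟨a, true⟩ j) (g : ι → k) :
    G.arrowEnd k a g j = g i := by
  have h' : ∃ i, G.Step i ⟨a, true⟩ j := ⟨i, h⟩
  simp only [arrowEnd, LinearMap.coe_mk, AddHom.coe_mk, dif_pos h']
  rw [G.source_unique h'.choose_spec h]

theorem arrowEnd_apply_of_not {a : Quiver.Total V} {j : ι} (h : ¬ ∃ i, G.Step i ⟨a, true⟩ j)
    (g : ι → k) : G.arrowEnd k a g j = 0 := by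
  simp only [arrowEnd, LinearMap.coe_mk, AddHom.coe_mk, dif_neg h]

theorem vertexEnd_apply (x : V) (g : ι → k) (j : ι) [Decidable (G.v j = x)] :
    G.vertexEnd k x g j = if G.v j = x then g j else 0 := by
  simp only [vertexEnd, LinearMap.coe_mk, AddHom.coe_mk]
  congr

variable [Fintype V]

variable (k) in
open Classical in
/-- The representation on the functions on the graph. -/
def rep : Rep P k (ι → k) where
  e := G.vertexEnd k
  r := G.arrowEnd k
  e_mul_e x := by
    refine LinearMap.ext fun g => funext fun j => ?_
    simp only [Module.End.mul_apply, vertexEnd_apply]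
    split_ifs <;> rfl
  e_mul_e_ne x y h := by
    refine LinearMap.ext fun g => funext fun j => ?_
    simp only [Module.End.mul_apply, vertexEnd_apply]
    split_ifs with h1 h2
    · exact absurd (h1.symm.trans h2) h
    · rfl
    · rfl
  e_sum := by
    refine LinearMap.ext fun g => funext fun j => ?_
    simp [LinearMap.sum_apply, Finset.sum_apply, vertexEnd_apply]
  r_mul_e a := by
    refine LinearMap.ext fun g => funext fun j => ?_
    rw [Module.End.mul_apply]
    by_cases h : ∃ i, G.Step i ⟨a, true⟩ j
    · obtain ⟨i, h⟩ := h
      rw [G.arrowEnd_apply h, G.arrowEnd_apply h, vertexEnd_apply,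
        if_pos (show G.v i = a.left from (G.src _ _ _ h).symm)]
    · rw [G.arrowEnd_apply_of_not h, G.arrowEnd_apply_of_not h]
  e_mul_r a := by
    refine LinearMap.ext fun g => funext fun j => ?_
    rw [Module.End.mul_apply, vertexEnd_apply]
    by_cases h : ∃ i, G.Step i ⟨a, true⟩ j
    · obtain ⟨i, h⟩ := h
      rw [if_pos (show G.v j = a.right from (G.tgt h).symm)]
    · rw [G.arrowEnd_apply_of_not h, ite_self]
  rel a b hr := by
    refine LinearMap.ext fun g => funext fun m => ?_
    rw [Module.End.mul_apply]
    by_cases h : ∃ j, G.Step j ⟨b, true⟩ m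
    · obtain ⟨j, h⟩ := h
      rw [G.arrowEnd_apply h, G.arrowEnd_apply_of_not fun ⟨i, hi⟩ => G.not_rel hi h hr]
      rfl
    · rw [G.arrowEnd_apply_of_not h]
      rfl

theorem rep_r : (G.rep k).r = G.arrowEnd k := rfl

theorem rep_e : (G.rep k).e = G.vertexEnd k := rfl

theorem e_single [DecidableEq ι] (x : V) (i : ι) [Decidable (G.v i = x)] :
    (G.rep k).e x (Pi.single i 1) = if G.v i = x then Pi.single i 1 else 0 := by
  classical
  funext j
  rw [rep_e, vertexEnd_apply]
  by_cases hij : j = i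
  · subst hij
    split_ifs <;> simp
  · split_ifs <;> simp [hij]

theorem r_single [DecidableEq ι] {a : Quiver.Total V} {i j : ι} (h : G.Step i ⟨a, true⟩ j) :
    (G.rep k).r a (Pi.single i 1) = Pi.single j 1 := by
  funext j'
  rw [rep_r]
  by_cases h' : ∃ i', G.Step i' ⟨a, true⟩ j'
  · obtain ⟨i', h'⟩ := h'
    rw [G.arrowEnd_apply h']
    by_cases hi : i' = i
    · subst hi
      obtain rfl := G.target_unique h h'
      simp
    · have : j' ≠ j := by
        rintro rfl
        exact hi (G.source_unique h' h)
      simp [hi, this]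
  · rw [G.arrowEnd_apply_of_not h']
    have : j' ≠ j := by
      rintro rfl
      exact h' ⟨i, h⟩
    simp [this]

theorem r_single_of_not [DecidableEq ι] {a : Quiver.Total V} {i : ι}
    (h : ¬ ∃ j, G.Step i ⟨a, true⟩ j) : (G.rep k).r a (Pi.single i 1) = 0 := by
  funext j'
  rw [rep_r]
  by_cases h' : ∃ i', G.Step i' ⟨a, true⟩ j'
  · obtain ⟨i', h'⟩ := h'
    rw [G.arrowEnd_apply h']
    have : i' ≠ i := by
      rintro rfl
      exact h ⟨_, h'⟩
    simp [this]
  · rw [G.arrowEnd_apply_of_not h']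
    rfl

/-! ### Homomorphisms out of and into graph representations -/

section Homs

variable {U : Type*} [AddCommGroup U] [Module k U] (R : Rep P k U)

/-- A family of vectors that defines a homomorphism from the representation of a graph. -/
structure IsVectorFamily (m : ι → U) : Prop where
  vertex : ∀ i, R.e (G.v i) (m i) = m i
  step : ∀ i a j, G.Step i ⟨a, true⟩ j → R.r a (m i) = m j
  halt : ∀ i a, a.left = G.v i → (¬ ∃ l j, G.Step i l j ∧ P.lsrc l = P.lsrc ⟨a, true⟩) →
    R.r a (m i) = 0

/-- A family of functionals that defines a homomorphism to the representation of a graph. -/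
structure IsFunctionalFamily (f : ι → U →ₗ[k] k) : Prop where
  vertex : ∀ i u, f i (R.e (G.v i) u) = f i u
  step : ∀ i a j, G.Step i ⟨a, true⟩ j → ∀ u, f j (R.r a u) = f i u
  halt : ∀ i a, a.right = G.v i → (¬ ∃ l j, G.Step i l j ∧ P.lsrc l = P.lsrc ⟨a, false⟩) →
    ∀ u, f i (R.r a u) = 0

variable {G R}

/-- The delicate case is an arrow `a` starting at the vertex of `i` without a step along it. Either
some `b` enters `i` on that side and `m i` is killed by the relation between `b` and `a`, or the
side is free and `halt` applies. -/
theorem IsVectorFamily.isHom [Fintype ι] {m : ι → U} (h : G.IsVectorFamily R m) :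
    Rep.IsHom (G.rep k) R (Fintype.linearCombination k m) := by
  classical
  constructor
  · intro x u
    have : Fintype.linearCombination k m ∘ₗ (G.rep k).e x = R.e x ∘ₗ Fintype.linearCombination k m := by
      refine LinearMap.pi_ext' fun i => LinearMap.ext_ring ?_
      simp only [LinearMap.comp_apply, LinearMap.single_apply, e_single,
        Fintype.linearCombination_apply_single, one_smul]
      split_ifs with hx
      · subst hx
        rw [Fintype.linearCombination_apply_single, one_smul, h.vertex]
      · rw [map_zero, ← h.vertex i, R.e_apply_ne (Ne.symm hx)]
    exact LinearMap.congr_fun this u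
  · intro a u
    have : Fintype.linearCombination k m ∘ₗ (G.rep k).r a = R.r a ∘ₗ Fintype.linearCombination k m := by
      refine LinearMap.pi_ext' fun i => LinearMap.ext_ring ?_
      simp only [LinearMap.comp_apply, LinearMap.single_apply,
        Fintype.linearCombination_apply_single, one_smul]
      by_cases hs : ∃ j, G.Step i ⟨a, true⟩ j
      · obtain ⟨j, hs⟩ := hs
        rw [G.r_single hs, Fintype.linearCombination_apply_single, one_smul, h.step _ _ _ hs]
      · rw [G.r_single_of_not hs, map_zero]
        by_cases hv : a.left = G.v i
        · by_cases hl : ∃ l j, G.Step i l j ∧ P.lsrc l = P.lsrc ⟨a, true⟩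
          · obtain ⟨⟨b, d⟩, j, hl, he⟩ := hl
            cases d
            · have hb := h.step _ _ _ (G.symm _ _ _ hl)
              rw [← hb, R.r_apply_r]
              rw [P.rel_iff_lsrc, ← he]
              rfl
            · have hab : (⟨b, true⟩ : Letter V) = ⟨a, true⟩ := P.lsrc_inj rfl he
              obtain rfl : b = a := congrArg Letter.arrow hab
              exact absurd ⟨j, hl⟩ hs
          · exact (h.halt _ _ hv hl).symm
        · rw [← h.vertex i, R.r_apply_e_ne hv]
    exact LinearMap.congr_fun this u

theorem IsFunctionalFamily.isHom {f : ι → U →ₗ[k] k} (h : G.IsFunctionalFamily R f) :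
    Rep.IsHom R (G.rep k) (LinearMap.pi f) := by
  classical
  constructor
  · intro x u
    funext i
    rw [rep_e, vertexEnd_apply, LinearMap.pi_apply, LinearMap.pi_apply]
    split_ifs with hx
    · subst hx
      rw [h.vertex]
    · rw [← h.vertex, R.e_apply_ne hx, map_zero]
  · intro a u
    funext j
    rw [rep_r, LinearMap.pi_apply]
    by_cases hs : ∃ i, G.Step i ⟨a, true⟩ j
    · obtain ⟨i, hs⟩ := hs
      rw [G.arrowEnd_apply hs, LinearMap.pi_apply, h.step _ _ _ hs]
    · rw [G.arrowEnd_apply_of_not hs]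
      by_cases hv : a.right = G.v j
      · by_cases hl : ∃ l i, G.Step j l i ∧ P.lsrc l = P.lsrc ⟨a, false⟩
        · obtain ⟨⟨b, d⟩, i, hl, he⟩ := hl
          cases d
          · have hab : (⟨b, false⟩ : Letter V) = ⟨a, false⟩ := P.lsrc_inj rfl he
            obtain rfl : b = a := congrArg Letter.arrow hab
            exact absurd ⟨i, G.symm _ _ _ hl⟩ hs
          · rw [← h.step _ _ _ hl, R.r_apply_r, map_zero]
            rw [P.rel_iff_lsrc, he]
            rfl
        · exact h.halt _ _ hv hl u
      · rw [← h.vertex, R.e_apply_r_ne (Ne.symm hv), map_zero]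

end Homs

/-! ### Endomorphisms -/

variable [DecidableEq ι] {θ : (ι → k) →ₗ[k] (ι → k)}

theorem coeff_vertex (hθ : Rep.IsHom (G.rep k) (G.rep k) θ) {i j : ι}
    (h : θ (Pi.single i 1) j ≠ 0) : G.v j = G.v i := by
  classical
  by_contra hv
  apply h
  have := congrFun (hθ.1 (G.v i) (Pi.single i 1)) j
  rw [e_single, if_pos rfl, rep_e, vertexEnd_apply, if_neg hv] at this
  exact this

/-- Commuting with an arrow makes the matrix coefficients constant when both positions move along
the same letter. -/
theorem coeff_step (hθ : Rep.IsHom (G.rep k) (G.rep k) θ) {i j i' j' : ι} {l : Letter V}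
    (h : G.Step i l i') (h' : G.Step j l j') :
    θ (Pi.single i' 1) j' = θ (Pi.single i 1) j := by
  have key : ∀ {i j i' j' : ι} {a : Quiver.Total V}, G.Step i ⟨a, true⟩ i' →
      G.Step j ⟨a, true⟩ j' → θ (Pi.single i' 1) j' = θ (Pi.single i 1) j := by
    intro i j i' j' a h h'
    have := congrFun (hθ.2 a (Pi.single i 1)) j'
    rwa [G.r_single h, rep_r, G.arrowEnd_apply h'] at this
  obtain ⟨a, d⟩ := l
  cases d
  · exact (key (G.symm _ _ _ h) (G.symm _ _ _ h')).symm
  · exact key h h'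

/-- The basis vector at `i` is in the image of `a`, hence so is its image under `θ`; elements of
that image have no component at `j`. -/
theorem coeff_eq_zero_of_low (hθ : Rep.IsHom (G.rep k) (G.rep k) θ) {i j i' : ι}
    {a : Quiver.Total V} (h : G.Step i ⟨a, false⟩ i') (h' : ¬ ∃ j', G.Step j ⟨a, false⟩ j') :
    θ (Pi.single i 1) j = 0 := by
  have := congrFun (hθ.2 a (Pi.single i' 1)) j
  rwa [G.r_single (G.symm _ _ _ h), rep_r,
    G.arrowEnd_apply_of_not fun ⟨j', hj⟩ => h' ⟨j', G.symm _ _ _ hj⟩] at this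

/-- The arrow `a` kills the basis vector at `i`, hence its image under `θ`, but it carries the
component at `j` injectively to `j'`. -/
theorem coeff_eq_zero_of_high (hθ : Rep.IsHom (G.rep k) (G.rep k) θ) {i j j' : ι}
    {a : Quiver.Total V} (h : G.Step j ⟨a, true⟩ j') (h' : ¬ ∃ i', G.Step i ⟨a, true⟩ i') :
    θ (Pi.single i 1) j = 0 := by
  have := congrFun (hθ.2 a (Pi.single i 1)) j'
  rw [G.r_single_of_not h', map_zero, rep_r, G.arrowEnd_apply h] at this
  exact this.symm

/-- A nonzero coefficient propagates along the common beginning of the two tails. Where they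
separate, the two vanishing lemmas leave only the order inverse letter, end of word, direct letter;
the ranks 0, 1, 2 record it. Thus endomorphisms are triangular for this order. -/
theorem Tail.ranks_le (hθ : Rep.IsHom (G.rep k) (G.rep k) θ) {i j : ι} {p : State V} {c d : Word V}
    (hc : G.Tail i p c) (hd : G.Tail j p d) (h : θ (Pi.single i 1) j ≠ 0) :
    Word.ranks d ≤ Word.ranks c := by
  induction c generalizing i j p d with
  | nil =>
    cases d with
    | nil => exact le_rfl
    | cons m d =>
      obtain ⟨hm, j', hj, -⟩ := hd
      obtain ⟨a, e⟩ := m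
      cases e
      · exact le_of_lt (List.Lex.rel (by simp [Letter.rank]))
      · exact absurd (G.coeff_eq_zero_of_high hθ hj fun ⟨i', hi⟩ => hc ⟨_, _, hi, hm⟩) h
  | cons l c ih =>
    obtain ⟨hl, i', hi, hc⟩ := hc
    cases d with
    | nil =>
      obtain ⟨a, e⟩ := l
      cases e
      · exact absurd (G.coeff_eq_zero_of_low hθ hi fun ⟨j', hj⟩ => hd ⟨_, _, hj, hl⟩) h
      · exact le_of_lt (List.Lex.rel (by simp [Letter.rank]))
    | cons m d =>
      obtain ⟨hm, j', hj, hd⟩ := hd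
      by_cases hdir : l.dir = m.dir
      · obtain rfl := P.lsrc_inj hdir (hl.trans hm.symm)
        have h2 := ih hc hd (by rwa [G.coeff_step hθ hi hj])
        simp only [Word.ranks, List.map_cons, List.cons_append]
        exact List.cons_le_cons _ h2
      · obtain ⟨a, e⟩ := l
        obtain ⟨b, f⟩ := m
        cases e <;> cases f
        · exact absurd rfl hdir
        · refine absurd (G.coeff_eq_zero_of_low hθ hi fun ⟨j'', hj''⟩ => ?_) h
          have := (G.unique _ _ _ _ _ hj'' hj (hl.trans hm.symm)).1
          exact absurd (congrArg Letter.dir this) (by simp)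
        · exact le_of_lt (List.Lex.rel (by simp [Letter.rank]))
        · exact absurd rfl hdir

/-- An endomorphism of the representation of a rigid graph is injective if its diagonal coefficients
do not vanish. -/
theorem injective_of_diag [Fintype ι] (hθ : Rep.IsHom (G.rep k) (G.rep k) θ) (c : ι → Bool → Word V)
    (hc : ∀ i s, G.Tail i (G.v i, s) (c i s))
    (hrigid : ∀ i j, G.v i = G.v j → (∀ s, c i s = c j s) → i = j)
    (hdiag : ∀ i, θ (Pi.single i 1) i ≠ 0) : Function.Injective θ := by
  classical
  rw [← LinearMap.ker_eq_bot, LinearMap.ker_eq_bot']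
  intro g hg
  by_contra hne
  obtain ⟨i₀, hi₀⟩ := Function.ne_iff.1 hne
  -- A total preorder on the positions by their two tails. At a position maximal in the support of
  -- `g`, only the diagonal coefficient contributes to `θ g`.
  let key : ι → Lex (List ℕ × List ℕ) := fun i =>
    toLex (Word.ranks (c i true), Word.ranks (c i false))
  obtain ⟨i, hi, hmax⟩ := Finset.exists_max_image (Finset.univ.filter fun i => g i ≠ 0) key
    ⟨i₀, by simpa using hi₀⟩
  simp only [Finset.mem_filter, Finset.mem_univ, true_and] at hi hmax
  have hsum : θ g = ∑ j, g j • θ (Pi.single j 1) := by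
    conv_lhs => rw [pi_eq_sum_univ' g]
    rw [map_sum]
    refine Finset.sum_congr rfl fun j _ => ?_
    rw [map_smul]
  have h0 : θ g i = g i * θ (Pi.single i 1) i := by
    rw [hsum, Finset.sum_apply, Finset.sum_eq_single i]
    · rfl
    · intro j _ hj
      by_cases hgj : g j = 0
      · simp [hgj]
      · by_cases hθj : θ (Pi.single j 1) i = 0
        · simp [hθj]
        · exfalso
          have hv := G.coeff_vertex hθ hθj
          have h1 : ∀ s, Word.ranks (c i s) ≤ Word.ranks (c j s) := fun s =>
            Tail.ranks_le G hθ (hc j s) (by rw [← hv]; exact hc i s) hθj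
          have h2 := hmax j hgj
          have h3 : key i ≤ key j := Prod.Lex.toLex_mono ⟨h1 true, h1 false⟩
          have h4 : key i = key j := le_antisymm h3 h2
          have h5 : (Word.ranks (c i true), Word.ranks (c i false)) =
            (Word.ranks (c j true), Word.ranks (c j false)) := toLex_inj.1 h4
          rw [Prod.mk.injEq] at h5
          refine hj (hrigid i j hv fun s => ?_).symm
          refine Tail.eq_of_ranks G (hc i s) (by rw [hv]; exact hc j s) ?_
          cases s
          · exact h5.2
          · exact h5.1
    · simp
  rw [hg] at h0
  exact mul_ne_zero hi (hdiag i) h0.symm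

end StepGraph

/-! ### String modules -/

namespace Word

variable {V : Type u} [Quiver.{v} V]

@[simp] theorem length_inv (w : Word V) : (inv w).length = w.length := by simp [inv]

theorem getElem?_inv {w : Word V} {i : ℕ} (h : i < w.length) :
    (inv w)[i]? = (w[w.length - 1 - i]?).map Letter.inv := by
  rw [inv, List.getElem?_reverse (by simpa using h), List.getElem?_map, List.length_map]

end Word

namespace Polarization

variable {V : Type u} [Quiver.{v} V] (P : Polarization V)

/-- The states passed by a word that starts at `p`. -/
def states : State V → Word V → ℕ → State V
  | p, [], _ => p
  | p, _ :: _, 0 => p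
  | _, l :: w, n + 1 => states (P.ltgt l) w n

variable {P} {p q : State V} {w : Word V}

@[simp] theorem states_zero : P.states p w 0 = p := by cases w <;> rfl

theorem Walk.take (h : P.Walk p w q) (i : ℕ) : P.Walk p (w.take i) (P.states p w i) := by
  induction w generalizing p i with
  | nil => rw [List.take_nil]; rfl
  | cons l w ih =>
    cases i with
    | zero => rfl
    | succ i => exact ⟨h.1, ih h.2 i⟩

theorem Walk.drop (h : P.Walk p w q) (i : ℕ) : P.Walk (P.states p w i) (w.drop i) q := by
  have h1 := h.take i
  have h2 := h
  rw [← List.take_append_drop i w, walk_append] at h2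
  obtain ⟨s, h2, h3⟩ := h2
  rwa [h1.end_unique h2]

theorem Walk.lsrc_eq (h : P.Walk p w q) {i : ℕ} {l : Letter V} (hi : w[i]? = some l) :
    P.lsrc l = P.states p w i ∧ P.ltgt l = P.states p w (i + 1) := by
  induction w generalizing p i with
  | nil => simp at hi
  | cons m w ih =>
    cases i with
    | zero =>
      obtain rfl : m = l := by simpa using hi
      exact ⟨h.1, by simp [states]⟩
    | succ i => exact ih h.2 (by simpa using hi)

/-- Consecutive letters of a walk are not inverse to each other. -/
theorem Walk.ne_inv (h : P.Walk p w q) {i : ℕ} {l m : Letter V} (hi : w[i]? = some l)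
    (hj : w[i + 1]? = some m) : m ≠ l.inv := by
  rintro rfl
  have h1 := (h.lsrc_eq hi).2
  have h2 := (h.lsrc_eq hj).1
  rw [P.lsrc_inv, h1] at h2
  exact State.bar_ne _ h2

theorem Walk.append_self {p q : State V} {w : Word V} (hw : w ≠ []) (h : P.Walk p (w ++ w) q) :
    P.Walk p w p := by
  rw [walk_append] at h
  obtain ⟨s, h1, h2⟩ := h
  obtain rfl := h1.start_unique hw h2
  exact h1

theorem walk_pow {p : State V} {w : Word V} (h : P.Walk p w p) (m : ℕ) : P.Walk p (w.pow m) p := by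
  induction m with
  | zero => rfl
  | succ m ih =>
    rw [Word.pow, List.replicate_succ, List.flatten_cons]
    exact h.append ih

theorem _root_.BoundQuiver.Word.length_pow (w : Word V) (m : ℕ) :
    (w.pow m).length = m * w.length := by
  simp [Word.pow]

/-- The graph of a string: its positions are lined up along the string. -/
def Walk.graph (h : P.Walk p w q) : StepGraph P (Fin (w.length + 1)) where
  v i := (P.states p w i).1
  Step i l j := (w[(i : ℕ)]? = some l ∧ (j : ℕ) = i + 1) ∨
    (w[(j : ℕ)]? = some l.inv ∧ (i : ℕ) = j + 1)
  symm i l j hs := by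
    rcases hs with hs | hs
    · exact Or.inr (by simpa using hs)
    · exact Or.inl hs
  src i l j hs := by
    rcases hs with hs | hs
    · rw [← (h.lsrc_eq hs.1).1, lsrc_fst]
    · rw [hs.2, ← (h.lsrc_eq hs.1).2, ltgt_fst, Letter.inv_tgt]
  unique i l j l' j' hs hs' he := by
    have key : ∀ {i j : Fin (w.length + 1)} {l : Letter V}, w[(j : ℕ)]? = some l.inv ∧
        (i : ℕ) = j + 1 → P.lsrc l = (P.states p w i).bar := by
      intro i j l hs
      rw [hs.2, ← (h.lsrc_eq hs.1).2, ltgt_inv, State.bar_bar]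
    rcases hs with hs | hs <;> rcases hs' with hs' | hs'
    · refine ⟨?_, Fin.ext (hs.2.trans hs'.2.symm)⟩
      have := hs.1.symm.trans hs'.1
      simpa using this
    · rw [key hs', (h.lsrc_eq hs.1).1] at he
      exact absurd he.symm (State.bar_ne _)
    · rw [key hs, (h.lsrc_eq hs'.1).1] at he
      exact absurd he (State.bar_ne _)
    · have hj : j = j' := Fin.ext (by have := hs.2.symm.trans hs'.2; omega)
      subst hj
      refine ⟨?_, rfl⟩
      have := hs.1.symm.trans hs'.1
      rw [Option.some_inj] at this
      rw [← l.inv_inv, this, Letter.inv_inv]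

theorem Walk.graph_lsrc (h : P.Walk p w q) {i j : Fin (w.length + 1)} {l : Letter V}
    (hs : h.graph.Step i l j) (hl : P.lsrc l = P.states p w i) :
    w[(i : ℕ)]? = some l ∧ (j : ℕ) = i + 1 := by
  rcases hs with hs | hs
  · exact hs
  · rw [hs.2, ← (h.lsrc_eq hs.1).2, ltgt_inv] at hl
    exact absurd hl.symm (State.bar_ne _)

theorem Walk.graph_lsrc_bar (h : P.Walk p w q) {i j : Fin (w.length + 1)} {l : Letter V}
    (hs : h.graph.Step i l j) (hl : P.lsrc l = (P.states p w i).bar) :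
    w[(j : ℕ)]? = some l.inv ∧ (i : ℕ) = j + 1 := by
  rcases hs with hs | hs
  · rw [(h.lsrc_eq hs.1).1] at hl
    exact absurd hl.symm (State.bar_ne _)
  · exact hs

/-- Together with `Walk.tail_take` this identifies the two tails at a position: the rest of the
word, and the inverse of the part already read. -/
theorem Walk.tail_drop (h : P.Walk p w q) (c : Word V) (i : Fin (w.length + 1))
    (hc : w.drop i = c) : h.graph.Tail i (P.states p w i) c := by
  induction c generalizing i with
  | nil =>
    rintro ⟨l, j, hs, hl⟩
    have := (h.graph_lsrc hs hl).1
    rw [List.drop_eq_nil_iff] at hc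
    rw [List.getElem?_eq_none hc] at this
    simp at this
  | cons l c ih =>
    have hlt : (i : ℕ) < w.length := by
      by_contra hlt
      rw [List.drop_eq_nil_iff.2 (by omega)] at hc
      simp at hc
    have hl : w[(i : ℕ)]? = some l := by
      have := congrArg (fun d : Word V => d[0]?) hc
      simpa using this
    refine ⟨(h.lsrc_eq hl).1, ⟨i + 1, by omega⟩, Or.inl ⟨hl, rfl⟩, ?_⟩
    rw [(h.lsrc_eq hl).2]
    refine ih ⟨i + 1, by omega⟩ ?_
    have := congrArg List.tail hc
    simpa using this

theorem Walk.tail_take (h : P.Walk p w q) (i : ℕ) (hi : i < w.length + 1) :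
    h.graph.Tail ⟨i, hi⟩ (P.states p w i).bar (Word.inv (w.take i)) := by
  induction i with
  | zero =>
    rintro ⟨l, j, hs, hl⟩
    have := (h.graph_lsrc_bar hs hl).2
    simp at this
  | succ i ih =>
    have hlt : i < w.length := by omega
    have hl : w[i]? = some w[i] := List.getElem?_eq_getElem hlt
    have : Word.inv (w.take (i + 1)) = w[i].inv :: Word.inv (w.take i) := by
      rw [List.take_add_one, hl, Option.toList_some, Word.inv, List.map_append, List.reverse_append]
      rfl
    rw [this]
    refine ⟨by rw [lsrc_inv, (h.lsrc_eq hl).2], ⟨i, by omega⟩, Or.inr ⟨by simp, rfl⟩, ?_⟩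
    rw [ltgt_inv, (h.lsrc_eq hl).1]
    exact ih _

/-- The segment between `i` and `j` would be its own inverse. At its middle there would be two
consecutive mutually inverse letters (even length) or a letter equal to its inverse (odd length). -/
theorem Walk.not_palindromic (h : P.Walk p w q) {i j : ℕ} (hij : i < j) (hn : i + j = w.length)
    (he : w.drop i = Word.inv (w.take j)) : False := by
  have key : ∀ t, t < j → w[i + t]? = (w[j - 1 - t]?).map Letter.inv := by
    intro t ht
    have hlen : (w.take j).length = j := by
      rw [List.length_take]
      omega
    have h1 := congrArg (fun d : Word V => d[t]?) he
    rw [List.getElem?_drop, Word.getElem?_inv (by omega), hlen, List.getElem?_take_of_lt (by omega)] at h1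
    exact h1
  rcases Nat.even_or_odd' (j - i) with ⟨t, ht | ht⟩
  · have h1 := key t (by omega)
    have e1 : i + t = (j - 1 - t) + 1 := by omega
    have h2 : w[j - 1 - t]? = some w[j - 1 - t] := List.getElem?_eq_getElem (by omega)
    rw [h2, e1] at h1
    exact h.ne_inv h2 h1 rfl
  · have h1 := key t (by omega)
    have e1 : i + t = j - 1 - t := by omega
    have h2 : w[j - 1 - t]? = some w[j - 1 - t] := List.getElem?_eq_getElem (by omega)
    rw [e1, h2] at h1
    simp only [Option.map_some, Option.some_inj] at h1
    exact Letter.inv_ne _ h1.symm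

/-- If two positions carry the same state, the lengths of the tails separate them. If the states are
opposite, equal tails would produce a palindromic segment. -/
theorem Walk.rigid (h : P.Walk p w q) {i j : Fin (w.length + 1)}
    (hv : (P.states p w i).1 = (P.states p w j).1)
    (hc : ∀ s : Bool, (if s = (P.states p w i).2 then w.drop i else Word.inv (w.take i)) =
      if s = (P.states p w j).2 then w.drop j else Word.inv (w.take j)) : i = j := by
  have hi := i.2
  have hj := j.2
  rcases State.eq_or_eq_bar hv with hs | hs
  · have h1 := hc (P.states p w i).2
    rw [if_pos rfl, if_pos (congrArg Prod.snd hs)] at h1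
    have := congrArg List.length h1
    simp only [List.length_drop] at this
    exact Fin.ext (by omega)
  · have h1 := hc (P.states p w i).2
    have h2 := hc (P.states p w j).2
    have hne : (P.states p w i).2 ≠ (P.states p w j).2 := by
      rw [hs]
      simp
    rw [if_pos rfl, if_neg hne] at h1
    rw [if_pos rfl, if_neg hne.symm] at h2
    have hlen := congrArg List.length h1
    simp only [List.length_drop, Word.length_inv, List.length_take] at hlen
    rcases lt_trichotomy (i : ℕ) j with hlt | heq | hgt
    · exact (h.not_palindromic hlt (by omega) h1).elim
    · rw [heq] at hs
      exact absurd hs.symm (State.bar_ne _)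
    · exact (h.not_palindromic hgt (by omega) h2.symm).elim

variable {k : Type w} [Field k] [Fintype V]

/-- An endomorphism of a string module is bijective if its first diagonal coefficient does not
vanish. -/
theorem Walk.bijective_of_diag (h : P.Walk p w q)
    {θ : (Fin (w.length + 1) → k) →ₗ[k] (Fin (w.length + 1) → k)}
    (hθ : Rep.IsHom (h.graph.rep k) (h.graph.rep k) θ) (h0 : θ (Pi.single 0 1) 0 ≠ 0) :
    Function.Bijective θ := by
  -- All diagonal coefficients are equal: apply `coeff_step` with both positions moving along `w`
  -- together.
  have hdiag : ∀ i (hi : i < w.length + 1), θ (Pi.single ⟨i, hi⟩ 1) ⟨i, hi⟩ ≠ 0 := by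
    intro i
    induction i with
    | zero => exact fun _ => h0
    | succ i ih =>
      intro hi
      have hlt : i < w.length := by omega
      have hs : h.graph.Step ⟨i, by omega⟩ w[i] ⟨i + 1, hi⟩ :=
        Or.inl ⟨List.getElem?_eq_getElem hlt, rfl⟩
      rw [h.graph.coeff_step hθ hs hs]
      exact ih _
  have hinj : Function.Injective θ := by
    refine h.graph.injective_of_diag hθ (fun i s => if s = (P.states p w i).2 then w.drop i else
      Word.inv (w.take i)) (fun i s => ?_) (fun i j hv hc => h.rigid hv hc) fun i => hdiag i i.2
    split_ifs with hs
    · rw [hs]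
      exact h.tail_drop _ i rfl
    · have hs' : s = !(P.states p w i).2 := by
        revert hs
        cases s <;> cases (P.states p w i).2 <;> simp
      rw [hs']
      exact h.tail_take i i.2
  exact ⟨hinj, LinearMap.injective_iff_surjective.1 hinj⟩

end Polarization

/-! ### Modules and representations -/

namespace Rep

variable {V : Type u} [Quiver.{v} V] [Fintype V] {P : Polarization V} {k : Type w} [Field k]
  {U U₁ : Type*} [AddCommGroup U] [Module k U] [AddCommGroup U₁] [Module k U₁]

/-- The representation given by an action of the path algebra that kills the zero relations. -/
def ofAlgHom (F : PathAlgebra k V →ₐ[k] Module.End k U) (hF : ∀ f ∈ P.ideal k, F f = 0) :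
    Rep P k U where
  e x := F (idem k x)
  r a := F (ofArrow k a)
  e_mul_e x := by rw [← map_mul, idem_mul_idem]
  e_mul_e_ne x y h := by rw [← map_mul, idem_mul_idem_ne h, map_zero]
  e_sum := by rw [← map_sum, ← one_eq_sum_idem, map_one]
  r_mul_e a := by rw [← map_mul, ofArrow_mul_idem]
  e_mul_r a := by rw [← map_mul, idem_mul_ofArrow]
  rel a b h := by
    rw [← map_mul]
    exact hF _ (TwoSidedIdeal.subset_span ⟨a, b, h, rfl⟩)

theorem toAlgHom_ofPath (R : Rep P k U) {a b : V} (p : Quiver.Path a b) :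
    R.toAlgHom (ofPath k ⟨a, b, p⟩) = R.path p := R.toLin_ofPath _

theorem ofAlgHom_path (F : PathAlgebra k V →ₐ[k] Module.End k U) (hF : ∀ f ∈ P.ideal k, F f = 0)
    {a b : V} (p : Quiver.Path a b) : (ofAlgHom F hF).path p = F (ofPath k ⟨a, b, p⟩) := by
  induction p with
  | nil => rfl
  | cons p e ih =>
    rw [ofPath_cons, map_mul, path, ih]
    rfl

theorem toAlgHom_ofAlgHom (F : PathAlgebra k V →ₐ[k] Module.End k U)
    (hF : ∀ f ∈ P.ideal k, F f = 0) (f : PathAlgebra k V) : (ofAlgHom F hF).toAlgHom f = F f := by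
  induction f using pathAlgebra_induction with
  | zero => simp
  | add f g hf hg => rw [map_add, map_add, hf, hg]
  | smul c f hf => rw [map_smul, map_smul, hf]
  | path p => exact ((ofAlgHom F hF).toAlgHom_ofPath p.2.2).trans (ofAlgHom_path F hF p.2.2)

theorem IsHom.path {R : Rep P k U} {R' : Rep P k U₁} {φ : U →ₗ[k] U₁} (h : IsHom R R' φ) {a b : V}
    (p : Quiver.Path a b) (u : U) : φ (R.path p u) = R'.path p (φ u) := by
  induction p with
  | nil => exact h.1 _ _
  | cons p e ih =>
    rw [Rep.path, Rep.path, Module.End.mul_apply, Module.End.mul_apply, h.2, ih]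

theorem IsHom.toAlgHom {R : Rep P k U} {R' : Rep P k U₁} {φ : U →ₗ[k] U₁} (h : IsHom R R' φ)
    (f : PathAlgebra k V) (u : U) : φ (R.toAlgHom f u) = R'.toAlgHom f (φ u) := by
  induction f using pathAlgebra_induction with
  | zero => simp
  | add f g hf hg => simp [hf, hg]
  | smul c f hf => simp [hf]
  | path p => rw [R.toAlgHom_ofPath, R'.toAlgHom_ofPath, h.path]

/-- The vector space of a representation, as a module over the bound quiver algebra. -/
def Mod (_ : Rep P k U) := U

variable (R : Rep P k U) (R' : Rep P k U₁)

instance : AddCommGroup R.Mod := inferInstanceAs (AddCommGroup U)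

instance : Module k R.Mod := inferInstanceAs (Module k U)

instance : Module (BoundAlgebra (P.ideal k)) R.Mod := Module.compHom U R.toRingHom

theorem mk_smul (f : PathAlgebra k V) (u : R.Mod) :
    ((P.ideal k).ringCon.mk' f • u : R.Mod) = R.toAlgHom f u := rfl

theorem algebraMap_smul' (c : k) (u : R.Mod) :
    (algebraMap k (BoundAlgebra (P.ideal k)) c • u : R.Mod) = c • u := by
  refine (R.mk_smul (algebraMap k _ c) u).trans ?_
  rw [AlgHom.commutes]
  rfl

instance : IsScalarTower k (BoundAlgebra (P.ideal k)) R.Mod :=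
  IsScalarTower.of_algebraMap_smul R.algebraMap_smul'

end Rep

section Modules

variable {V : Type u} [Quiver.{v} V] [Fintype V] {P : Polarization V} {k : Type w} [Field k]

/-- The representation given by a module over the bound quiver algebra. -/
def Rep.ofModule (N : Type*) [AddCommGroup N] [Module k N] [Module (BoundAlgebra (P.ideal k)) N]
    [IsScalarTower k (BoundAlgebra (P.ideal k)) N] : Rep P k N :=
  Rep.ofAlgHom ((Algebra.lsmul k k N).comp ((P.ideal k).ringCon.mkₐ (α := k))) fun f hf => by
    have : (P.ideal k).ringCon.mkₐ (α := k) f = 0 :=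
      (RingCon.eq _).2 ((TwoSidedIdeal.mem_iff _ _).1 hf)
    rw [AlgHom.comp_apply, this, map_zero]

theorem Rep.ofModule_toAlgHom (N : Type*) [AddCommGroup N] [Module k N]
    [Module (BoundAlgebra (P.ideal k)) N] [IsScalarTower k (BoundAlgebra (P.ideal k)) N]
    (f : PathAlgebra k V) (n : N) :
    (Rep.ofModule N : Rep P k N).toAlgHom f n = (P.ideal k).ringCon.mk' f • n :=
  LinearMap.congr_fun (Rep.toAlgHom_ofAlgHom _ _ f) n

/-- A representation as an object of the category of modules. -/
def Rep.toModuleCat {U : Type w} [AddCommGroup U] [Module k U] (R : Rep P k U) :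
    ModuleCat.{max u v w} (BoundAlgebra (P.ideal k)) :=
  ModuleCat.of _ (ULift.{max u v} R.Mod)

variable {U U₁ : Type w} [AddCommGroup U] [Module k U] [AddCommGroup U₁] [Module k U₁]

/-- The linear map underlying a module homomorphism between representations. -/
def Rep.homToLin {R : Rep P k U} {R' : Rep P k U₁} (f : R.toModuleCat ⟶ R'.toModuleCat) :
    U →ₗ[k] U₁ where
  toFun u := (f.hom ⟨u⟩).down
  map_add' u u' := congrArg ULift.down (f.hom.map_add (⟨u⟩ : ULift R.Mod) ⟨u'⟩)
  map_smul' c u := by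
    have h1 := congrArg ULift.down
      (f.hom.map_smul (algebraMap k (BoundAlgebra (P.ideal k)) c) (⟨u⟩ : ULift R.Mod))
    have h2 : (algebraMap k (BoundAlgebra (P.ideal k)) c • (⟨u⟩ : ULift R.Mod)) =
        ⟨(c • u : U)⟩ := congrArg ULift.up (R.algebraMap_smul' c u)
    have h3 := R'.algebraMap_smul' c (f.hom ⟨u⟩).down
    erw [h2] at h1
    exact h1.trans h3

theorem Rep.homToLin_isHom {R : Rep P k U} {R' : Rep P k U₁} (f : R.toModuleCat ⟶ R'.toModuleCat) :
    Rep.IsHom R R' (Rep.homToLin f) := by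
  have key : ∀ (g : PathAlgebra k V) (u : U),
      Rep.homToLin f (R.toAlgHom g u) = R'.toAlgHom g (Rep.homToLin f u) := fun g u =>
    congrArg ULift.down (f.hom.map_smul ((P.ideal k).ringCon.mk' g) (⟨u⟩ : ULift R.Mod))
  refine ⟨fun x u => ?_, fun a u => ?_⟩
  · rw [← R.toAlgHom_idem, ← R'.toAlgHom_idem, key]
  · rw [← R.toAlgHom_ofArrow, ← R'.toAlgHom_ofArrow, key]

theorem Rep.finite_toModuleCat [Module.Finite k U] (R : Rep P k U) :
    Module.Finite (BoundAlgebra (P.ideal k)) R.toModuleCat := by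
  have : Module.Finite k R.Mod := inferInstanceAs (Module.Finite k U)
  have : Module.Finite (BoundAlgebra (P.ideal k)) R.Mod := Module.Finite.of_restrictScalars_finite k _ _
  exact Module.Finite.equiv (ULift.moduleEquiv (R := BoundAlgebra (P.ideal k)) (M := R.Mod)).symm

theorem Rep.finrank_eq {R : Rep P k U} {R' : Rep P k U₁} (f : R.toModuleCat ≅ R'.toModuleCat) :
    Module.finrank k U = Module.finrank k U₁ := by
  refine LinearEquiv.finrank_eq (LinearEquiv.ofLinearMap (Rep.homToLin f.hom) (Rep.homToLin f.inv) ?_ ?_)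
  · refine LinearMap.ext fun u => ?_
    exact congrArg (fun g : R'.toModuleCat ⟶ R'.toModuleCat => (g.hom ⟨u⟩).down) f.inv_hom_id
  · refine LinearMap.ext fun u => ?_
    exact congrArg (fun g : R.toModuleCat ⟶ R.toModuleCat => (g.hom ⟨u⟩).down) f.hom_inv_id

theorem Rep.bijective_of_homToLin {R : Rep P k U} {R' : Rep P k U₁}
    {f : R.toModuleCat ⟶ R'.toModuleCat} (h : Function.Bijective (Rep.homToLin f)) :
    Function.Bijective f.hom := by
  constructor
  · intro x y hxy
    have := h.1 (a₁ := x.down) (a₂ := y.down) (congrArg ULift.down hxy)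
    exact congrArg ULift.up this
  · intro y
    obtain ⟨x, hx⟩ := h.2 y.down
    exact ⟨⟨x⟩, congrArg ULift.up hx⟩

/-! ### Criteria for indecomposability and splitting -/

open Limits

/-- A module is indecomposable if there is an additive function on its endomorphisms that does not
vanish on the identity and such that each endomorphism at which it does not vanish is injective. -/
theorem indecomposable_of_additive {A : Type*} [Ring A] {X : ModuleCat A} {K : Type*} [AddMonoid K]
    (χ : (X ⟶ X) → K) (h0 : χ 0 = 0) (hadd : ∀ f g, χ (f + g) = χ f + χ g) (h1 : χ (𝟙 X) ≠ 0)
    (hinj : ∀ f, χ f ≠ 0 → Mono f) : Indecomposable X := by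
  constructor
  · intro hX
    rw [IsZero.iff_id_eq_zero] at hX
    rw [hX] at h1
    exact h1 h0
  · intro Y Z f
    -- A decomposition writes the identity as a sum of two idempotents, so `χ` is nonzero on one of
    -- them. That one is mono and kills the other summand, which is therefore zero.
    have htot : f.hom ≫ (biprod.fst ≫ biprod.inl) ≫ f.inv +
        f.hom ≫ (biprod.snd ≫ biprod.inr) ≫ f.inv = 𝟙 X := by
      rw [← Preadditive.comp_add, ← Preadditive.add_comp, biprod.total]
      simp
    have hne : χ (f.hom ≫ (biprod.fst ≫ biprod.inl) ≫ f.inv) ≠ 0 ∨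
        χ (f.hom ≫ (biprod.snd ≫ biprod.inr) ≫ f.inv) ≠ 0 := by
      by_contra! hcon
      apply h1
      rw [← htot, hadd, hcon.1, hcon.2, add_zero]
    rcases hne with hne | hne
    · right
      have := hinj _ hne
      rw [IsZero.iff_id_eq_zero]
      have h2 : (biprod.inr ≫ f.inv : Z ⟶ X) = 0 := by
        rw [← cancel_mono (f.hom ≫ (biprod.fst ≫ biprod.inl) ≫ f.inv)]
        simp
      have h3 : (biprod.inr : Z ⟶ Y ⊞ Z) = 0 := by
        rw [← cancel_mono f.inv, h2, zero_comp]
      rw [← biprod.inr_snd (X := Y) (Y := Z), h3, zero_comp]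
    · left
      have := hinj _ hne
      rw [IsZero.iff_id_eq_zero]
      have h2 : (biprod.inl ≫ f.inv : Y ⟶ X) = 0 := by
        rw [← cancel_mono (f.hom ≫ (biprod.snd ≫ biprod.inr) ≫ f.inv)]
        simp
      have h3 : (biprod.inl : Y ⟶ Y ⊞ Z) = 0 := by
        rw [← cancel_mono f.inv, h2, zero_comp]
      rw [← biprod.inl_fst (X := Y) (Y := Z), h3, zero_comp]

/-- A nonzero retract of an indecomposable module is isomorphic to it. -/
theorem nonempty_iso_of_retract {A : Type*} [Ring A] {X N : ModuleCat A} (hN : Indecomposable N)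
    (hX : ¬ IsZero X) (i : X ⟶ N) (r : N ⟶ X) (h : i ≫ r = 𝟙 X) : Nonempty (N ≅ X) := by
  have hri : ∀ x, r.hom (i.hom x) = x := fun x => congrArg (fun g : X ⟶ X => g.hom x) h
  -- `N` is the direct sum of `X` and the kernel of the retraction, so the kernel is zero by
  -- indecomposability.
  let K := ModuleCat.of A (LinearMap.ker r.hom)
  let e : N ≃ₗ[A] (X × LinearMap.ker r.hom) :=
    { toFun := fun n => (r.hom n, ⟨n - i.hom (r.hom n), by simp [hri]⟩)
      invFun := fun x => i.hom x.1 + x.2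
      map_add' := fun n n' => by
        ext
        · simp
        · simp
          abel
      map_smul' := fun c n => by
        ext
        · simp
        · simp [smul_sub]
      left_inv := fun n => by simp
      right_inv := fun x => by
        have : r.hom (x.2 : N) = 0 := x.2.2
        ext
        · simp [hri, this]
        · simp [hri, this] }
  have e' : N ≅ X ⊞ K := e.toModuleIso ≪≫ (ModuleCat.biprodIsoProd X K).symm
  rcases hN.2 X K e' with h1 | h1
  · exact absurd h1 hX
  · have hs : Subsingleton (LinearMap.ker r.hom) := ModuleCat.isZero_of_iff_subsingleton.1 h1
    have hinj : Function.Injective r.hom :=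
      LinearMap.ker_eq_bot.1 ((Submodule.subsingleton_iff_eq_bot).1 hs)
    have hsurj : Function.Surjective r.hom := fun x => ⟨i.hom x, hri x⟩
    exact ⟨(LinearEquiv.ofBijective r.hom ⟨hinj, hsurj⟩).toModuleIso⟩

end Modules

namespace Polarization

variable {V : Type u} [Quiver.{v} V] [Fintype V] {P : Polarization V} (k : Type w) [Field k]
  {p q : State V} {w : Word V}

/-- The string module of a walk. -/
def Walk.module (h : P.Walk p w q) : ModuleCat.{max u v w} (BoundAlgebra (P.ideal k)) :=
  (h.graph.rep k).toModuleCat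

theorem Walk.isIso_of_diag (h : P.Walk p w q) (f : h.module k ⟶ h.module k)
    (hf : Rep.homToLin (R := h.graph.rep k) (R' := h.graph.rep k) f (Pi.single 0 1) 0 ≠ 0) :
    IsIso f := by
  have hb := Rep.bijective_of_homToLin (R := h.graph.rep k) (R' := h.graph.rep k)
    (h.bijective_of_diag (Rep.homToLin_isHom f) hf)
  exact (LinearEquiv.ofBijective f.hom hb).toModuleIso.isIso_hom

/-- The first diagonal coefficient is additive on endomorphisms, and an endomorphism on which it
does not vanish is invertible. -/
theorem Walk.indecomposable_module (h : P.Walk p w q) : Indecomposable (h.module k) := by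
  refine indecomposable_of_additive (K := k) (fun f => Rep.homToLin (R := h.graph.rep k)
    (R' := h.graph.rep k) f (Pi.single 0 1) 0) rfl (fun f g => rfl) ?_ fun f hf => ?_
  · change (Pi.single (0 : Fin (w.length + 1)) (1 : k) : _ → k) 0 ≠ 0
    simp
  · have := h.isIso_of_diag k f hf
    infer_instance

/-- A closed walk yields infinitely many indecomposable modules. -/
theorem isRepInfinite_of_walk (h : P.Walk p w p) (hw : w ≠ []) :
    IsRepInfinite (BoundAlgebra (P.ideal k)) := by
  rintro ⟨n, M, hM⟩
  have hex : ∀ m : ℕ, ∃ i, Nonempty ((walk_pow h m).module k ≅ M i) := fun m =>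
    hM _ (Rep.finite_toModuleCat _) ((walk_pow h m).indecomposable_module k)
  choose i hi using hex
  -- Two powers of `w` would have isomorphic string modules, but the `m`-th power gives dimension `m
  -- * w.length + 1`.
  obtain ⟨m, m', hne, he⟩ := Finite.exists_ne_map_eq_of_infinite i
  obtain ⟨f⟩ := hi m
  obtain ⟨g⟩ := hi m'
  rw [← he] at g
  have := Rep.finrank_eq (R := (walk_pow h m).graph.rep k) (R' := (walk_pow h m').graph.rep k)
    (f ≪≫ g.symm)
  rw [Module.finrank_fin_fun, Module.finrank_fin_fun, Word.length_pow, Word.length_pow] at this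
  have hpos : 0 < w.length := List.length_pos_iff.2 hw
  exact hne (Nat.eq_of_mul_eq_mul_right hpos (by omega))

end Polarization

/-! ### Subspaces given by words -/

namespace Polarization

variable {V : Type u} [Quiver.{v} V] {P : Polarization V}

/-- If there are no closed walks, walks lead downwards in a well-founded order. -/
theorem wellFounded_of_acyclic [Finite V] (hP : ∀ p w, P.Walk p w p → w = []) :
    WellFounded (fun q p : State V => ∃ w, w ≠ [] ∧ P.Walk p w q) := by
  have : IsTrans (State V) (fun q p : State V => ∃ w, w ≠ [] ∧ P.Walk p w q) :=
    ⟨fun a b c ⟨w, hw, h⟩ ⟨w', hw', h'⟩ => ⟨w' ++ w, by simp [hw], h'.append h⟩⟩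
  have : Std.Irrefl (fun q p : State V => ∃ w, w ≠ [] ∧ P.Walk p w q) :=
    ⟨fun a ⟨w, hw, h⟩ => hw (hP _ _ h)⟩
  exact Finite.wellFounded_of_trans_of_irrefl _

/-- Induction along the well-founded order on states: a nonempty walk is one of finitely many
letters followed by a walk from a lower state. -/
theorem finite_walks [Finite V] [Finite (Quiver.Total V)] (hP : ∀ p w, P.Walk p w p → w = []) :
    Finite {x : State V × Word V // ∃ q, P.Walk x.1 x.2 q} := by
  have hfin : Finite (Letter V) :=
    Finite.of_injective (fun l : Letter V => (l.arrow, l.dir)) fun l m h => by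
      obtain ⟨a, d⟩ := l
      obtain ⟨b, e⟩ := m
      simpa using h
  have key : ∀ p, {w : Word V | ∃ q, P.Walk p w q}.Finite := by
    intro p
    induction p using (wellFounded_of_acyclic hP).induction with
    | _ p ih =>
      have hsub : {w : Word V | ∃ q, P.Walk p w q} ⊆ {[]} ∪ ⋃ l ∈ {l : Letter V | P.lsrc l = p},
          List.cons l '' {w : Word V | ∃ q, P.Walk (P.ltgt l) w q} := by
        rintro w ⟨q, hw⟩
        cases w with
        | nil => exact Or.inl rfl
        | cons l w =>
          right
          simp only [Set.mem_iUnion]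
          exact ⟨l, hw.1, w, ⟨q, hw.2⟩, rfl⟩
      refine Set.Finite.subset ((Set.finite_singleton _).union
        (Set.Finite.biUnion (Set.toFinite _) fun l hl => ?_)) hsub
      exact (ih _ ⟨[l], by simp, hl, rfl⟩).image _
  have : {x : State V × Word V | ∃ q, P.Walk x.1 x.2 q}.Finite := by
    refine Set.Finite.subset (Set.finite_iUnion fun p => (key p).image (Prod.mk p)) ?_
    rintro ⟨p, w⟩ hw
    simp only [Set.mem_iUnion]
    exact ⟨p, w, hw, rfl⟩
  exact this

end Polarization

namespace Rep

variable {V : Type u} [Quiver.{v} V] [Fintype V] {P : Polarization V} {k : Type w} [Field k]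
  {U : Type*} [AddCommGroup U] [Module k U] (R : Rep P k U)

/-- The vectors at a vertex. -/
def atVertex (x : V) : Submodule k U where
  carrier := {u | R.e x u = u}
  add_mem' h h' := by
    simp only [Set.mem_ofPred_eq] at *
    rw [map_add, h, h']
  zero_mem' := map_zero _
  smul_mem' c u h := by
    simp only [Set.mem_ofPred_eq] at *
    rw [map_smul, h]

/-- The vectors at a state killed by the outgoing arrow. -/
def kerAt (p : State V) : Submodule k U where
  carrier := {u | R.e p.1 u = u ∧ ∀ a, P.lsrc ⟨a, true⟩ = p → R.r a u = 0}
  add_mem' h h' := by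
    simp only [Set.mem_ofPred_eq] at *
    exact ⟨by rw [map_add, h.1, h'.1], fun a ha => by rw [map_add, h.2 a ha, h'.2 a ha, add_zero]⟩
  zero_mem' := ⟨map_zero _, fun _ _ => map_zero _⟩
  smul_mem' c u h := by
    simp only [Set.mem_ofPred_eq] at *
    exact ⟨by rw [map_smul, h.1], fun a ha => by rw [map_smul, h.2 a ha, smul_zero]⟩

/-- The image of the arrow coming in at a state. -/
def imAt (p : State V) : Submodule k U :=
  ⨆ (b : Quiver.Total V) (_ : P.lsrc ⟨b, false⟩ = p), LinearMap.range (R.r b)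

variable {R}

/-- The supremum that defines `imAt` has at most one term; this form also covers the sides without
an incoming arrow, where it is zero. -/
theorem imAt_eq {p : State V} {b : Quiver.Total V} (hb : P.lsrc ⟨b, false⟩ = p) :
    R.imAt p = LinearMap.range (R.r b) := by
  refine le_antisymm (iSup₂_le fun c hc => ?_) (le_iSup₂_of_le b hb le_rfl)
  have h : (⟨c, false⟩ : Letter V) = ⟨b, false⟩ := P.lsrc_inj rfl (hc.trans hb.symm)
  obtain rfl : c = b := congrArg Letter.arrow h
  exact le_rfl

theorem imAt_eq_bot {p : State V} (hb : ¬ ∃ b, P.lsrc ⟨b, false⟩ = p) : R.imAt p = ⊥ :=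
  le_bot_iff.1 (iSup₂_le fun b h => absurd ⟨b, h⟩ hb)

/-- The incoming and the outgoing arrow on one side compose to a zero relation. -/
theorem imAt_le_kerAt (p : State V) : R.imAt p ≤ R.kerAt p := by
  refine iSup₂_le fun b hb => ?_
  rintro _ ⟨u, rfl⟩
  subst hb
  refine ⟨R.e_apply_r b u, fun a ha => R.r_apply_r ?_ u⟩
  rw [P.rel_iff_lsrc, ha]
  rfl

theorem kerAt_le_atVertex (p : State V) : R.kerAt p ≤ R.atVertex p.1 := fun _ h => h.1

theorem mem_kerAt {a : Quiver.Total V} {u : U} (hu : u ∈ R.atVertex a.left) (h : R.r a u = 0) :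
    u ∈ R.kerAt (P.lsrc ⟨a, true⟩) := by
  refine ⟨hu, fun b hb => ?_⟩
  have h' : (⟨b, true⟩ : Letter V) = ⟨a, true⟩ := P.lsrc_inj rfl hb
  obtain rfl : b = a := congrArg Letter.arrow h'
  exact h

variable (R)

/-- The subspace given by a word that starts at the state `p`, where `B` is the family of subspaces
attached to the ends of words. -/
def wordSpace (B : State V → Submodule k U) : State V → Word V → Submodule k U
  | p, [] => B p
  | _, ⟨a, true⟩ :: c => (wordSpace B (P.ltgt ⟨a, true⟩) c).comap (R.r a) ⊓ R.atVertex a.left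
  | _, ⟨a, false⟩ :: c => (wordSpace B (P.ltgt ⟨a, false⟩) c).map (R.r a)

variable {R}

theorem wordSpace_le {B : State V → Submodule k U} (hB : ∀ p, B p ≤ R.atVertex p.1) {p q : State V}
    {c : Word V} (h : P.Walk p c q) : R.wordSpace B p c ≤ R.atVertex p.1 := by
  cases c with
  | nil => exact hB p
  | cons l c =>
    obtain ⟨a, d⟩ := l
    obtain rfl : P.lsrc ⟨a, d⟩ = p := h.1
    cases d
    · rw [wordSpace]
      rintro _ ⟨u, -, rfl⟩
      exact R.e_apply_r a u
    · exact inf_le_right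

/-- The subspaces given by words form a filtration, which is used in the following form. -/
theorem exists_word (hP : ∀ p w, P.Walk p w p → w = []) (p : State V) (K' U₁ : Submodule k U)
    (hU : U₁ ≤ R.atVertex p.1) (hK : K' ≤ U₁) (hne : ¬ U₁ ≤ K') :
    ∃ c q, P.Walk p c q ∧ ¬ R.wordSpace R.kerAt p c ⊓ U₁ ≤ K' ∧
      R.wordSpace R.imAt p c ⊓ U₁ ≤ K' := by
  induction p using (P.wellFounded_of_acyclic hP).induction generalizing K' U₁ with
  | _ p ih =>
    -- Find the layer of the chain from zero through `imAt` and `kerAt` to the whole space at the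
    -- vertex in which `U₁` first leaves `K'`. The middle layer ends the word, the top layer
    -- continues with the outgoing arrow, the bottom layer with the inverse of the incoming one.
    by_cases hJ : R.imAt p ⊓ U₁ ≤ K'
    · by_cases hker : R.kerAt p ⊓ U₁ ≤ K'
      · obtain ⟨x, hx, hx'⟩ := SetLike.not_le_iff_exists.1 hne
        have hout : ∃ a, P.lsrc ⟨a, true⟩ = p := by
          by_contra hout
          exact hx' (hker ⟨⟨hU hx, fun a ha => absurd ⟨a, ha⟩ hout⟩, hx⟩)
        obtain ⟨a, rfl⟩ := hout
        -- Within `U₁` the kernel of `a` is contained in `K'`, so nothing of `U₁ / K'` is lost under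
        -- `a`.
        have key : ∀ y ∈ U₁, R.r a y ∈ K'.map (R.r a) → y ∈ K' := by
          rintro y hy ⟨z, hz, hzy⟩
          have h1 : y - z ∈ R.kerAt (P.lsrc ⟨a, true⟩) ⊓ U₁ := by
            have h2 := U₁.sub_mem hy (hK hz)
            exact ⟨mem_kerAt (hU h2) (by rw [map_sub, hzy, sub_self]), h2⟩
          have h3 := K'.add_mem (hker h1) hz
          rwa [sub_add_cancel] at h3
        obtain ⟨c, q, hw, hc1, hc2⟩ := ih (P.ltgt ⟨a, true⟩) ⟨[⟨a, true⟩], by simp, rfl, rfl⟩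
          (K'.map (R.r a)) (U₁.map (R.r a))
          (by rintro _ ⟨y, -, rfl⟩; exact R.e_apply_r a y) (Submodule.map_mono hK)
          (fun hle => hx' (key x hx (hle (Submodule.mem_map_of_mem hx))))
        refine ⟨⟨a, true⟩ :: c, q, ⟨rfl, hw⟩, fun hle => hc1 ?_, ?_⟩
        · rintro _ ⟨h1, ⟨y, hy, rfl⟩⟩
          exact Submodule.mem_map_of_mem (hle ⟨⟨h1, hU hy⟩, hy⟩)
        · rintro y ⟨⟨h1, -⟩, hy⟩
          exact key y hy (hc2 ⟨h1, Submodule.mem_map_of_mem hy⟩)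
      · exact ⟨[], p, rfl, hker, hJ⟩
    · have hin : ∃ b, P.lsrc ⟨b, false⟩ = p := by
        by_contra hin
        rw [imAt_eq_bot hin, bot_inf_eq] at hJ
        exact hJ bot_le
      obtain ⟨b, rfl⟩ := hin
      rw [imAt_eq rfl] at hJ
      -- Here both subspaces are pulled back along `b`, since the failure already occurs inside its
      -- image.
      obtain ⟨c, q, hw, hc1, hc2⟩ := ih (P.ltgt ⟨b, false⟩) ⟨[⟨b, false⟩], by simp, rfl, rfl⟩
        (K'.comap (R.r b) ⊓ R.atVertex b.left) (U₁.comap (R.r b) ⊓ R.atVertex b.left) inf_le_right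
        (inf_le_inf_right _ (Submodule.comap_mono hK)) (by
          intro hle
          apply hJ
          rintro _ ⟨⟨z, rfl⟩, hz⟩
          have h1 : R.e b.left z ∈ K'.comap (R.r b) ⊓ R.atVertex b.left := hle
            ⟨by rw [SetLike.mem_coe, Submodule.mem_comap, R.r_apply_e]; exact hz, R.e_apply_e _ _⟩
          have h2 := h1.1
          rwa [SetLike.mem_coe, Submodule.mem_comap, R.r_apply_e] at h2)
      refine ⟨⟨b, false⟩ :: c, q, ⟨rfl, hw⟩, fun hle => hc1 ?_, ?_⟩
      · rintro z ⟨h1, h2, h3⟩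
        exact ⟨hle ⟨Submodule.mem_map_of_mem h1, h2⟩, h3⟩
      · rintro _ ⟨⟨z, hz, rfl⟩, h2⟩
        have h3 : z ∈ R.atVertex b.left :=
          wordSpace_le (fun p => (imAt_le_kerAt p).trans (kerAt_le_atVertex p)) hw hz
        exact (hc2 ⟨hz, h2, h3⟩).1

/-- On a nonzero representation the sequences given by the sides of the vertices are not all
exact. -/
theorem exists_not_exact (hP : ∀ p w, P.Walk p w p → w = []) [Nontrivial U] :
    ∃ p, ¬ R.kerAt p ≤ R.imAt p := by
  by_contra! hcon
  -- A vector at `p` is killed by the outgoing arrow, whose target space is zero by induction. By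
  -- exactness it comes from the incoming arrow, whose source space is zero for the same reason.
  have key : ∀ p : State V, R.atVertex p.1 = ⊥ := by
    intro p
    induction p using (P.wellFounded_of_acyclic hP).induction with
    | _ p ih =>
      rw [Submodule.eq_bot_iff]
      intro u hu
      have h1 : u ∈ R.imAt p := by
        refine hcon p ⟨hu, fun a ha => ?_⟩
        have h2 := ih (P.ltgt ⟨a, true⟩) ⟨[⟨a, true⟩], by simp, ha, rfl⟩
        rw [Submodule.eq_bot_iff] at h2
        exact h2 _ (R.e_apply_r a u)
      by_cases hin : ∃ b, P.lsrc ⟨b, false⟩ = p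
      · obtain ⟨b, hb⟩ := hin
        rw [imAt_eq hb] at h1
        obtain ⟨z, rfl⟩ := h1
        have h2 := ih (P.ltgt ⟨b, false⟩) ⟨[⟨b, false⟩], by simp, hb, rfl⟩
        rw [Submodule.eq_bot_iff] at h2
        rw [← R.r_apply_e, h2 _ (R.e_apply_e b.left z), map_zero]
      · rw [imAt_eq_bot hin] at h1
        exact h1
  obtain ⟨u, hu⟩ := exists_ne (0 : U)
  apply hu
  have h1 : u = ∑ x, R.e x u := by
    rw [← LinearMap.sum_apply, R.e_sum]
    rfl
  rw [h1]
  refine Finset.sum_eq_zero fun x _ => ?_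
  have h2 := key (x, true)
  rw [Submodule.eq_bot_iff] at h2
  exact h2 _ (R.e_apply_e x u)

/-! ### String modules as direct summands -/

/-- A vector in the subspace given by a word extends to a family of vectors along the word. -/
theorem exists_vectors {p q : State V} {w : Word V} (h : P.Walk p w q) {u : U}
    (hu : u ∈ R.wordSpace R.kerAt p w) :
    ∃ m : ℕ → U, m 0 = u ∧ (∀ i ≤ w.length, R.e (P.states p w i).1 (m i) = m i) ∧
      (∀ i a, w[i]? = some ⟨a, true⟩ → R.r a (m i) = m (i + 1)) ∧
      (∀ i a, w[i]? = some ⟨a, false⟩ → R.r a (m (i + 1)) = m i) ∧ m w.length ∈ R.kerAt q := by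
  induction w generalizing p u with
  | nil =>
    obtain rfl : p = q := h
    exact ⟨fun _ => u, rfl, fun i _ => hu.1, by simp, by simp, hu⟩
  | cons l w ih =>
    have hv := wordSpace_le (R := R) (fun p => kerAt_le_atVertex p) h hu
    obtain ⟨a, d⟩ := l
    obtain ⟨u', hu', hr⟩ : ∃ u', u' ∈ R.wordSpace R.kerAt (P.ltgt ⟨a, d⟩) w ∧
        (d = true → R.r a u = u') ∧ (d = false → R.r a u' = u) := by
      cases d
      · obtain ⟨z, hz, hzu⟩ := hu
        exact ⟨z, hz, by simp, fun _ => hzu⟩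
      · exact ⟨_, hu.1, fun _ => rfl, by simp⟩
    obtain ⟨m, h0, h1, h2, h3, h4⟩ := ih h.2 hu'
    refine ⟨fun i => Nat.casesOn i u m, rfl, ?_, ?_, ?_, h4⟩
    · rintro (_ | i) hi
      · exact hv
      · exact h1 i (by simpa using hi)
    · rintro (_ | i) b hb
      · obtain ⟨rfl, rfl⟩ : a = b ∧ d = true := by simpa using hb
        exact (hr.1 rfl).trans h0.symm
      · exact h2 i b (by simpa using hb)
    · rintro (_ | i) b hb
      · obtain ⟨rfl, rfl⟩ : a = b ∧ d = false := by simpa using hb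
        refine Eq.trans ?_ (hr.2 rfl)
        exact congrArg _ h0
      · exact h3 i b (by simpa using hb)

/-- A functional that vanishes on the subspace given by a word extends to a family of functionals
along the word. -/
theorem exists_functionals {p q : State V} {w : Word V} (h : P.Walk p w q) {f : U →ₗ[k] k}
    (hf : ∀ u ∈ R.wordSpace R.imAt p w, f u = 0) (hfe : ∀ u, f (R.e p.1 u) = f u) :
    ∃ F : ℕ → U →ₗ[k] k, F 0 = f ∧ (∀ i ≤ w.length, ∀ u, F i (R.e (P.states p w i).1 u) = F i u) ∧
      (∀ i a, w[i]? = some ⟨a, true⟩ → ∀ u, F (i + 1) (R.r a u) = F i u) ∧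
      (∀ i a, w[i]? = some ⟨a, false⟩ → ∀ u, F i (R.r a u) = F (i + 1) u) ∧
      ∀ u ∈ R.imAt q, F w.length u = 0 := by
  induction w generalizing p f with
  | nil =>
    obtain rfl : p = q := h
    exact ⟨fun _ => f, rfl, fun i _ => hfe, by simp, by simp, hf⟩
  | cons l w ih =>
    obtain ⟨a, d⟩ := l
    obtain rfl : P.lsrc ⟨a, d⟩ = p := h.1
    obtain ⟨f', hf', hfe', hr⟩ : ∃ f' : U →ₗ[k] k,
        (∀ u ∈ R.wordSpace R.imAt (P.ltgt ⟨a, d⟩) w, f' u = 0) ∧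
        (∀ u, f' (R.e (P.ltgt ⟨a, d⟩).1 u) = f' u) ∧
        (d = true → ∀ u, f' (R.r a u) = f u) ∧ (d = false → ∀ u, f (R.r a u) = f' u) := by
      cases d
      · refine ⟨f ∘ₗ R.r a, fun u hu => hf _ (Submodule.mem_map_of_mem hu), fun u => ?_, by simp,
          fun _ u => rfl⟩
        exact congrArg f (R.r_apply_e a u)
      · have hle : R.wordSpace R.imAt (P.ltgt ⟨a, true⟩) w ≤ R.atVertex a.right :=
          wordSpace_le (fun p => (imAt_le_kerAt p).trans (kerAt_le_atVertex p)) h.2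
        -- `f` vanishes on every vector that `a` sends into the next word space, so it factors
        -- through `a` followed by the quotient map. The annihilator of the kernel of `g` is the
        -- range of its dual map, in any dimension.
        let g := (R.wordSpace R.imAt (P.ltgt ⟨a, true⟩) w).mkQ ∘ₗ R.r a
        have hg : f ∈ LinearMap.range g.dualMap := by
          rw [LinearMap.range_dualMap_eq_dualAnnihilator_ker, Submodule.mem_dualAnnihilator]
          intro u hu
          have hu' : R.r a u ∈ R.wordSpace R.imAt (P.ltgt ⟨a, true⟩) w :=
            (Submodule.Quotient.mk_eq_zero _).1 hu
          rw [← hfe]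
          refine hf _ ⟨?_, R.e_apply_e a.left u⟩
          rw [SetLike.mem_coe, Submodule.mem_comap]
          exact (R.r_apply_e a u).symm ▸ hu'
        obtain ⟨g', hg'⟩ := hg
        -- Composing with the idempotent makes the new functional live at the target vertex only.
        refine ⟨g' ∘ₗ (R.wordSpace R.imAt (P.ltgt ⟨a, true⟩) w).mkQ ∘ₗ R.e a.right, fun u hu => ?_,
          fun u => ?_, fun _ u => ?_, by simp⟩
        · have h1 : R.e a.right u = u := hle hu
          have h2 : (R.wordSpace R.imAt (P.ltgt ⟨a, true⟩) w).mkQ u = 0 :=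
            (Submodule.Quotient.mk_eq_zero _).2 hu
          rw [LinearMap.comp_apply, LinearMap.comp_apply, h1, h2, map_zero]
        · exact congrArg (fun z => g' (Submodule.mkQ _ z)) (R.e_apply_e a.right u)
        · rw [← hg']
          exact congrArg (fun z => g' (Submodule.mkQ _ z)) (R.e_apply_r a u)
    obtain ⟨F, h0, h1, h2, h3, h4⟩ := ih h.2 hf' hfe'
    refine ⟨fun i => Nat.casesOn i f F, rfl, ?_, ?_, ?_, h4⟩
    · rintro (_ | i) hi
      · exact hfe
      · exact h1 i (by simpa using hi)
    · rintro (_ | i) b hb u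
      · obtain ⟨rfl, rfl⟩ : a = b ∧ d = true := by simpa using hb
        refine Eq.trans ?_ (hr.1 rfl u)
        exact congrArg (fun g : U →ₗ[k] k => g (R.r a u)) h0
      · exact h2 i b (by simpa using hb) u
    · rintro (_ | i) b hb u
      · obtain ⟨rfl, rfl⟩ : a = b ∧ d = false := by simpa using hb
        refine (hr.2 rfl u).trans ?_
        exact congrArg (fun g : U →ₗ[k] k => g u) h0.symm
      · exact h3 i b (by simpa using hb) u

end Rep

/-! ### The algebras without closed walks -/

section RepFinite

variable {V : Type u} [Quiver.{v} V] [Fintype V] {P : Polarization V} {k : Type w} [Field k]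
  {U : Type*} [AddCommGroup U] [Module k U] {R : Rep P k U}

/-- On a nonzero representation some string module splits off. -/
theorem Rep.exists_retract (hP : ∀ p w, P.Walk p w p → w = []) [Nontrivial U] :
    ∃ (p q : State V) (w : Word V) (h : P.Walk p w q) (φ : (Fin (w.length + 1) → k) →ₗ[k] U)
      (ψ : U →ₗ[k] (Fin (w.length + 1) → k)), Rep.IsHom (h.graph.rep k) R φ ∧
        Rep.IsHom R (h.graph.rep k) ψ ∧ ψ (φ (Pi.single 0 1)) 0 ≠ 0 := by
  -- The side `p₀` on which exactness fails becomes the closed side at the start of the string; the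
  -- word is read from the opposite side.
  obtain ⟨p₀, hp₀⟩ := Rep.exists_not_exact (R := R) hP
  obtain ⟨p, rfl⟩ : ∃ p : State V, p.bar = p₀ := ⟨p₀.bar, p₀.bar_bar⟩
  obtain ⟨w, q, h, h1, h2⟩ := Rep.exists_word (R := R) hP p (R.imAt p.bar) (R.kerAt p.bar)
    (Rep.kerAt_le_atVertex p.bar) (Rep.imAt_le_kerAt p.bar) hp₀
  obtain ⟨u, ⟨hu1, hu2⟩, hu⟩ := SetLike.not_le_iff_exists.1 h1
  -- By the modular law: if `u = y + z`, then `z` lies in `kerAt p.bar`, hence in `imAt p.bar` by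
  -- the choice of `w`.
  have hnot : u ∉ R.imAt p.bar ⊔ R.wordSpace R.imAt p w := by
    intro hmem
    obtain ⟨y, hy, z, hz, rfl⟩ := Submodule.mem_sup.1 hmem
    have hz' : z ∈ R.kerAt p.bar := by
      have := (R.kerAt p.bar).sub_mem hu2 (Rep.imAt_le_kerAt _ hy)
      rwa [add_sub_cancel_left] at this
    exact hu ((R.imAt p.bar).add_mem hy (h2 ⟨hz, hz'⟩))
  obtain ⟨f, hf, hf'⟩ := Submodule.exists_le_ker_of_notMem hnot
  have hle : R.imAt p.bar ⊔ R.wordSpace R.imAt p w ≤ R.atVertex p.1 :=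
    sup_le ((Rep.imAt_le_kerAt _).trans (Rep.kerAt_le_atVertex _))
      (Rep.wordSpace_le (fun p => (Rep.imAt_le_kerAt p).trans (Rep.kerAt_le_atVertex p)) h)
  have hg : ∀ y ∈ R.imAt p.bar ⊔ R.wordSpace R.imAt p w, (f ∘ₗ R.e p.1) y = 0 := by
    intro y hy
    have h3 : R.e p.1 y = y := hle hy
    rw [LinearMap.comp_apply, h3]
    exact hf' hy
  obtain ⟨m, m0, m1, m2, m3, m4⟩ := Rep.exists_vectors h hu1
  obtain ⟨F, F0, F1, F2, F3, F4⟩ := Rep.exists_functionals (f := f ∘ₗ R.e p.1) h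
    (fun y hy => hg y (Submodule.mem_sup_right hy)) fun y => congrArg f (R.e_apply_e _ y)
  -- A side of a position without a step is the outer side at one of the two ends of the string, so
  -- the halting conditions need to be checked only there.
  have hend : ∀ (i : Fin (w.length + 1)) (l : Letter V), l.src = (P.states p w i).1 →
      (¬ ∃ l' j, h.graph.Step i l' j ∧ P.lsrc l' = P.lsrc l) →
      (i : ℕ) = w.length ∧ P.lsrc l = q ∨ (i : ℕ) = 0 ∧ P.lsrc l = p.bar := by
    intro i l hl hno
    have hi := i.2
    have hend : P.states p w w.length = q := by
      have h3 := h.take w.length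
      rw [List.take_length] at h3
      exact h3.end_unique h
    rw [← P.lsrc_fst] at hl
    rcases State.eq_or_eq_bar hl with hs | hs
    · left
      have hlen : (i : ℕ) = w.length := by
        by_contra hne
        have hlt : (i : ℕ) < w.length := by omega
        have h3 : w[(i : ℕ)]? = some w[(i : ℕ)] := List.getElem?_eq_getElem hlt
        exact hno ⟨w[(i : ℕ)], ⟨i + 1, by omega⟩, Or.inl ⟨h3, rfl⟩, (h.lsrc_eq h3).1.trans hs.symm⟩
      exact ⟨hlen, by rw [hs, hlen, hend]⟩
    · right
      have hzero : (i : ℕ) = 0 := by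
        by_contra hne
        obtain ⟨j, hj⟩ := Nat.exists_eq_succ_of_ne_zero hne
        have hlt : j < w.length := by omega
        have h3 : w[j]? = some w[j] := List.getElem?_eq_getElem hlt
        refine hno ⟨w[j].inv, ⟨j, by omega⟩, Or.inr ⟨by rw [Letter.inv_inv]; exact h3, hj⟩, ?_⟩
        rw [P.lsrc_inv, (h.lsrc_eq h3).2, hs, hj]
      exact ⟨hzero, by rw [hs, hzero, Polarization.states_zero]⟩
  have hm : h.graph.IsVectorFamily R (fun i => m i) := by
    refine ⟨fun i => m1 i (by omega), ?_, ?_⟩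
    · rintro i a j (⟨hs, hj⟩ | ⟨hs, hj⟩)
      · rw [m2 _ _ hs, hj]
      · rw [hj, m3 _ _ hs]
    · intro i a ha hno
      rcases hend i ⟨a, true⟩ ha hno with ⟨hi, hl⟩ | ⟨hi, hl⟩
      · rw [hi]
        exact m4.2 a hl
      · rw [hi, m0]
        exact hu2.2 a hl
  have hF : h.graph.IsFunctionalFamily R (fun i => F i) := by
    refine ⟨fun i => F1 i (by omega), ?_, ?_⟩
    · rintro i a j (⟨hs, hj⟩ | ⟨hs, hj⟩) y
      · rw [hj, F2 _ _ hs]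
      · rw [hj, F3 _ _ hs]
    · intro i a ha hno y
      rcases hend i ⟨a, false⟩ ha hno with ⟨hi, hl⟩ | ⟨hi, hl⟩
      · rw [hi]
        exact F4 _ (by rw [Rep.imAt_eq hl]; exact ⟨y, rfl⟩)
      · rw [hi, F0]
        exact hg _ (Submodule.mem_sup_left (by rw [Rep.imAt_eq hl]; exact ⟨y, rfl⟩))
  refine ⟨p, q, w, h, _, _, hm.isHom, hF.isHom, ?_⟩
  have hval : R.e p.1 u = u := hu2.1
  -- The first diagonal coefficient of the composition is the value of `f` at `u`, which is nonzero
  -- by choice.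
  rw [Fintype.linearCombination_apply_single, one_smul, LinearMap.pi_apply]
  simp only [Fin.val_zero]
  rw [F0, m0, LinearMap.comp_apply, hval]
  exact hf

/-- A homomorphism from a representation to a module. -/
def Rep.homTo {X : Type w} [AddCommGroup X] [Module k X] (S : Rep P k X)
    (N : ModuleCat.{max u v w} (BoundAlgebra (P.ideal k))) [Module k N]
    [IsScalarTower k (BoundAlgebra (P.ideal k)) N] (φ : X →ₗ[k] N)
    (h : Rep.IsHom S (Rep.ofModule N) φ) : S.toModuleCat ⟶ N :=
  ModuleCat.ofHom (X := ULift.{max u v} S.Mod)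
    { toFun := fun x => φ x.down
      map_add' := fun x y => φ.map_add x.down y.down
      map_smul' := fun a x => by
        obtain ⟨f, rfl⟩ := RingCon.mk'_surjective _ a
        exact (h.toAlgHom f x.down).trans (Rep.ofModule_toAlgHom N f _) }

/-- A homomorphism from a module to a representation. -/
def Rep.homFrom {X : Type w} [AddCommGroup X] [Module k X] (S : Rep P k X)
    (N : ModuleCat.{max u v w} (BoundAlgebra (P.ideal k))) [Module k N]
    [IsScalarTower k (BoundAlgebra (P.ideal k)) N] (ψ : N →ₗ[k] X)
    (h : Rep.IsHom (Rep.ofModule N) S ψ) : N ⟶ S.toModuleCat :=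
  ModuleCat.ofHom (Y := ULift.{max u v} S.Mod)
    { toFun := fun x => ⟨ψ x⟩
      map_add' := fun x y => congrArg ULift.up (ψ.map_add x y)
      map_smul' := fun a x => by
        obtain ⟨f, rfl⟩ := RingCon.mk'_surjective _ a
        refine congrArg ULift.up ?_
        exact (congrArg ψ (Rep.ofModule_toAlgHom N f x)).symm.trans (h.toAlgHom f x) }

/-- An indecomposable module over an algebra without closed walks is a string module. -/
theorem exists_iso_module (hP : ∀ p w, P.Walk p w p → w = [])
    (N : ModuleCat.{max u v w} (BoundAlgebra (P.ideal k))) (hN : Indecomposable N) :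
    ∃ (p q : State V) (w : Word V) (h : P.Walk p w q), Nonempty (N ≅ h.module k) := by
  let _ : Module k N := Module.compHom N (algebraMap k (BoundAlgebra (P.ideal k)))
  have : IsScalarTower k (BoundAlgebra (P.ideal k)) N := IsScalarTower.of_algebraMap_smul
    fun _ _ => rfl
  have : Nontrivial N := by
    by_contra hcon
    rw [not_nontrivial_iff_subsingleton] at hcon
    exact hN.1 (ModuleCat.isZero_of_subsingleton N)
  obtain ⟨p, q, w, h, φ, ψ, hφ, hψ, hne⟩ := Rep.exists_retract (R := (Rep.ofModule N : Rep P k N)) hP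
  refine ⟨p, q, w, h, ?_⟩
  let i : h.module k ⟶ N := Rep.homTo _ N φ hφ
  let r : N ⟶ h.module k := Rep.homFrom _ N ψ hψ
  have := h.isIso_of_diag k (i ≫ r) hne
  exact nonempty_iso_of_retract hN (h.indecomposable_module k).1 i (r ≫ CategoryTheory.inv (i ≫ r))
    (by rw [← Category.assoc, IsIso.hom_inv_id])

variable (k)

/-- An algebra without closed walks is representation-finite. -/
theorem not_isRepInfinite [Finite (Quiver.Total V)] (hP : ∀ p w, P.Walk p w p → w = []) :
    ¬ IsRepInfinite (BoundAlgebra (P.ideal k)) := by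
  have := P.finite_walks hP
  obtain ⟨n, ⟨e⟩⟩ := Finite.exists_equiv_fin {x : State V × Word V // ∃ q, P.Walk x.1 x.2 q}
  let F : {x : State V × Word V // ∃ q, P.Walk x.1 x.2 q} →
    ModuleCat.{max u v w} (BoundAlgebra (P.ideal k)) := fun x => x.2.choose_spec.module k
  refine fun hinf => hinf ⟨n, fun i => F (e.symm i), fun N _ hN => ?_⟩
  obtain ⟨p, q, w, h, hiso⟩ := exists_iso_module hP N hN
  refine ⟨e ⟨(p, w), q, h⟩, ?_⟩
  have he : F (e.symm (e ⟨(p, w), q, h⟩)) = h.module k := by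
    rw [e.symm_apply_apply]
    rfl
  rw [← he] at hiso
  exact hiso

end RepFinite

/-! ### Strings and the ideal of a polarization -/

section ArrowsProd

variable {k : Type w} [Field k] {V : Type u} [Quiver.{v} V] [Fintype V]

@[simp] theorem arrowsProd_nil : arrowsProd k ([] : List (Quiver.Total V)) = 1 := rfl

@[simp] theorem arrowsProd_append (c d : List (Quiver.Total V)) :
    arrowsProd k (c ++ d) = arrowsProd k d * arrowsProd k c := by
  simp [arrowsProd]

@[simp] theorem arrowsProd_singleton (a : Quiver.Total V) : arrowsProd k [a] = ofArrow k a := by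
  simp [arrowsProd]

theorem arrowsProd_pair (a b : Quiver.Total V) :
    arrowsProd k [a, b] = ofArrow k b * ofArrow k a := by
  simp [arrowsProd]

theorem arrowsProd_replicate (c : List (Quiver.Total V)) (m : ℕ) :
    arrowsProd k (List.replicate m c).flatten = arrowsProd k c ^ m := by
  induction m with
  | zero => simp
  | succ m ih => rw [List.replicate_succ, List.flatten_cons, arrowsProd_append, ih, pow_succ]

end ArrowsProd

/-- The directed word given by a list of arrows. -/
def Word.ofArrows {V : Type u} [Quiver.{v} V] (c : List (Quiver.Total V)) : Word V :=
  c.map fun a => ⟨a, true⟩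

theorem Word.exists_ofArrows {V : Type u} [Quiver.{v} V] {w : Word V}
    (h : ∀ l ∈ w, l.dir = true) : ∃ c, w = Word.ofArrows c := by
  refine ⟨w.map Letter.arrow, ?_⟩
  rw [Word.ofArrows, List.map_map]
  symm
  rw [List.map_eq_iff]
  intro i
  cases hi : w[i]? with
  | none => rfl
  | some l =>
    have := h l (List.mem_of_getElem? hi)
    obtain ⟨a, d⟩ := l
    obtain rfl : d = true := this
    rfl

namespace Polarization

variable {V : Type u} [Quiver.{v} V] [Fintype V] {P : Polarization V} {k : Type w} [Field k]
  {p q : State V}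

variable (k) in
/-- A directed walk does not lie in the ideal. -/
theorem Walk.arrowsProd_notMem {r : List (Quiver.Total V)} (h : P.Walk p (Word.ofArrows r) q) :
    arrowsProd k r ∉ P.ideal k := by
  intro hmem
  -- On its own string module the path carries the first basis vector to the last, whereas the ideal
  -- acts as zero.
  have key : ∀ i (hi : i < (Word.ofArrows r).length + 1),
      (h.graph.rep k).toAlgHom (arrowsProd k (r.take i)) (Pi.single 0 1) =
        Pi.single ⟨i, hi⟩ 1 := by
    intro i
    induction i with
    | zero =>
      intro hi
      rw [List.take_zero, arrowsProd_nil, map_one]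
      rfl
    | succ i ih =>
      intro hi
      have hlt : i < r.length := by simpa [Word.ofArrows] using hi
      have hc : r[i]? = some r[i] := List.getElem?_eq_getElem hlt
      rw [List.take_add_one, hc, Option.toList_some, arrowsProd_append, arrowsProd_singleton,
        map_mul, Module.End.mul_apply, ih (by omega), Rep.toAlgHom_ofArrow]
      refine h.graph.r_single (Or.inl ⟨?_, rfl⟩)
      change (r.map fun a => (⟨a, true⟩ : Letter V))[i]? = _
      rw [List.getElem?_map, hc]
      rfl
  have h1 := key r.length (by simp [Word.ofArrows])
  rw [List.take_length, Rep.toAlgHom_eq_zero _ hmem] at h1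
  have h2 := congrFun h1 ⟨r.length, by simp [Word.ofArrows]⟩
  simp at h2

theorem mul_mem_ideal_iff {a b : Quiver.Total V} (h : a.right = b.left) :
    ofArrow k b * ofArrow k a ∈ P.ideal k ↔ P.Rel a b := by
  constructor
  · intro hmem
    by_contra hr
    rw [← arrowsProd_pair] at hmem
    have hw : P.Walk (P.lsrc ⟨a, true⟩) (Word.ofArrows [a, b]) (P.ltgt ⟨b, true⟩) := by
      refine ⟨rfl, ?_, rfl⟩
      rw [rel_iff_lsrc] at hr
      rcases State.eq_or_eq_bar (p := P.lsrc ⟨b, true⟩) (q := P.ltgt ⟨a, true⟩)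
        (by rw [lsrc_fst, ltgt_fst]; exact h.symm) with h1 | h1
      · exact h1
      · exact absurd (by rw [h1, State.bar_bar]) hr
    exact hw.arrowsProd_notMem k hmem
  · exact fun hr => TwoSidedIdeal.subset_span ⟨a, b, hr, rfl⟩

theorem ofArrow_notMem_ideal (a : Quiver.Total V) : ofArrow k a ∉ P.ideal k := by
  have hw : P.Walk (P.lsrc ⟨a, true⟩) (Word.ofArrows [a]) (P.ltgt ⟨a, true⟩) := ⟨rfl, rfl⟩
  have := hw.arrowsProd_notMem k
  rwa [arrowsProd_singleton] at this

theorem Walk.avoidsIdeal {w : Word V} (h : P.Walk p w q) : AvoidsIdeal (P.ideal k) w := by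
  rintro c - ⟨s, t, rfl⟩
  rw [walk_append] at h
  obtain ⟨q', h, -⟩ := h
  rw [walk_append] at h
  obtain ⟨p', -, h⟩ := h
  exact Walk.arrowsProd_notMem k h

theorem _root_.BoundQuiver.AvoidsIdeal.mono {I : TwoSidedIdeal (PathAlgebra k V)} {w w' : Word V}
    (h : w' <:+: w)
    (hw : AvoidsIdeal I w) : AvoidsIdeal I w' := fun c hc h' => hw c hc (h'.trans h)

/-- If `m` left on the side by which `l` enters, it would either be the inverse of `l` or have the
same direction as `l`; in the second case `l` and `m`, or their inverses, form a zero relation. -/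
theorem lsrc_eq_ltgt_of_avoids {l m : Letter V} (h1 : m.src = l.tgt) (h2 : m ≠ l.inv)
    (h3 : AvoidsIdeal (P.ideal k) [l, m]) (h4 : AvoidsIdeal (P.ideal k) [m.inv, l.inv]) :
    P.lsrc m = P.ltgt l := by
  rcases State.eq_or_eq_bar (p := P.lsrc m) (q := P.ltgt l)
    (by rw [lsrc_fst, ltgt_fst, h1]) with hs | hs
  · exact hs
  · exfalso
    by_cases hd : m.dir = l.inv.dir
    · exact h2 (P.lsrc_inj hd (by rw [hs, lsrc_inv]))
    · obtain ⟨a, d⟩ := l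
      obtain ⟨b, e⟩ := m
      cases d <;> cases e <;> simp at hd
      · refine h4 [b, a] (by simp) (List.infix_refl _) ?_
        rw [arrowsProd_pair]
        refine TwoSidedIdeal.subset_span ⟨b, a, ?_, rfl⟩
        rw [rel_iff_lsrc]
        exact (congrArg State.bar hs).trans (by rw [State.bar_bar]; rfl)
      · refine h3 [a, b] (by simp) (List.infix_refl _) ?_
        rw [arrowsProd_pair]
        refine TwoSidedIdeal.subset_span ⟨a, b, ?_, rfl⟩
        rw [rel_iff_lsrc, hs, State.bar_bar]

/-- Strings are the walks of positive length. -/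
theorem isString_iff {w : Word V} :
    IsString (P.ideal k) w ↔ w ≠ [] ∧ ∃ p q, P.Walk p w q := by
  constructor
  · rintro ⟨hne, hchain, h1, h2⟩
    refine ⟨hne, (exists_walk_iff_isChain P hne).2 ?_⟩
    clear hne
    induction w with
    | nil => exact List.isChain_nil
    | cons l w ih =>
      cases w with
      | nil => exact List.isChain_singleton _
      | cons m w =>
        rw [List.isChain_cons_cons] at hchain ⊢
        have hinv : Word.inv (l :: m :: w) = Word.inv w ++ [m.inv, l.inv] := by simp [Word.inv]
        have hinv' : Word.inv (m :: w) = Word.inv w ++ [m.inv] := by simp [Word.inv]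
        refine ⟨lsrc_eq_ltgt_of_avoids hchain.1.1 hchain.1.2
          (AvoidsIdeal.mono ⟨[], w, rfl⟩ h1) (AvoidsIdeal.mono ⟨Word.inv w, [], ?_⟩ h2),
          ih hchain.2 (AvoidsIdeal.mono ⟨[l], [], ?_⟩ h1) (AvoidsIdeal.mono ⟨[], [l.inv], ?_⟩ h2)⟩
        · rw [hinv, List.append_nil]
        · simp
        · rw [hinv, hinv']
          simp
  · rintro ⟨hne, p, q, h⟩
    refine ⟨hne, ?_, h.avoidsIdeal, h.inv.avoidsIdeal⟩
    refine ((exists_walk_iff_isChain P hne).1 ⟨p, q, h⟩).imp fun l m hlm => ⟨?_, ?_⟩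
    · rw [← P.lsrc_fst, hlm, ltgt_fst]
    · rintro rfl
      rw [lsrc_inv] at hlm
      exact State.bar_ne _ hlm

/-- The square of a band is a walk, so the second copy of the band starts in the state where the
first one ends. -/
theorem walk_of_isBand {w : Word V} (h : IsBand (P.ideal k) w) : w ≠ [] ∧ ∃ p, P.Walk p w p := by
  obtain ⟨-, p, q, h2⟩ := isString_iff.1 (h.1 2 (by norm_num))
  have hw : w ≠ [] := by
    rintro rfl
    exact (isString_iff.1 (h.1 1 le_rfl)).1 (by simp [Word.pow])
  refine ⟨hw, p, Walk.append_self (q := q) hw ?_⟩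
  simpa [Word.pow] using h2

variable (k) in
/-- A closed walk is supported on the letters of a band. -/
theorem exists_band {w : Word V} (hw : w ≠ []) (h : P.Walk p w p) :
    ∃ u, IsBand (P.ideal k) u ∧ ∀ l ∈ u, l ∈ w := by
  induction hn : w.length using Nat.strong_induction_on generalizing w with
  | _ n ih =>
    have hstr : ∀ m : ℕ, 1 ≤ m → IsString (P.ideal k) (w.pow m) := fun m hm => by
      refine isString_iff.2 ⟨?_, p, p, walk_pow h m⟩
      rw [← List.length_pos_iff, Word.length_pow]
      exact Nat.mul_pos hm (List.length_pos_iff.2 hw)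
    -- A primitive closed walk is a band. Otherwise it is a power of a shorter string, which is
    -- closed as well, and induction on the length applies.
    by_cases hprim : ∃ (u : Word V) (m : ℕ), IsString (P.ideal k) u ∧ u.length < w.length ∧
        w = u.pow m
    · obtain ⟨u, m, hu, hlt, rfl⟩ := hprim
      have hune := hu.1
      -- The exponents 0 and 1 contradict the strict inequality of lengths; from exponent 2 on the
      -- word starts with two copies of `u`.
      match m, hlt, hw, h, hn with
      | 0, hlt, hw, h, hn => simp [Word.pow] at hlt
      | 1, hlt, hw, h, hn => simp [Word.pow] at hlt
      | m + 2, hlt, hw, h, hn =>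
        have hpow : u.pow (m + 2) = (u ++ u) ++ u.pow m := by
          simp [Word.pow, List.replicate_succ]
        rw [hpow, walk_append] at h
        obtain ⟨q, h1, -⟩ := h
        obtain ⟨u', hu', hsub⟩ := ih _ (hn ▸ hlt) hune (Walk.append_self hune h1) rfl
        refine ⟨u', hu', fun l hl => ?_⟩
        rw [hpow]
        simp [hsub l hl]
    · exact ⟨w, ⟨hstr, hprim⟩, fun l hl => hl⟩

/-! ### Reductions -/

variable (P) in
/-- Every closed walk runs through all arrows. -/
def Covering : Prop :=
  ∀ (p : State V) (w : Word V), w ≠ [] → P.Walk p w p → ∀ a, w.Supports a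

/-- An arrow missed by a closed walk is also missed by the band inside it, so it generates part of
the reduction ideal; but arrows are nonzero in the quotient. -/
theorem covering_of_reductionIdeal
    (h : ∀ w : Word V, IsBand (P.ideal k) w → reductionIdeal (P.ideal k) w = ⊥) : P.Covering := by
  intro p w hw hwalk a
  obtain ⟨u, hu, hsub⟩ := exists_band k hw hwalk
  by_contra hcon
  have hcon' : ¬ u.Supports a := fun ⟨l, hl, hla⟩ => hcon ⟨l, hsub l hl, hla⟩
  have hmem : (P.ideal k).ringCon.mk' (ofArrow k a) ∈ reductionIdeal (P.ideal k) u :=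
    TwoSidedIdeal.subset_span ⟨a, hcon', rfl⟩
  rw [h u hu, TwoSidedIdeal.mem_bot] at hmem
  exact P.ofArrow_notMem_ideal a
    ((TwoSidedIdeal.mem_iff _ _).2 ((RingCon.eq _).1 hmem))

theorem Covering.reductionIdeal_eq_bot (h : P.Covering) {w : Word V} (hw : IsBand (P.ideal k) w) :
    reductionIdeal (P.ideal k) w = ⊥ := by
  obtain ⟨hne, p, hwalk⟩ := walk_of_isBand hw
  rw [reductionIdeal, ← le_bot_iff, TwoSidedIdeal.span_le]
  rintro _ ⟨a, ha, -⟩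
  exact absurd (h p w hne hwalk a) ha

/-- A band through all arrows visits every vertex incident with an arrow, so `wordIdem` is the
identity. -/
theorem Covering.weakReductionIdeal_eq_bot (h : P.Covering)
    (hV : ∀ x : V, ∃ a : Quiver.Total V, a.left = x ∨ a.right = x) {w : Word V}
    (hw : IsBand (P.ideal k) w) : weakReductionIdeal (P.ideal k) w = ⊥ := by
  obtain ⟨hne, p, hwalk⟩ := walk_of_isBand hw
  have hvis : ∀ x, w.Visits x := by
    intro x
    obtain ⟨a, ha⟩ := hV x
    obtain ⟨⟨b, d⟩, hl, rfl⟩ := h p w hne hwalk a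
    refine ⟨_, hl, ?_⟩
    cases d
    · exact ha.symm
    · exact ha
  have hone : wordIdem k w = 1 := by
    rw [wordIdem, one_eq_sum_idem]
    exact Finset.sum_congr rfl fun x _ => if_pos (hvis x)
  rw [weakReductionIdeal, hone, map_one, sub_self, ← le_bot_iff, TwoSidedIdeal.span_le]
  rintro _ rfl
  exact TwoSidedIdeal.zero_mem _

end Polarization

/-! ### Gentle algebras and polarizations -/

theorem eq_or_eq_of_encard_le_two {T : Type*} {s : Set T} (h : s.encard ≤ 2) {x y z : T}
    (hx : x ∈ s) (hy : y ∈ s) (hz : z ∈ s) (hxy : x ≠ y) : z = x ∨ z = y := by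
  have hsub : ({x, y} : Set T) ⊆ s := by
    rintro t (rfl | rfl)
    exacts [hx, hy]
  have := (Set.toFinite ({x, y} : Set T)).eq_of_subset_of_encard_le hsub
    (by rwa [Set.encard_pair hxy])
  rw [← this] at hz
  exact hz

/-- The ends of the arrows at a vertex can be distributed over its two sides. -/
theorem exists_signs {T : Type*} (In Out : Set T) (hIn : In.encard ≤ 2) (hOut : Out.encard ≤ 2)
    (r : T → T → Prop) (h1 : ∀ a ∈ In, {b | b ∈ Out ∧ r a b}.Subsingleton)
    (h2 : ∀ a ∈ In, {b | b ∈ Out ∧ ¬ r a b}.Subsingleton)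
    (h3 : ∀ b ∈ Out, {a | a ∈ In ∧ r a b}.Subsingleton)
    (h4 : ∀ b ∈ Out, {a | a ∈ In ∧ ¬ r a b}.Subsingleton) :
    ∃ sIn sOut : T → Bool, Set.InjOn sIn In ∧ Set.InjOn sOut Out ∧
      ∀ a ∈ In, ∀ b ∈ Out, r a b ↔ sIn a = sOut b := by
  classical
  have key : ∀ (s : Set T), s.encard ≤ 2 → ∀ x₀ ∈ s, Set.InjOn (fun x => decide (x = x₀)) s := by
    intro s hs x₀ h₀ x hx y hy hxy
    simp only [decide_eq_decide] at hxy
    by_contra hne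
    by_cases hx₀ : x = x₀
    · exact hne (hx₀.trans (hxy.1 hx₀).symm)
    · have hy₀ : y ≠ x₀ := fun h => hx₀ (hxy.2 h)
      rcases eq_or_eq_of_encard_le_two hs hx hy h₀ hne with h | h
      · exact hx₀ h.symm
      · exact hy₀ h.symm
  rcases Out.eq_empty_or_nonempty with rfl | ⟨b₀, hb₀⟩
  · rcases In.eq_empty_or_nonempty with rfl | ⟨a₀, ha₀⟩
    · exact ⟨fun _ => true, fun _ => true, by simp, by simp, by simp⟩
    · exact ⟨_, fun _ => true, key In hIn a₀ ha₀, by simp, by simp⟩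
  -- The chosen outgoing arrow `b₀` marks one side. An incoming arrow is put on that side exactly
  -- when it has a relation with `b₀`; the gentle conditions make this consistent with the other
  -- outgoing arrow.
  · refine ⟨fun a => decide (r a b₀), _, ?_, key Out hOut b₀ hb₀, ?_⟩
    · intro a ha a' ha' haa
      simp only [decide_eq_decide] at haa
      by_cases hr : r a b₀
      · exact h3 b₀ hb₀ ⟨ha, hr⟩ ⟨ha', haa.1 hr⟩
      · exact h4 b₀ hb₀ ⟨ha, hr⟩ ⟨ha', fun h => hr (haa.2 h)⟩
    · intro a ha b hb
      simp only [decide_eq_decide]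
      by_cases hbb : b = b₀
      · subst hbb
        simp
      · simp only [hbb, iff_false]
        constructor
        · exact fun hr hr' => hbb (h1 a ha ⟨hb, hr⟩ ⟨hb₀, hr'⟩)
        · intro hr
          by_contra hr'
          exact hbb (h2 a ha ⟨hb, hr'⟩ ⟨hb₀, hr⟩)

section Gentle

variable {V : Type u} [Quiver.{v} V] [Fintype V] {k : Type w} [Field k]

/-- The ideal of a gentle algebra comes from a polarization. -/
theorem IsGentle.exists_polarization {I : TwoSidedIdeal (PathAlgebra k V)} (h : IsGentle I) :
    ∃ P : Polarization V, I = P.ideal k := by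
  obtain ⟨-, -, ⟨hle, hsb⟩, ⟨S, hS, hI⟩, hg⟩ := h
  -- Incoming and outgoing ends receive separate signs, because a loop has both ends at the same
  -- vertex.
  have hsigns : ∀ x : V, ∃ sIn sOut : Quiver.Total V → Bool,
      Set.InjOn sIn {a : Quiver.Total V | a.right = x} ∧
      Set.InjOn sOut {a : Quiver.Total V | a.left = x} ∧
      ∀ a ∈ {a : Quiver.Total V | a.right = x}, ∀ b ∈ {a : Quiver.Total V | a.left = x},
        ofArrow k b * ofArrow k a ∈ I ↔ sIn a = sOut b := by
    intro x
    refine exists_signs _ _ (hle x).1 (hle x).2 (fun a b => ofArrow k b * ofArrow k a ∈ I) ?_ ?_ ?_ ?_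
    · rintro a rfl b ⟨hb, hb'⟩ c ⟨hc, hc'⟩
      exact (hg a).2 ⟨ofArrow_mul_ofArrow_ne_zero.2 (Eq.symm hb), hb'⟩
        ⟨ofArrow_mul_ofArrow_ne_zero.2 (Eq.symm hc), hc'⟩
    · rintro a rfl b ⟨hb, hb'⟩ c ⟨hc, hc'⟩
      exact (hsb a).1 hb' hc'
    · rintro a rfl b ⟨hb, hb'⟩ c ⟨hc, hc'⟩
      exact (hg a).1 ⟨ofArrow_mul_ofArrow_ne_zero.2 hb, hb'⟩
        ⟨ofArrow_mul_ofArrow_ne_zero.2 hc, hc'⟩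
    · rintro a rfl b ⟨hb, hb'⟩ c ⟨hc, hc'⟩
      exact (hsb a).2 hb' hc'
  choose sIn sOut hIn hOut hrel using hsigns
  let P : Polarization V :=
    { srcSign := fun a => sOut a.left a
      tgtSign := fun a => sIn a.right a
      src_inj := fun a b hab hs => hOut b.left hab rfl (by rw [← hs, hab])
      tgt_inj := fun a b hab hs => hIn b.right hab rfl (by rw [← hs, hab]) }
  refine ⟨P, le_antisymm ?_ ?_⟩
  · conv_lhs => rw [hI]
    rw [TwoSidedIdeal.span_le]
    rintro _ ⟨⟨a, c, p⟩, hp, rfl⟩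
    have hlen := hS _ hp
    have hmem : ofPath k ⟨a, c, p⟩ ∈ I := by
      rw [hI]
      exact TwoSidedIdeal.subset_span ⟨_, hp, rfl⟩
    match p, hlen, hmem with
    | Quiver.Path.cons (Quiver.Path.cons Quiver.Path.nil e) f, hlen, hmem =>
      have he : (ofPath k ⟨a, c, (Quiver.Path.nil.cons e).cons f⟩ : PathAlgebra k V) =
        ofArrow k ⟨_, _, f⟩ * ofArrow k ⟨_, _, e⟩ := ofPath_cons _ _
      rw [he] at hmem ⊢
      exact TwoSidedIdeal.subset_span ⟨_, _, ⟨rfl, (hrel _ _ rfl _ rfl).1 hmem⟩, rfl⟩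
  · refine TwoSidedIdeal.span_le.2 ?_
    rintro _ ⟨a, b, ⟨hab, hs⟩, rfl⟩
    refine (hrel a.right a rfl b hab.symm).2 (hs.trans ?_)
    change sOut b.left b = _
    rw [hab]

/-- All powers of a directed closed walk are directed walks, hence outside the ideal, while a high
power of the arrow ideal lies inside it. -/
theorem IsAdmissible.not_directed {P : Polarization V} (h : IsAdmissible (P.ideal k))
    {p : State V} {w : Word V} (hw : w ≠ []) (hwalk : P.Walk p w p) : ¬ ∀ l ∈ w, l.dir = true := by
  intro hdir
  obtain ⟨r, rfl⟩ := Word.exists_ofArrows hdir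
  obtain ⟨m, -, hm, -⟩ := h
  have hr : arrowsProd k r ∈ arrowIdeal k V := by
    have hne : r ≠ [] := by
      rintro rfl
      exact hw rfl
    obtain ⟨s, a, rfl⟩ := List.eq_nil_or_concat r |>.resolve_left hne
    rw [List.concat_eq_append, arrowsProd_append, arrowsProd_singleton]
    exact TwoSidedIdeal.mul_mem_right _ _ _ (TwoSidedIdeal.subset_span ⟨a, rfl⟩)
  have hmem := hm (Ideal.pow_mem_pow (TwoSidedIdeal.mem_asIdeal.2 hr) m)
  rw [← arrowsProd_replicate] at hmem
  have h1 := Polarization.walk_pow hwalk m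
  have h2 : Word.pow (Word.ofArrows r) m = Word.ofArrows (List.replicate m r).flatten := by
    simp [Word.pow, Word.ofArrows, List.map_flatten]
  rw [h2] at h1
  exact h1.arrowsProd_notMem k (TwoSidedIdeal.mem_asIdeal.1 hmem)

/-! ### Long paths and admissibility -/

/-- The span of the paths of length at least `n`. -/
def longPaths (k : Type w) [Field k] (V : Type u) [Quiver.{v} V] [Fintype V] (n : ℕ) :
    Submodule k (PathAlgebra k V) :=
  Submodule.span k (ofPath k '' {p | n ≤ p.2.2.length})

theorem mul_mem_longPaths {m n : ℕ} {f g : PathAlgebra k V} (hf : f ∈ longPaths k V m)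
    (hg : g ∈ longPaths k V n) : f * g ∈ longPaths k V (m + n) := by
  have hle : longPaths k V m * longPaths k V n ≤ longPaths k V (m + n) := by
    rw [longPaths, longPaths, Submodule.span_mul_span, Submodule.span_le]
    rintro _ ⟨_, ⟨⟨a, b, p⟩, hp, rfl⟩, _, ⟨⟨c, d, q⟩, hq, rfl⟩, rfl⟩
    dsimp only
    rw [ofPath_mul_ofPath]
    by_cases h : a = d
    · subst h
      refine Submodule.subset_span ⟨⟨c, b, q.comp p⟩, ?_, by simp [pathMul]⟩
      change m + n ≤ (q.comp p).length
      rw [Quiver.Path.length_comp]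
      have h1 : m ≤ p.length := hp
      have h2 : n ≤ q.length := hq
      omega
    · simp [pathMul, h]
  exact hle (Submodule.mul_mem_mul hf hg)

theorem mem_longPaths_zero (f : PathAlgebra k V) : f ∈ longPaths k V 0 := by
  induction f using pathAlgebra_induction with
  | zero => exact zero_mem _
  | add f g hf hg => exact add_mem hf hg
  | smul c f hf => exact Submodule.smul_mem _ c hf
  | path p => exact Submodule.subset_span ⟨p, Nat.zero_le _, rfl⟩

theorem mem_longPaths_one {f : PathAlgebra k V} (hf : f ∈ arrowIdeal k V) :
    f ∈ longPaths k V 1 := by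
  induction hf using TwoSidedIdeal.span_induction with
  | mem f hf =>
    obtain ⟨a, rfl⟩ := hf
    exact Submodule.subset_span ⟨⟨a.left, a.right, a.hom.toPath⟩,
      (le_refl 1 : 1 ≤ a.hom.toPath.length), rfl⟩
  | zero => exact zero_mem _
  | add f g _ _ hf hg => exact add_mem hf hg
  | neg f _ hf => exact neg_mem hf
  | left_absorb a f _ hf =>
    have := mul_mem_longPaths (mem_longPaths_zero a) hf
    rwa [zero_add] at this
  | right_absorb a f _ hf =>
    have := mul_mem_longPaths hf (mem_longPaths_zero a)
    rwa [add_zero] at this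

/-- The paths of length at least `n` span an ideal. -/
def longPathsIdeal (k : Type w) [Field k] (V : Type u) [Quiver.{v} V] [Fintype V] (n : ℕ) :
    Ideal (PathAlgebra k V) where
  carrier := longPaths k V n
  add_mem' := add_mem
  zero_mem' := zero_mem _
  smul_mem' f g hg := by
    have := mul_mem_longPaths (mem_longPaths_zero f) hg
    rwa [zero_add] at this

theorem arrowIdeal_pow_le (n : ℕ) : (arrowIdeal k V).asIdeal ^ n ≤ longPathsIdeal k V n := by
  induction n with
  | zero => exact fun f _ => mem_longPaths_zero f
  | succ n ih =>
    rw [Submodule.pow_succ]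
    exact Ideal.mul_le.2 fun f hf g hg =>
      mul_mem_longPaths (ih hf) (mem_longPaths_one (TwoSidedIdeal.mem_asIdeal.1 hg))

/-- The state in which a path ends. -/
def Polarization.endState (P : Polarization V) {a : V} : {b : V} → Quiver.Path a b → State V
  -- The side of a lazy path is an arbitrary choice; a path of length one therefore has to be
  -- treated separately below.
  | _, Quiver.Path.nil => (a, true)
  | _, Quiver.Path.cons _ e => P.ltgt ⟨⟨_, _, e⟩, true⟩

/-- A path lies in the ideal or is a directed walk. -/
theorem Polarization.mem_ideal_or_walk (P : Polarization V) {a b : V} (p : Quiver.Path a b) :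
    ofPath k ⟨a, b, p⟩ ∈ P.ideal k ∨ ∃ r q, r.length = p.length ∧
      P.Walk q (Word.ofArrows r) (P.endState p) := by
  induction p with
  | nil => exact Or.inr ⟨[], _, rfl, rfl⟩
  | @cons b c p e ih =>
    rcases ih with ih | ⟨r, q, hr, hw⟩
    · left
      rw [ofPath_cons]
      exact TwoSidedIdeal.mul_mem_left _ _ _ ih
    · cases p with
      | nil => exact Or.inr ⟨[⟨_, _, e⟩], _, rfl, rfl, rfl⟩
      | @cons b' _ p f =>
        by_cases hrel : P.Rel ⟨b', b, f⟩ ⟨b, c, e⟩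
        · left
          rw [ofPath_cons, ofPath_cons, ← mul_assoc]
          exact TwoSidedIdeal.mul_mem_right _ _ _ (TwoSidedIdeal.subset_span ⟨_, _, hrel, rfl⟩)
        · right
          refine ⟨r ++ [⟨b, c, e⟩], q, by simp [hr], ?_⟩
          have : Word.ofArrows (r ++ [(⟨b, c, e⟩ : Quiver.Total V)]) =
              Word.ofArrows r ++ [⟨⟨b, c, e⟩, true⟩] := by simp [Word.ofArrows]
          rw [this]
          refine hw.append ⟨?_, rfl⟩
          rw [P.rel_iff_lsrc] at hrel
          rcases State.eq_or_eq_bar (p := P.lsrc ⟨⟨b, c, e⟩, true⟩)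
            (q := P.ltgt ⟨⟨b', b, f⟩, true⟩) rfl with h1 | h1
          · exact h1
          · exact absurd (by rw [h1, State.bar_bar]) hrel

/-- A state passed twice would cut out a directed closed walk, so the states along a directed walk
are distinct. -/
theorem Polarization.length_le_of_not_directed {P : Polarization V}
    (hP : ∀ p w, w ≠ [] → P.Walk p w p → ¬ ∀ l ∈ w, l.dir = true) {p q : State V}
    {r : List (Quiver.Total V)} (h : P.Walk p (Word.ofArrows r) q) :
    r.length ≤ Fintype.card (State V) := by
  have hinj : Function.Injective
      (fun i : Fin (r.length + 1) => P.states p (Word.ofArrows r) i) := by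
    have key : ∀ i j : ℕ, i < j → j ≤ r.length →
        P.states p (Word.ofArrows r) i ≠ P.states p (Word.ofArrows r) j := by
      intro i j hij hj he
      have h1 := (h.take j).drop i
      have h2 : P.states p ((Word.ofArrows r).take j) i = P.states p (Word.ofArrows r) i := by
        have h3 := (h.take j).take i
        rw [List.take_take, min_eq_left hij.le] at h3
        exact h3.end_unique (h.take i)
      rw [h2, he] at h1
      refine hP _ _ ?_ h1 ?_
      · rw [← List.length_pos_iff]
        simp [Word.ofArrows]
        omega
      · intro l hl
        have hl' := List.mem_of_mem_take (List.mem_of_mem_drop hl)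
        simp only [Word.ofArrows, List.mem_map] at hl'
        obtain ⟨a, -, rfl⟩ := hl'
        rfl
    intro i j hij
    by_contra hne
    rcases lt_or_gt_of_ne (fun h => hne (Fin.ext h)) with hlt | hlt
    · exact key i j hlt (by omega) hij
    · exact key j i hlt (by omega) hij.symm
  have := Fintype.card_le_of_injective _ hinj
  rw [Fintype.card_fin] at this
  omega

theorem Polarization.isAdmissible_ideal {P : Polarization V}
    (hP : ∀ p w, w ≠ [] → P.Walk p w p → ¬ ∀ l ∈ w, l.dir = true) : IsAdmissible (P.ideal k) := by
  -- This exponent exceeds the length of every directed walk, and it is at least 2 whatever the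
  -- number of states.
  refine ⟨Fintype.card (State V) + 2, by omega, ?_, ?_⟩
  · have key : ∀ f ∈ longPaths k V (Fintype.card (State V) + 2), f ∈ P.ideal k := by
      intro f hf
      induction hf using Submodule.span_induction with
      | mem f hf =>
        obtain ⟨⟨a, b, p⟩, hp, rfl⟩ := hf
        rcases P.mem_ideal_or_walk (k := k) p with h | ⟨r, q, hr, hw⟩
        · exact h
        · have h1 := Polarization.length_le_of_not_directed hP hw
          have h2 : Fintype.card (State V) + 2 ≤ p.length := hp
          omega
      | zero => exact TwoSidedIdeal.zero_mem _
      | add f g _ _ hf hg => exact TwoSidedIdeal.add_mem _ hf hg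
      | smul c f _ hf =>
        rw [Algebra.smul_def]
        exact TwoSidedIdeal.mul_mem_left _ _ _ hf
    exact fun f hf => TwoSidedIdeal.mem_asIdeal.2 (key f (arrowIdeal_pow_le _ hf))
  · have : P.ideal k ≤ ((arrowIdeal k V).asIdeal ^ 2).toTwoSided := by
      refine TwoSidedIdeal.span_le.2 ?_
      rintro _ ⟨a, b, -, rfl⟩
      rw [SetLike.mem_coe, Ideal.mem_toTwoSided, Submodule.pow_succ, Submodule.pow_one]
      exact Ideal.mul_mem_mul (TwoSidedIdeal.mem_asIdeal.2 (TwoSidedIdeal.subset_span ⟨b, rfl⟩))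
        (TwoSidedIdeal.mem_asIdeal.2 (TwoSidedIdeal.subset_span ⟨a, rfl⟩))
    intro f hf
    exact Ideal.mem_toTwoSided.1 (this hf)

/-- A polarization of a connected quiver without closed directed walks defines a gentle algebra. -/
theorem Polarization.isGentle_ideal {P : Polarization V} (hV : IsConnectedQuiver V)
    (hP : ∀ p w, w ≠ [] → P.Walk p w p → ¬ ∀ l ∈ w, l.dir = true) : IsGentle (P.ideal k) := by
  -- Two sides per vertex leave room for at most two incoming and two outgoing arrows.
  have hbool : ∀ (s : Set (Quiver.Total V)) (f : Quiver.Total V → Bool), Set.InjOn f s →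
      s.encard ≤ 2 := by
    intro s f hf
    have := Set.encard_le_encard_of_injOn (Set.mapsTo_univ f s) hf
    refine this.trans ?_
    rw [Set.encard_univ]
    simp
  have hcomp : ∀ a b : Quiver.Total V, ofArrow k b * ofArrow k a ∉ P.ideal k →
      a.right = b.left ∧ P.srcSign b = !P.tgtSign a := by
    intro a b hab
    have h1 : a.right = b.left := by
      rw [← ofArrow_mul_ofArrow_ne_zero (k := k)]
      intro h0
      rw [h0] at hab
      exact hab (TwoSidedIdeal.zero_mem _)
    refine ⟨h1, ?_⟩
    rw [P.mul_mem_ideal_iff h1] at hab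
    have h2 : P.tgtSign a ≠ P.srcSign b := fun h => hab ⟨h1, h⟩
    revert h2
    cases P.tgtSign a <;> cases P.srcSign b <;> simp
  have hrel : ∀ a b : Quiver.Total V, ofArrow k b * ofArrow k a ≠ 0 ∧
      ofArrow k b * ofArrow k a ∈ P.ideal k → P.Rel a b := by
    rintro a b ⟨h1, h2⟩
    exact (P.mul_mem_ideal_iff (ofArrow_mul_ofArrow_ne_zero.1 h1)).1 h2
  refine ⟨hV, P.isAdmissible_ideal hP, ⟨fun x => ⟨hbool _ P.tgtSign ?_, hbool _ P.srcSign ?_⟩,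
    fun a => ⟨?_, ?_⟩⟩, ⟨{p | p.2.2.length = 2 ∧ ofPath k p ∈ P.ideal k}, fun p hp => hp.1, ?_⟩,
    fun a => ⟨?_, ?_⟩⟩
  · exact fun a ha b hb h => P.tgt_inj a b (Eq.trans ha (Eq.symm hb)) h
  · exact fun a ha b hb h => P.src_inj a b (Eq.trans ha (Eq.symm hb)) h
  · intro b hb c hc
    have h1 := hcomp _ _ hb
    have h2 := hcomp _ _ hc
    exact P.src_inj b c (h1.1.symm.trans h2.1) (h1.2.trans h2.2.symm)
  · intro b hb c hc
    have h1 := hcomp _ _ hb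
    have h2 := hcomp _ _ hc
    refine P.tgt_inj b c (h1.1.trans h2.1.symm) ?_
    have h3 := h1.2.symm.trans h2.2
    simpa using h3
  · refine le_antisymm (TwoSidedIdeal.span_le.2 ?_) (TwoSidedIdeal.span_le.2 ?_)
    · rintro _ ⟨a, b, hab, rfl⟩
      obtain ⟨p, hp, he⟩ := ofArrow_mul_ofArrow (k := k) hab.1
      refine TwoSidedIdeal.subset_span ⟨_, ⟨hp, ?_⟩, he.symm⟩
      rw [← he]
      exact TwoSidedIdeal.subset_span ⟨a, b, hab, rfl⟩
    · rintro _ ⟨p, hp, rfl⟩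
      exact hp.2
  · intro b hb c hc
    have h1 := hrel _ _ hb
    have h2 := hrel _ _ hc
    exact P.tgt_inj b c (h1.1.trans h2.1.symm) (h1.2.trans h2.2.symm)
  · intro b hb c hc
    have h1 := hrel _ _ hb
    have h2 := hrel _ _ hc
    exact P.src_inj b c (h1.1.symm.trans h2.1) (h1.2.symm.trans h2.2)

end Gentle

/-! ### Barbells, as sequences of states -/

/-- A sequence of states forming a barbell: the vertices at the times `1, …, N - 1` are distinct,
the sequence starts with a loop that comes back to its start on the other side at time `p`, and ends
with a loop that starts at time `q`. -/
structure BarbellStates {V : Type u} (st : ℕ → State V) (p q N : ℕ) : Prop where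
  one_le : 1 ≤ p
  le : p ≤ q
  lt : q < N
  left : st 0 = (st p).bar
  right : st N = (st q).bar
  inj : ∀ i j, 1 ≤ i → i < N → 1 ≤ j → j < N → (st i).1 = (st j).1 → i = j

namespace BarbellStates

variable {V : Type u} {st : ℕ → State V} {p q N : ℕ}

/-- Letters of a barbell start at the times `0, …, N - 1` and end at the times `1, …, N`. The vertex
at time 0 occurs again at time `p`, and the one at time `N` already at time `q`, but on the opposite
side. -/
theorem start_inj (h : BarbellStates st p q N) {i j : ℕ} (hi : i < N) (hj : j < N)
    (hij : st i = st j) : i = j := by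
  have h1 := h.one_le
  have h2 := h.le
  have h3 := h.lt
  have key : ∀ j, 1 ≤ j → j < N → st 0 ≠ st j := by
    intro j h1j hj h0
    rw [h.left] at h0
    have := h.inj p j h1 (by omega) h1j hj (State.bar_fst (st p) ▸ congrArg Prod.fst h0)
    subst this
    exact State.bar_ne _ h0
  rcases Nat.eq_zero_or_pos i with rfl | hi'
  · rcases Nat.eq_zero_or_pos j with rfl | hj'
    · rfl
    · exact absurd hij (key j hj' hj)
  · rcases Nat.eq_zero_or_pos j with rfl | hj'
    · exact absurd hij.symm (key i hi' hi)
    · exact h.inj i j hi' hi hj' hj (congrArg Prod.fst hij)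

theorem end_inj (h : BarbellStates st p q N) {i j : ℕ} (hi : 1 ≤ i) (hi' : i ≤ N) (hj : 1 ≤ j)
    (hj' : j ≤ N)
    (hij : st i = st j) : i = j := by
  have h1 := h.one_le
  have h2 := h.le
  have h3 := h.lt
  have key : ∀ j, 1 ≤ j → j < N → st N ≠ st j := by
    intro j h1j hj h0
    rw [h.right] at h0
    have := h.inj q j (by omega) h3 h1j hj (State.bar_fst (st q) ▸ congrArg Prod.fst h0)
    subst this
    exact State.bar_ne _ h0
  rcases Nat.lt_or_ge i N with hi2 | hi2
  · rcases Nat.lt_or_ge j N with hj2 | hj2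
    · exact h.inj i j hi hi2 hj hj2 (congrArg Prod.fst hij)
    · obtain rfl : j = N := by omega
      exact absurd hij.symm (key i hi hi2)
  · obtain rfl : i = N := by omega
    rcases Nat.lt_or_ge j i with hj2 | hj2
    · exact absurd hij (key j hj hj2)
    · omega

/-- The only two places where a letter starts on the side by which another one enters are the
junctions of the two loops. These are the relations, and the only points at which a walk has a
choice. -/
theorem cross (h : BarbellStates st p q N) {i j : ℕ} (hi : i < N) (hj : 1 ≤ j) (hj' : j ≤ N)
    (hij : st i = (st j).bar) :
    (i = 0 ∧ j = p) ∨ (i = q ∧ j = N) := by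
  have h1 := h.one_le
  have h2 := h.le
  have h3 := h.lt
  rcases Nat.eq_zero_or_pos i with rfl | hi'
  · left
    rw [h.left, State.bar_inj] at hij
    exact ⟨rfl, (h.end_inj h1 (by omega) hj hj' hij).symm⟩
  · right
    rcases Nat.lt_or_ge j N with hj2 | hj2
    · have := h.inj i j hi' hi hj hj2 (State.bar_fst (st j) ▸ congrArg Prod.fst hij)
      subst this
      exact absurd hij.symm (State.bar_ne _)
    · obtain rfl : j = N := by omega
      rw [h.right, State.bar_bar] at hij
      exact ⟨h.start_inj hi h3 hij, rfl⟩

end BarbellStates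

/-- A barbell in a polarized quiver, as a sequence of letters. -/
structure BarbellWalk {V : Type u} [Quiver.{v} V] (P : Polarization V) (W : ℕ → Letter V)
    (st : ℕ → State V) (p q N : ℕ) : Prop extends BarbellStates st p q N where
  src : ∀ i < N, P.lsrc (W i) = st i
  tgt : ∀ i < N, P.ltgt (W i) = st (i + 1)
  cover : ∀ a, ∃ i < N, (W i).arrow = a

/-- In a closed walk each letter is followed by a letter. -/
theorem Polarization.Walk.exists_next {V : Type u} [Quiver.{v} V] {P : Polarization V} {p : State V}
    {w : Word V} (h : P.Walk p w p) {l : Letter V} (hl : l ∈ w) : ∃ m ∈ w, P.lsrc m = P.ltgt l := by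
  obtain ⟨s, t, rfl⟩ := List.append_of_mem hl
  have h1 := h
  rw [walk_append] at h1
  obtain ⟨q, h1, rfl, h2⟩ := h1
  cases t with
  | nil =>
    obtain rfl : P.ltgt l = p := h2
    cases s with
    | nil => exact ⟨l, by simp, h1.symm⟩
    | cons m s => exact ⟨m, by simp, h1.1⟩
  | cons m t => exact ⟨m, by simp, h2.1⟩

namespace BarbellWalk

variable {V : Type u} [Quiver.{v} V] {P : Polarization V} {W : ℕ → Letter V} {st : ℕ → State V}
  {p q N : ℕ}

theorem lsrc_inv (h : BarbellWalk P W st p q N) {i : ℕ} (hi : i < N) : P.lsrc (W i).inv =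
    (st (i + 1)).bar := by
  rw [P.lsrc_inv, h.tgt i hi]

theorem ltgt_inv (h : BarbellWalk P W st p q N) {i : ℕ} (hi : i < N) : P.ltgt (W i).inv =
    (st i).bar := by
  rw [P.ltgt_inv, h.src i hi]

theorem arrow_inj (h : BarbellWalk P W st p q N) {i j : ℕ} (hi : i < N) (hj : j < N)
    (hij : (W i).arrow = (W j).arrow) :
    i = j := by
  have h1 := h.one_le
  have h2 := h.le
  have h3 := h.lt
  rcases Letter.eq_or_eq_inv hij with he | he
  · exact h.start_inj hi hj (by rw [← h.src i hi, he, h.src j hj])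
  · have e1 : st i = (st (j + 1)).bar := by rw [← h.src i hi, he, h.lsrc_inv hj]
    have e2 : st j = (st (i + 1)).bar := by
      rw [← h.tgt i hi, he, h.ltgt_inv hj, State.bar_bar]
    have c1 := h.cross hi (by omega) (by omega) e1
    have c2 := h.cross hj (by omega) (by omega) e2
    omega

theorem letter_cases (h : BarbellWalk P W st p q N) (m : Letter V) : ∃ i < N, m = W i ∨ m =
    (W i).inv := by
  obtain ⟨i, hi, he⟩ := h.cover m.arrow
  exact ⟨i, hi, Letter.eq_or_eq_inv he.symm⟩

/-- The first letter of the loop and the inverse of the last one leave from the same side; with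
equal directions they would coincide. -/
theorem left_dir (h : BarbellWalk P W st p q N) : (W 0).dir = (W (p - 1)).dir := by
  have h1 := h.one_le
  have h2 := h.le
  have h3 := h.lt
  by_contra hne
  have he : W 0 = (W (p - 1)).inv := by
    refine P.lsrc_inj ?_ ?_
    · revert hne
      simp only [Letter.inv_dir]
      cases (W 0).dir <;> cases (W (p - 1)).dir <;> simp
    · rw [h.src 0 (by omega), h.lsrc_inv (by omega), h.left, Nat.sub_add_cancel h1]
  have := h.arrow_inj (i := 0) (j := p - 1) (by omega) (by omega) (by rw [he]; rfl)
  rw [← this] at hne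
  exact hne rfl

theorem right_dir (h : BarbellWalk P W st p q N) : (W q).dir = (W (N - 1)).dir := by
  have h1 := h.one_le
  have h2 := h.le
  have h3 := h.lt
  by_contra hne
  have he : W q = (W (N - 1)).inv := by
    refine P.lsrc_inj ?_ ?_
    · revert hne
      simp only [Letter.inv_dir]
      cases (W q).dir <;> cases (W (N - 1)).dir <;> simp
    · rw [h.src q h3, h.lsrc_inv (by omega), Nat.sub_add_cancel (by omega), h.right, State.bar_bar]
  have := h.arrow_inj (i := q) (j := N - 1) (by omega) (by omega) (by rw [he]; rfl)
  rw [← this] at hne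
  exact hne rfl

/-- The zero relations of a barbell. -/
theorem rel_iff (h : BarbellWalk P W st p q N) (hl : (W 0).dir = true) (hr : (W q).dir = true)
    (a b : Quiver.Total V) :
    P.Rel a b ↔ (a = (W (p - 1)).arrow ∧ b = (W 0).arrow) ∨
      (a = (W (N - 1)).arrow ∧ b = (W q).arrow) := by
  have h1 := h.one_le
  have h2 := h.le
  have h3 := h.lt
  have hmk : ∀ m : Letter V, m.dir = true → (⟨m.arrow, true⟩ : Letter V) = m := by
    rintro ⟨a, d⟩ rfl
    rfl
  rw [P.rel_iff_lsrc]
  constructor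
  · intro hrel
    obtain ⟨i, hi, ha⟩ := h.letter_cases ⟨a, true⟩
    obtain ⟨j, hj, hb⟩ := h.letter_cases ⟨b, true⟩
    rcases ha with ha | ha <;> rcases hb with hb | hb <;> rw [ha, hb] at hrel
    · rw [h.tgt i hi, h.src j hj] at hrel
      have hc := h.cross hj (i := j) (j := i + 1) (by omega) (by omega)
        (by rw [hrel, State.bar_bar])
      have ha' := congrArg Letter.arrow ha
      have hb' := congrArg Letter.arrow hb
      rcases hc with ⟨rfl, hc⟩ | ⟨rfl, hc⟩
      · left
        rw [show p - 1 = i by omega]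
        exact ⟨ha', hb'⟩
      · right
        rw [show N - 1 = i by omega]
        exact ⟨ha', hb'⟩
    · rw [h.tgt i hi, h.lsrc_inv hj, State.bar_bar] at hrel
      have := h.end_inj (by omega) (by omega) (by omega) (by omega) hrel
      obtain rfl : i = j := by omega
      rw [← ha] at hb
      exact absurd (congrArg Letter.dir hb) (by simp)
    · rw [h.ltgt_inv hi, h.src j hj, State.bar_inj] at hrel
      obtain rfl := h.start_inj hi hj hrel
      rw [← hb] at ha
      exact absurd (congrArg Letter.dir ha) (by simp)
    · rw [h.ltgt_inv hi, h.lsrc_inv hj, State.bar_bar] at hrel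
      have hc := h.cross (i := i) (j := j + 1) hi (by omega) (by omega)
        (by rw [← hrel, State.bar_bar])
      have ha' := congrArg Letter.dir ha
      rcases hc with ⟨rfl, -⟩ | ⟨rfl, -⟩
      · simp [hl] at ha'
      · simp [hr] at ha'
  · rintro (⟨rfl, rfl⟩ | ⟨rfl, rfl⟩)
    · rw [hmk _ (h.left_dir ▸ hl), hmk _ hl, h.tgt _ (by omega), h.src _ (by omega),
        Nat.sub_add_cancel h1, h.left, State.bar_bar]
    · rw [hmk _ (h.right_dir ▸ hr), hmk _ hr, h.tgt _ (by omega), h.src _ (by omega),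
        Nat.sub_add_cancel (by omega), h.right]

theorem ideal_eq (h : BarbellWalk P W st p q N) (k : Type w) [Field k] [Fintype V]
    (hl : (W 0).dir = true)
    (hr : (W q).dir = true) :
    P.ideal k = TwoSidedIdeal.span
      {ofArrow k (W 0).arrow * ofArrow k (W (p - 1)).arrow,
        ofArrow k (W q).arrow * ofArrow k (W (N - 1)).arrow} := by
  rw [Polarization.ideal]
  congr 1
  ext f
  simp only [h.rel_iff hl hr, Set.mem_insert_iff, Set.mem_singleton_iff]
  constructor
  · rintro ⟨a, b, ⟨rfl, rfl⟩ | ⟨rfl, rfl⟩, rfl⟩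
    · exact Or.inl rfl
    · exact Or.inr rfl
  · rintro (rfl | rfl)
    · exact ⟨_, _, Or.inl ⟨rfl, rfl⟩, rfl⟩
    · exact ⟨_, _, Or.inr ⟨rfl, rfl⟩, rfl⟩

/-! ### Closed walks in a barbell -/

section Closed

variable {s : State V} {w : Word V}

/-- At a time `m ≥ 1` other than `q`, the only letter leaving `st m` is `W m`, so a closed walk that
passes this state is forced on. `backward` is the same for the reversed walk, with `p` as the
exceptional time. -/
theorem forward (h : BarbellWalk P W st p q N) (hw : P.Walk s w s) {i j : ℕ} (hij : i ≤ j)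
    (hi : 1 ≤ i) (hj : j ≤ N) (hq : ∀ m, i ≤ m → m < j → m ≠ q)
    (hT : ∃ m ∈ w, P.lsrc m = st i) :
    (∀ m, i ≤ m → m < j → W m ∈ w) ∧ (j < N ∨ i < j → ∃ m ∈ w, P.lsrc m = st j) := by
  induction j, hij using Nat.le_induction with
  | base => exact ⟨fun m h1 h2 => by omega, fun _ => hT⟩
  | succ j hij ih =>
    obtain ⟨ih1, ih2⟩ := ih (by omega) fun m h1 h2 => hq m h1 (by omega)
    obtain ⟨m, hm, hmj⟩ := ih2 (Or.inl (by omega))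
    have hjw : W j ∈ w := by
      obtain ⟨n, hn, rfl | rfl⟩ := h.letter_cases m
      · rw [h.src n hn] at hmj
        rwa [← h.start_inj hn (by omega) hmj]
      · rw [h.lsrc_inv hn] at hmj
        have hc := h.cross (i := j) (j := n + 1) (by omega) (by omega) (by omega) hmj.symm
        have := hq j hij (by omega)
        omega
    refine ⟨fun n h1 h2 => ?_, fun _ => ?_⟩
    · rcases Nat.lt_or_ge n j with h3 | h3
      · exact ih1 n h1 h3
      · rwa [show n = j by omega]
    · have := hw.exists_next hjw
      rwa [h.tgt j (by omega)] at this

theorem backward (h : BarbellWalk P W st p q N) (hw : P.Walk s w s) {i j : ℕ} (hij : j ≤ i)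
    (hi : i < N) (hp : ∀ m, j < m → m ≤ i → m ≠ p)
    (hT : ∃ m ∈ w, P.lsrc m = (st i).bar) :
    (∀ m, j ≤ m → m < i → (W m).inv ∈ w) ∧ ∃ m ∈ w, P.lsrc m = (st j).bar := by
  induction i, hij using Nat.le_induction with
  | base => exact ⟨fun m h1 h2 => by omega, hT⟩
  | succ i hij ih =>
    obtain ⟨m, hm, hmi⟩ := hT
    have hiw : (W i).inv ∈ w := by
      obtain ⟨n, hn, rfl | rfl⟩ := h.letter_cases m
      · rw [h.src n hn] at hmi
        have hc := h.cross (i := n) (j := i + 1) hn (by omega) (by omega) hmi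
        have := hp (i + 1) (by omega) le_rfl
        omega
      · rw [h.lsrc_inv hn, State.bar_inj] at hmi
        have := h.end_inj (by omega) (by omega) (by omega) (by omega) hmi
        rwa [show i = n by omega]
    have hT' := hw.exists_next hiw
    rw [h.ltgt_inv (by omega)] at hT'
    obtain ⟨ih1, ih2⟩ := ih (by omega) (fun m h1 h2 => hp m h1 (by omega)) hT'
    refine ⟨fun n h1 h2 => ?_, ih2⟩
    rcases Nat.lt_or_ge n i with h3 | h3
    · exact ih1 n h1 h3
    · rwa [show n = i by omega]

/-- From `st 0` a walk can enter the loop at either end. After that it has no choice, and both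
directions bring it out in `st p`. -/
theorem left_loop (h : BarbellWalk P W st p q N) (hw : P.Walk s w s)
    (hT : ∃ m ∈ w, P.lsrc m = st 0) :
    (∃ m ∈ w, P.lsrc m = st p) ∧ ((∀ m < p, W m ∈ w) ∨ ∀ m < p, (W m).inv ∈ w) := by
  have h1 := h.one_le
  have h2 := h.le
  have h3 := h.lt
  obtain ⟨m, hm, hm0⟩ := hT
  obtain ⟨n, hn, rfl | rfl⟩ := h.letter_cases m
  · rw [h.src n hn] at hm0
    obtain rfl := h.start_inj hn (by omega) hm0
    have hT := hw.exists_next hm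
    rw [h.tgt 0 hn] at hT
    obtain ⟨f1, f2⟩ := h.forward hw h1 le_rfl (by omega) (fun m _ _ => by omega) hT
    refine ⟨f2 (Or.inl (by omega)), Or.inl fun m hmp => ?_⟩
    rcases Nat.eq_zero_or_pos m with rfl | hpos
    · exact hm
    · exact f1 m hpos hmp
  · rw [h.lsrc_inv hn] at hm0
    have hc := h.cross (i := 0) (j := n + 1) (by omega) (by omega) (by omega) hm0.symm
    have hT := hw.exists_next hm
    rw [h.ltgt_inv hn] at hT
    obtain ⟨f1, f2⟩ := h.backward hw (Nat.zero_le n) hn (fun m _ _ => by omega) hT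
    refine ⟨?_, Or.inr fun m hmp => ?_⟩
    · rwa [h.left, State.bar_bar] at f2
    · rcases Nat.lt_or_ge m n with h4 | h4
      · exact f1 m (Nat.zero_le m) h4
      · rwa [show m = n by omega]

theorem right_loop (h : BarbellWalk P W st p q N) (hw : P.Walk s w s)
    (hT : ∃ m ∈ w, P.lsrc m = st q) :
    (∃ m ∈ w, P.lsrc m = (st q).bar) ∧ ((∀ m, q ≤ m → m < N → W m ∈ w) ∨
      ∀ m, q ≤ m → m < N → (W m).inv ∈ w) := by
  have h1 := h.one_le
  have h2 := h.le
  have h3 := h.lt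
  obtain ⟨m, hm, hm0⟩ := hT
  obtain ⟨n, hn, rfl | rfl⟩ := h.letter_cases m
  · rw [h.src n hn] at hm0
    obtain rfl := h.start_inj hn h3 hm0
    have hT := hw.exists_next hm
    rw [h.tgt n hn] at hT
    obtain ⟨f1, f2⟩ := h.forward hw (i := n + 1) (j := N) (by omega) (by omega) le_rfl
      (fun m _ _ => by omega) hT
    refine ⟨?_, Or.inl fun m hmp hmN => ?_⟩
    · rw [← h.right]
      rcases Nat.lt_or_ge (n + 1) N with h4 | h4
      · exact f2 (Or.inr h4)
      · rwa [show n + 1 = N by omega] at hT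
    · rcases Nat.lt_or_ge n m with h4 | h4
      · exact f1 m h4 hmN
      · rwa [show m = n by omega]
  · rw [h.lsrc_inv hn] at hm0
    have hc := h.cross (i := q) (j := n + 1) h3 (by omega) (by omega) hm0.symm
    have hT := hw.exists_next hm
    rw [h.ltgt_inv hn] at hT
    obtain ⟨f1, f2⟩ := h.backward hw (i := n) (j := q) (by omega) hn (fun m _ _ => by omega) hT
    refine ⟨f2, Or.inr fun m hmp hmN => ?_⟩
    rcases Nat.lt_or_ge m n with h4 | h4
    · exact f1 m hmp h4
    · rwa [show m = n by omega]

/-- A closed walk runs through both loops of a barbell and through the bar in both directions. -/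
theorem closed_walk (h : BarbellWalk P W st p q N) (hw : P.Walk s w s) (hne : w ≠ []) :
    (∀ m, p ≤ m → m < q → W m ∈ w ∧ (W m).inv ∈ w) ∧
    ((∀ m < p, W m ∈ w) ∨ ∀ m < p, (W m).inv ∈ w) ∧
    ((∀ m, q ≤ m → m < N → W m ∈ w) ∨ ∀ m, q ≤ m → m < N → (W m).inv ∈ w) := by
  have h1 := h.one_le
  have h2 := h.le
  have h3 := h.lt
  have hbar : st p = (st 0).bar := by rw [h.left, State.bar_bar]
  have bar_to_zero : ∀ i, p ≤ i → i < N → (∃ m ∈ w, P.lsrc m = (st i).bar) →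
      (∀ m, p ≤ m → m < i → (W m).inv ∈ w) ∧ ∃ m ∈ w, P.lsrc m = st 0 := by
    intro i hi hiN hT
    rw [h.left]
    exact h.backward hw hi hiN (fun m _ _ => by omega) hT
  -- From any letter the forced continuation reaches the exit of the left loop, possibly after the
  -- right loop and the way back along the bar. From there the walk must cover the bar, the right
  -- loop, the bar backwards and the left loop.
  have hTp : ∃ m ∈ w, P.lsrc m = st p := by
    suffices hor : (∃ m ∈ w, P.lsrc m = st 0) ∨ (∃ m ∈ w, P.lsrc m = st p) from
      hor.elim (fun h0 => (h.left_loop hw h0).1) id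
    obtain ⟨m, hm⟩ := List.exists_mem_of_ne_nil w hne
    obtain ⟨n, hn, rfl | rfl⟩ := h.letter_cases m
    · have hT : ∃ m ∈ w, P.lsrc m = st n := ⟨_, hm, h.src n hn⟩
      rcases Nat.eq_zero_or_pos n with rfl | hpos
      · exact Or.inl hT
      · left
        rcases Nat.lt_or_ge q n with hqn | hqn
        · have := (h.forward hw (i := n) (j := N) (by omega) hpos le_rfl
            (fun m _ _ => by omega) hT).2 (Or.inr hn)
          rw [h.right] at this
          exact (bar_to_zero q h2 h3 this).2
        · have := (h.forward hw (i := n) (j := q) hqn hpos h3.le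
            (fun m _ _ => by omega) hT).2 (Or.inl h3)
          exact (bar_to_zero q h2 h3 (h.right_loop hw this).1).2
    · have hT : ∃ m ∈ w, P.lsrc m = (st n).bar := by
        have := hw.exists_next hm
        rwa [h.ltgt_inv hn] at this
      rcases Nat.lt_or_ge n p with hnp | hnp
      · right
        rw [hbar]
        exact (h.backward hw (Nat.zero_le n) hn (fun m _ _ => by omega) hT).2
      · exact Or.inl (bar_to_zero n hnp hn hT).2
  obtain ⟨f1, f2⟩ := h.forward hw h2 h1 h3.le (fun m _ _ => by omega) hTp
  obtain ⟨r1, r2⟩ := h.right_loop hw (f2 (Or.inl h3))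
  obtain ⟨b1, b2⟩ := bar_to_zero q h2 h3 r1
  exact ⟨fun m hm hm' => ⟨f1 m hm hm', b1 m hm hm'⟩, (h.left_loop hw b2).2, r2⟩

end Closed

theorem covering (h : BarbellWalk P W st p q N) : P.Covering := by
  intro s w hne hw a
  obtain ⟨i, hi, rfl⟩ := h.cover a
  obtain ⟨h1, h2, h3⟩ := h.closed_walk hw hne
  rcases Nat.lt_or_ge i p with hip | hip
  · rcases h2 with h2 | h2
    · exact ⟨_, h2 i hip, rfl⟩
    · exact ⟨_, h2 i hip, rfl⟩
  · rcases Nat.lt_or_ge i q with hiq | hiq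
    · exact ⟨_, (h1 i hip hiq).1, rfl⟩
    · rcases h3 with h3 | h3
      · exact ⟨_, h3 i hiq hi, rfl⟩
      · exact ⟨_, h3 i hiq hi, rfl⟩

/-- There are no closed directed walks in a barbell, unless it consists of two directed cycles. -/
theorem not_directed (h : BarbellWalk P W st p q N) (hl : (W 0).dir = true) (hr : (W q).dir = true)
    (hd : ¬ (p = q ∧ ∀ i < N, (W i).dir = true)) {s : State V} {w : Word V} (hne : w ≠ [])
    (hw : P.Walk s w s) : ¬ ∀ l ∈ w, l.dir = true := by
  intro hdir
  have hp := h.one_le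
  have hpq := h.le
  have hqN := h.lt
  obtain ⟨h1, h2, h3⟩ := h.closed_walk hw hne
  have hdinv : ∀ i, (W i).dir = true → (W i).inv ∉ w := fun i hi hmem => by
    have := hdir _ hmem
    simp [hi] at this
  apply hd
  -- A bar of positive length is traversed in both directions, which a directed walk cannot do.
  have heq : p = q := by
    by_contra hne
    have h4 := h1 p le_rfl (by omega)
    exact hdinv p (hdir _ h4.1) h4.2
  refine ⟨heq, fun i hi => ?_⟩
  rcases Nat.lt_or_ge i p with hip | hip
  · rcases h2 with h2 | h2
    · exact hdir _ (h2 i hip)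
    · exact absurd (h2 0 (by omega)) (hdinv 0 hl)
  · rcases h3 with h3 | h3
    · exact hdir _ (h3 i (by omega) hi)
    · exact absurd (h3 q le_rfl hqN) (hdinv q hr)

end BarbellWalk

/-! ### Words along sequences of letters -/

namespace Word

variable {V : Type u} [Quiver.{v} V] {W : ℕ → Letter V}

/-- The word formed by the letters at the times `i, …, j - 1`. -/
def seg (W : ℕ → Letter V) (i j : ℕ) : Word V := (List.range' i (j - i)).map W

theorem mem_seg {i j : ℕ} {l : Letter V} : l ∈ seg W i j ↔ ∃ m, i ≤ m ∧ m < j ∧ W m = l := by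
  simp only [seg, List.mem_map, List.mem_range'_1]
  constructor
  · rintro ⟨m, hm, rfl⟩
    exact ⟨m, hm.1, by omega, rfl⟩
  · rintro ⟨m, h1, h2, rfl⟩
    exact ⟨m, ⟨h1, by omega⟩, rfl⟩

theorem seg_ne_nil {i j : ℕ} (h : i < j) : seg W i j ≠ [] :=
  List.ne_nil_of_mem (mem_seg.2 ⟨i, le_rfl, h, rfl⟩)

theorem seg_eq_cons {i j : ℕ} (h : i < j) : seg W i j = W i :: seg W (i + 1) j := by
  rw [seg, seg, show j - i = (j - (i + 1)) + 1 by omega, List.range'_succ, List.map_cons]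

theorem seg_append {i j m : ℕ} (h : i ≤ j) (h' : j ≤ m) : seg W i j ++ seg W j m = seg W i m := by
  rw [seg, seg, seg, ← List.map_append]
  congr 1
  have := List.range'_append_1 (s := i) (m := j - i) (n := m - j)
  rwa [show i + (j - i) = j by omega, show j - i + (m - j) = m - i by omega] at this

theorem getLast?_seg {i j : ℕ} (h : i < j) : (seg W i j).getLast? = some (W (j - 1)) := by
  have h1 := seg_append (W := W) (i := i) (j := j - 1) (m := j) (by omega) (by omega)
  rw [← h1, seg_eq_cons (W := W) (i := j - 1) (j := j) (by omega),
    show j - 1 + 1 = j by omega]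
  simp [seg]

/-- The vertices of a barbell, in the order in which they are passed. -/
theorem vertices_eq {v : ℕ → V} {p q N : ℕ} (h1 : 1 ≤ p) (h2 : p ≤ q) (h3 : q < N)
    (hsrc : ∀ i < N, (W i).src = v i) (htgt : ∀ i < N, (W i).tgt = v (i + 1)) :
    (seg W 0 p).tail.map Letter.src ++ (v p :: (seg W p q).map Letter.tgt) ++
      (seg W q N).tail.map Letter.src = (List.range' 1 (N - 1)).map v := by
  have hs : ∀ i j, j ≤ N → (seg W i j).map Letter.src = (List.range' i (j - i)).map v := by
    intro i j hj
    rw [seg, List.map_map]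
    refine List.map_congr_left fun m hm => ?_
    rw [List.mem_range'_1] at hm
    exact hsrc m (by omega)
  have ht : (seg W p q).map Letter.tgt = (List.range' (p + 1) (q - p)).map v := by
    rw [seg, List.map_map, add_comm, ← List.map_add_range', List.map_map]
    refine List.map_congr_left fun m hm => ?_
    rw [List.mem_range'_1] at hm
    rw [Function.comp_apply, Function.comp_apply, htgt m (by omega), add_comm]
  rw [seg_eq_cons (by omega : 0 < p), seg_eq_cons h3, List.tail_cons, List.tail_cons,
    hs _ _ (by omega), hs _ _ le_rfl, ht, ← List.map_cons, ← List.range'_succ, ← List.map_append,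
    ← List.map_append]
  congr 1
  have e1 := List.range'_append_1 (s := 1) (m := p - (0 + 1)) (n := q - p + 1)
  rw [show 1 + (p - (0 + 1)) = p by omega] at e1
  rw [e1]
  have e2 := List.range'_append_1 (s := 1) (m := p - (0 + 1) + (q - p + 1)) (n := N - (q + 1))
  rw [show 1 + (p - (0 + 1) + (q - p + 1)) = q + 1 by omega,
    show p - (0 + 1) + (q - p + 1) + (N - (q + 1)) = N - 1 by omega] at e2
  exact e2

end Word

namespace Polarization

variable {V : Type u} [Quiver.{v} V] {P : Polarization V}

theorem walk_seg {W : ℕ → Letter V} {st : ℕ → State V} {i j : ℕ} (hij : i ≤ j)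
    (hsrc : ∀ m, i ≤ m → m < j → P.lsrc (W m) = st m)
    (htgt : ∀ m, i ≤ m → m < j → P.ltgt (W m) = st (m + 1)) :
    P.Walk (st i) (Word.seg W i j) (st j) := by
  induction j, hij using Nat.le_induction with
  | base => simp [Word.seg]
  | succ j hij ih =>
    rw [← Word.seg_append hij (Nat.le_succ j), Word.seg_eq_cons (Nat.lt_succ_self j)]
    refine (ih (fun m h1 h2 => hsrc m h1 (by omega)) (fun m h1 h2 => htgt m h1 (by omega))).append
      ⟨hsrc j hij (by omega), ?_⟩
    simpa [Word.seg] using htgt j hij (by omega)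

/-- A closed walk can be continued for ever. -/
theorem Walk.exists_seq {s : State V} {w : Word V} (h : P.Walk s w s) (hw : w ≠ []) :
    ∃ W : ℕ → Letter V, ∀ i, P.lsrc (W (i + 1)) = P.ltgt (W i) := by
  choose! f hf hf' using fun l (hl : l ∈ w) => h.exists_next hl
  obtain ⟨l, hl⟩ := List.exists_mem_of_ne_nil w hw
  have hmem : ∀ i, f^[i] l ∈ w := by
    intro i
    induction i with
    | zero => exact hl
    | succ i ih =>
      rw [Function.iterate_succ_apply']
      exact hf _ ih
  refine ⟨fun i => f^[i] l, fun i => ?_⟩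
  dsimp only
  rw [Function.iterate_succ_apply']
  exact hf' _ (hmem i)

end Polarization

/-- A closed walk without repeated vertices that runs through all arrows. -/
structure CycleWalk {V : Type u} [Quiver.{v} V] (P : Polarization V) {n : ℕ}
    (W : ZMod (n + 1) → Letter V) (st : ZMod (n + 1) → State V) : Prop where
  src : ∀ z, P.lsrc (W z) = st z
  tgt : ∀ z, P.ltgt (W z) = st (z + 1)
  inj : Function.Injective fun z => (st z).1
  cover : ∀ a, ∃ z, (W z).arrow = a

namespace Polarization

variable {V : Type u} [Quiver.{v} V] {P : Polarization V}

/-- A sequence that closes up after `n + 1` steps, as a function on `ℤ / (n + 1)`. -/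
theorem cycleWalk_of_seq {W : ℕ → Letter V} {st : ℕ → State V} {n : ℕ}
    (hsrc : ∀ i, P.lsrc (W i) = st i) (htgt : ∀ i, P.ltgt (W i) = st (i + 1))
    (hinj : ∀ i j, i < n + 1 → j < n + 1 → (st i).1 = (st j).1 → i = j)
    (hend : st (n + 1) = st 0) (hcov : ∀ a, ∃ i < n + 1, (W i).arrow = a) :
    CycleWalk P (fun z : ZMod (n + 1) => W z.val) (fun z => st z.val) where
  src z := hsrc _
  tgt z := by
    rw [htgt, ZMod.val_add, ZMod.val_one_eq_one_mod, Nat.add_mod_mod]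
    rcases Nat.lt_or_ge (z.val + 1) (n + 1) with h | h
    · rw [Nat.mod_eq_of_lt h]
    · obtain h' : z.val + 1 = n + 1 := le_antisymm (ZMod.val_lt z) h
      rw [h', Nat.mod_self, hend]
  inj z z' h := ZMod.val_injective _ (hinj _ _ (ZMod.val_lt z) (ZMod.val_lt z') h)
  cover a := by
    obtain ⟨i, hi, rfl⟩ := hcov a
    exact ⟨i, by rw [ZMod.val_natCast_of_lt hi]⟩

/-- If every closed walk runs through all arrows, then the quiver is a cycle or a barbell. -/
theorem Covering.cycle_or_barbell [Finite V] (hP : P.Covering) {s : State V} {w : Word V}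
    (h : P.Walk s w s) (hw : w ≠ []) :
    (∃ (n : ℕ) (W : ZMod (n + 1) → Letter V) (st : ZMod (n + 1) → State V), CycleWalk P W st) ∨
      ∃ (W : ℕ → Letter V) (st : ℕ → State V) (p q N : ℕ), BarbellWalk P W st p q N := by
  classical
  obtain ⟨F, hF⟩ := h.exists_seq hw
  -- Take the first repeated vertex and shift the time so that its first visit is at time 0. It is
  -- met again at time `p + 1`, and the vertices before that are distinct.
  have hrep : ∃ N, ∃ i < N, (P.lsrc (F i)).1 = (P.lsrc (F N)).1 := by
    obtain ⟨i, j, hij, he⟩ := Finite.exists_ne_map_eq_of_infinite fun i => (P.lsrc (F i)).1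
    rcases lt_or_gt_of_ne hij with hlt | hlt
    · exact ⟨j, i, hlt, he⟩
    · exact ⟨i, j, hlt, he.symm⟩
  obtain ⟨i, hi, he⟩ := Nat.find_spec hrep
  have hmin := fun m => Nat.find_min hrep (m := m)
  generalize Nat.find hrep = N₁ at hi he hmin
  obtain ⟨p, rfl⟩ := Nat.exists_eq_add_of_lt hi
  obtain ⟨W, hWF⟩ : ∃ W : ℕ → Letter V, ∀ m, W m = F (i + m) := ⟨fun m => F (i + m), fun _ => rfl⟩
  obtain ⟨st, hsrc⟩ : ∃ st : ℕ → State V, ∀ m, P.lsrc (W m) = st m := ⟨_, fun _ => rfl⟩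
  have htgt : ∀ m, P.ltgt (W m) = st (m + 1) := fun m => by
    rw [← hsrc, hWF, hWF, ← add_assoc, hF]
  have hinj : ∀ a b, a < b → b < p + 1 → (st a).1 ≠ (st b).1 := by
    intro a b hab hb hne
    rw [← hsrc, ← hsrc, hWF, hWF] at hne
    exact hmin (i + b) (by omega) ⟨i + a, by omega, hne⟩
  replace he : (st 0).1 = (st (p + 1)).1 := by
    rw [← hsrc, ← hsrc, hWF, hWF]
    exact he
  clear hmin hWF hrep
  have hwalk : ∀ a b, a ≤ b → P.Walk (st a) (Word.seg W a b) (st b) := fun a b hab =>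
    walk_seg hab (fun m _ _ => hsrc m) (fun m _ _ => htgt m)
  rcases State.eq_or_eq_bar he with he | he
  · left
    refine ⟨p, _, _, cycleWalk_of_seq hsrc htgt ?_ he.symm ?_⟩
    · intro a b ha hb hab
      by_contra hne
      rcases lt_or_gt_of_ne hne with hlt | hlt
      · exact hinj a b hlt hb hab
      · exact hinj b a hlt ha hab.symm
    · intro a
      have h1 := hwalk 0 (p + 1) (by omega)
      rw [← he] at h1
      obtain ⟨l, hl, hla⟩ := hP _ _ (Word.seg_ne_nil (by omega)) h1 a
      obtain ⟨m, -, hm, rfl⟩ := Word.mem_seg.1 hl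
      exact ⟨m, hm, hla⟩
  · right
    -- The left loop is closed. Time 0 is excluded because its vertex reappears at time `p + 1`; the
    -- next repetition is to close the right loop.
    have hrep : ∃ N, ∃ j, 1 ≤ j ∧ j < N ∧ (st j).1 = (st N).1 := by
      obtain ⟨i, j, hij, he⟩ := Finite.exists_ne_map_eq_of_infinite fun i => (st (i + 1)).1
      rcases lt_or_gt_of_ne hij with hlt | hlt
      · exact ⟨j + 1, i + 1, by omega, by omega, he⟩
      · exact ⟨i + 1, j + 1, by omega, by omega, he.symm⟩
    obtain ⟨q, hq, hqN, heq⟩ := Nat.find_spec hrep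
    have hmin := fun m => Nat.find_min hrep (m := m)
    generalize Nat.find hrep = N at hqN heq hmin
    have hinj' : ∀ a b, 1 ≤ a → a < N → 1 ≤ b → b < N → (st a).1 = (st b).1 → a = b := by
      intro a b ha ha' hb hb' hab
      by_contra hne
      rcases lt_or_gt_of_ne hne with hlt | hlt
      · exact hmin b hb' ⟨a, ha, hlt, hab⟩
      · exact hmin a ha' ⟨b, hb, hlt, hab.symm⟩
    have hpN : p + 1 < N := by
      by_contra hle
      rcases Nat.lt_or_ge N (p + 1) with h1 | h1
      · exact hinj q N hqN h1 heq
      · obtain rfl : N = p + 1 := by omega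
        exact hinj 0 q (by omega) hqN (he ▸ heq.symm)
    have harr : ∀ a b, a < b → b < N → (W a).arrow ≠ (W b).arrow := by
      intro a b hab hb hne
      have hb1 : st (a + 1) ≠ (st b).bar := by
        intro h1
        have := hinj' (a + 1) b (by omega) (by omega) (by omega) hb 
          (State.bar_fst (st b) ▸ congrArg Prod.fst h1)
        subst this
        exact State.bar_ne _ h1.symm
      rcases Letter.eq_or_eq_inv hne with h1 | h1
      · have h2 : st a = st b := by rw [← hsrc, h1, hsrc]
        rcases Nat.eq_zero_or_pos a with rfl | hpos
        · have := hinj' (p + 1) b (by omega) hpN (by omega) hb (by rw [← h2]; exact he ▸ rfl)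
          subst this
          rw [he] at h2
          exact State.bar_ne _ h2
        · have := hinj' a b hpos (by omega) (by omega) hb (congrArg Prod.fst h2)
          omega
      · apply hb1
        rw [← htgt, h1, P.ltgt_inv, hsrc]
    rcases State.eq_or_eq_bar heq with heq | heq
    -- A return in the same state gives a closed walk from `q` to `N` that misses the arrow of `W
    -- 0`.
    · exfalso
      have h1 := hwalk q N hqN.le
      rw [← heq] at h1
      obtain ⟨l, hl, hla⟩ := hP _ _ (Word.seg_ne_nil hqN) h1 (W 0).arrow
      obtain ⟨m, hm, hm', rfl⟩ := Word.mem_seg.1 hl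
      exact harr 0 m (by omega) hm' hla.symm
    · rcases Nat.lt_or_ge q (p + 1) with hqp | hqp
      -- If the walk runs back into the inside of the left loop, going back from there to the start
      -- gives a closed walk that misses the arrow of `W p`.
      · exfalso
        have h1 := hwalk (p + 1) N hpN.le
        have h2 := (hwalk 0 q (Nat.zero_le q)).inv
        rw [heq, State.bar_bar, he, State.bar_bar] at h2
        obtain ⟨l, hl, hla⟩ := hP _ _ (by simp [Word.seg_ne_nil hpN]) (h1.append h2) (W p).arrow
        rw [List.mem_append] at hl
        rcases hl with hl | hl
        · obtain ⟨m, hm, hm', rfl⟩ := Word.mem_seg.1 hl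
          exact harr p m (by omega) hm' hla.symm
        · simp only [Word.inv, List.mem_reverse, List.mem_map] at hl
          obtain ⟨l, hl, rfl⟩ := hl
          obtain ⟨m, hm, hm', rfl⟩ := Word.mem_seg.1 hl
          exact harr m p (by omega) (by omega) hla
      · refine ⟨W, st, p + 1, q, N, ⟨by omega, hqp, hqN, he, by rw [heq, State.bar_bar], hinj'⟩,
          fun m _ => hsrc m, fun m _ => htgt m, fun a => ?_⟩
        -- The walk through everything followed by the way back along the bar is closed, so by
        -- covering these letters contain all arrows.
        have h1 := hwalk 0 N (Nat.zero_le N)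
        have h2 := (hwalk (p + 1) q hqp).inv
        rw [heq, State.bar_bar, ← he] at h2
        obtain ⟨l, hl, rfl⟩ := hP _ _ (by simp [Word.seg_ne_nil (show 0 < N by omega)])
          (h1.append h2) a
        rw [List.mem_append] at hl
        rcases hl with hl | hl
        · obtain ⟨m, hm, hm', rfl⟩ := Word.mem_seg.1 hl
          exact ⟨m, hm', rfl⟩
        · simp only [Word.inv, List.mem_reverse, List.mem_map] at hl
          obtain ⟨l, hl, rfl⟩ := hl
          obtain ⟨m, hm, hm', rfl⟩ := Word.mem_seg.1 hl
          exact ⟨m, by omega, rfl⟩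

end Polarization

/-! ### Cycles -/

namespace CycleWalk

variable {V : Type u} [Quiver.{v} V] {P : Polarization V} {n : ℕ} {W : ZMod (n + 1) → Letter V}
  {st : ZMod (n + 1) → State V}

theorem lsrc_inv (h : CycleWalk P W st) (z : ZMod (n + 1)) :
    P.lsrc (W z).inv = (st (z + 1)).bar := by
  rw [P.lsrc_inv, h.tgt]

theorem ltgt_inv (h : CycleWalk P W st) (z : ZMod (n + 1)) : P.ltgt (W z).inv = (st z).bar := by
  rw [P.ltgt_inv, h.src]

theorem ne_bar (h : CycleWalk P W st) (z z' : ZMod (n + 1)) : st z ≠ (st z').bar := by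
  intro he
  obtain rfl : z = z' := h.inj (show (st z).1 = (st z').bar.1 by rw [he])
  exact State.bar_ne _ he.symm

theorem st_inj (h : CycleWalk P W st) {z z' : ZMod (n + 1)} (he : st z = st z') : z = z' :=
  h.inj (congrArg Prod.fst he)

theorem letter_cases (h : CycleWalk P W st) (m : Letter V) : ∃ z, m = W z ∨ m = (W z).inv := by
  obtain ⟨z, he⟩ := h.cover m.arrow
  exact ⟨z, Letter.eq_or_eq_inv he.symm⟩

theorem arrow_injective (h : CycleWalk P W st) : Function.Injective fun z => (W z).arrow := by
  intro z z' he
  rcases Letter.eq_or_eq_inv he with he | he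
  · exact h.st_inj (by rw [← h.src, he, h.src])
  · exact absurd (by rw [← h.src, he, h.lsrc_inv]) (h.ne_bar z (z' + 1))

theorem not_rel (h : CycleWalk P W st) (a b : Quiver.Total V) : ¬ P.Rel a b := by
  rw [P.rel_iff_lsrc]
  intro hrel
  obtain ⟨z, ha⟩ := h.letter_cases ⟨a, true⟩
  obtain ⟨z', hb⟩ := h.letter_cases ⟨b, true⟩
  rcases ha with ha | ha <;> rcases hb with hb | hb <;> rw [ha, hb] at hrel
  · rw [h.tgt, h.src] at hrel
    exact h.ne_bar _ _ hrel
  · rw [h.tgt, h.lsrc_inv, State.bar_bar] at hrel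
    obtain rfl := add_right_cancel (h.st_inj hrel)
    rw [← ha] at hb
    exact absurd (congrArg Letter.dir hb) (by simp)
  · rw [h.ltgt_inv, h.src, State.bar_inj] at hrel
    obtain rfl := h.st_inj hrel
    rw [← hb] at ha
    exact absurd (congrArg Letter.dir ha) (by simp)
  · rw [h.ltgt_inv, h.lsrc_inv, State.bar_bar] at hrel
    exact h.ne_bar _ _ hrel.symm

theorem ideal_eq_bot (h : CycleWalk P W st) (k : Type w) [Field k] [Fintype V] : P.ideal k = ⊥ := by
  rw [Polarization.ideal, ← le_bot_iff, TwoSidedIdeal.span_le]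
  rintro _ ⟨a, b, hab, -⟩
  exact absurd hab (h.not_rel a b)

/-- From each state of the cycle only one letter leaves, so a closed walk goes around completely in
one of the two directions. -/
theorem covering (h : CycleWalk P W st) : P.Covering := by
  intro s w hne hw
  have hstep : ∀ z, W z ∈ w → W (z + 1) ∈ w := by
    intro z hz
    obtain ⟨m, hm, he⟩ := hw.exists_next hz
    rw [h.tgt] at he
    obtain ⟨z', rfl | rfl⟩ := h.letter_cases m
    · rw [h.src] at he
      rwa [← h.st_inj he]
    · rw [h.lsrc_inv] at he
      exact absurd he.symm (h.ne_bar _ _)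
  have hstep' : ∀ z, (W z).inv ∈ w → (W (z - 1)).inv ∈ w := by
    intro z hz
    obtain ⟨m, hm, he⟩ := hw.exists_next hz
    rw [h.ltgt_inv] at he
    obtain ⟨z', rfl | rfl⟩ := h.letter_cases m
    · rw [h.src] at he
      exact absurd he (h.ne_bar _ _)
    · rw [h.lsrc_inv, State.bar_inj] at he
      rwa [← h.st_inj he, add_sub_cancel_right]
  obtain ⟨m, hm⟩ := List.exists_mem_of_ne_nil w hne
  obtain ⟨z, rfl | rfl⟩ := h.letter_cases m
  · have hall : ∀ i : ℕ, W (z + i) ∈ w := by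
      intro i
      induction i with
      | zero => simpa using hm
      | succ i ih =>
        have := hstep _ ih
        rwa [add_assoc, ← Nat.cast_succ] at this
    intro a
    obtain ⟨z', rfl⟩ := h.cover a
    have := hall (z' - z).val
    rw [ZMod.natCast_zmod_val, add_sub_cancel] at this
    exact ⟨_, this, rfl⟩
  · have hall : ∀ i : ℕ, (W (z - i)).inv ∈ w := by
      intro i
      induction i with
      | zero => simpa using hm
      | succ i ih =>
        have := hstep' _ ih
        rwa [sub_sub, ← Nat.cast_succ] at this
    intro a
    obtain ⟨z', rfl⟩ := h.cover a
    have := hall (z - z').val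
    rw [ZMod.natCast_zmod_val, sub_sub_cancel] at this
    exact ⟨_, this, rfl⟩

theorem isAcyclicAffineA (h : CycleWalk P W st) [Fintype V] (k : Type w) [Field k]
    (hV : ∀ x : V, ∃ a : Quiver.Total V, a.left = x ∨ a.right = x)
    (hP : ∀ p w, w ≠ [] → P.Walk p w p → ¬ ∀ l ∈ w, l.dir = true) : IsAcyclicAffineA V n := by
  have hends : ∀ z, (W z).src = (st z).1 ∧ (W z).tgt = (st (z + 1)).1 := fun z =>
    ⟨by rw [← h.src, P.lsrc_fst], by rw [← h.tgt, P.ltgt_fst]⟩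
  refine ⟨⟨Equiv.ofBijective _ ⟨h.inj, fun x => ?_⟩,
    Equiv.ofBijective _ ⟨h.arrow_injective, h.cover⟩, fun z => ?_⟩, fun x p => ?_⟩
  · obtain ⟨a, ha⟩ := hV x
    obtain ⟨z, rfl⟩ := h.cover a
    obtain ⟨h1, h2⟩ := hends z
    cases hd : (W z).dir <;> simp only [Letter.src, Letter.tgt, hd, if_true, if_false,
      Bool.false_eq_true] at h1 h2 <;> rcases ha with rfl | rfl
    · exact ⟨_, h2.symm⟩
    · exact ⟨_, h1.symm⟩
    · exact ⟨_, h1.symm⟩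
    · exact ⟨_, h2.symm⟩
  · obtain ⟨h1, h2⟩ := hends z
    cases hd : (W z).dir <;> simp only [Letter.src, Letter.tgt, hd, if_true, if_false,
      Bool.false_eq_true] at h1 h2
    · exact Or.inr ⟨h2, h1⟩
    · exact Or.inl ⟨h1, h2⟩
  · by_contra hne
    -- An oriented cycle would yield arbitrarily long paths. As the ideal is zero, these are
    -- directed walks, whose length is bounded.
    have hlong : ∀ m : ℕ, ∃ r : Quiver.Path x x, m ≤ r.length := by
      intro m
      induction m with
      | zero => exact ⟨p, Nat.zero_le _⟩
      | succ m ih =>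
        obtain ⟨r, hr⟩ := ih
        exact ⟨r.comp p, by rw [Quiver.Path.length_comp]; omega⟩
    obtain ⟨r, hr⟩ := hlong (Fintype.card (State V) + 1)
    rcases P.mem_ideal_or_walk (k := k) r with hmem | ⟨c, s, hc, hw⟩
    · rw [h.ideal_eq_bot k, TwoSidedIdeal.mem_bot] at hmem
      exact ofPath_ne_zero _ hmem
    · have := Polarization.length_le_of_not_directed hP hw
      omega

end CycleWalk

/-! ### Barbells -/

theorem IsConnectedQuiver.exists_incident {V : Type u} [Quiver.{v} V] (h : IsConnectedQuiver V)
    (a : Quiver.Total V) (x : V) : ∃ b : Quiver.Total V, b.left = x ∨ b.right = x := by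
  obtain ⟨p⟩ := h.2 a.left x
  cases p with
  | nil => exact ⟨a, Or.inl rfl⟩
  | cons p e =>
    rcases e with e | e
    · exact ⟨⟨_, _, e⟩, Or.inr rfl⟩
    · exact ⟨⟨_, _, e⟩, Or.inl rfl⟩

namespace BarbellWalk

variable {V : Type u} [Quiver.{v} V] {P : Polarization V} {W : ℕ → Letter V} {st : ℕ → State V}
  {p q N : ℕ}

theorem walk (h : BarbellWalk P W st p q N) {i j : ℕ} (hij : i ≤ j) (hj : j ≤ N) : P.Walk (st i)
    (Word.seg W i j) (st j) :=
  Polarization.walk_seg hij (fun m _ _ => h.src m (by omega)) (fun m _ _ => h.tgt m (by omega))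

/-- Run through the left loop in the opposite direction. -/
theorem flipLeft (h : BarbellWalk P W st p q N) : BarbellWalk P
    (fun i => if i < p then (W (p - 1 - i)).inv else W i)
    (fun i => if i < p then (st (p - i)).bar else st i) p q N := by
  have h1 := h.one_le
  have h2 := h.le
  have h3 := h.lt
  refine ⟨⟨h1, h2, h3, ?_, ?_, ?_⟩, ?_, ?_, ?_⟩
  · simp [show 0 < p by omega]
  · simp [show ¬ N < p by omega, show ¬ q < p by omega, h.right]
  · intro i j hi hi' hj hj' hij
    split_ifs at hij with h4 h5 h5
    · have := h.inj (p - i) (p - j) (by omega) (by omega) (by omega) (by omega) hij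
      omega
    · have := h.inj (p - i) j (by omega) (by omega) (by omega) (by omega) hij
      omega
    · have := h.inj i (p - j) (by omega) (by omega) (by omega) (by omega) hij
      omega
    · exact h.inj i j hi hi' hj hj' hij
  · intro i hi
    split_ifs with h4
    · rw [h.lsrc_inv (by omega), show p - 1 - i + 1 = p - i by omega]
    · exact h.src i hi
  · intro i hi
    split_ifs with h4 h5 h5
    · rw [h.ltgt_inv (by omega), show p - 1 - i = p - (i + 1) by omega]
    · rw [h.ltgt_inv (by omega), show p - 1 - i = 0 by omega, h.left, State.bar_bar,
        show i + 1 = p by omega]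
    · omega
    · exact h.tgt i hi
  · intro a
    obtain ⟨i, hi, rfl⟩ := h.cover a
    rcases Nat.lt_or_ge i p with h4 | h4
    · refine ⟨p - 1 - i, by omega, ?_⟩
      rw [if_pos (by omega), show p - 1 - (p - 1 - i) = i by omega]
      rfl
    · exact ⟨i, hi, by rw [if_neg (by omega)]⟩

/-- Run through the right loop in the opposite direction. -/
theorem flipRight (h : BarbellWalk P W st p q N) : BarbellWalk P
    (fun i => if i < q then W i else (W (N - 1 - (i - q))).inv)
    (fun i => if i ≤ q then st i else (st (N - (i - q))).bar) p q N := by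
  have h1 := h.one_le
  have h2 := h.le
  have h3 := h.lt
  refine ⟨⟨h1, h2, h3, ?_, ?_, ?_⟩, ?_, ?_, ?_⟩
  · simp [h2, h.left]
  · simp [show ¬ N ≤ q by omega, show N - (N - q) = q by omega]
  · intro i j hi hi' hj hj' hij
    split_ifs at hij with h4 h5 h5
    · exact h.inj i j hi hi' hj hj' hij
    · have := h.inj i (N - (j - q)) (by omega) (by omega) (by omega) (by omega) hij
      omega
    · have := h.inj (N - (i - q)) j (by omega) (by omega) (by omega) (by omega) hij
      omega
    · have := h.inj (N - (i - q)) (N - (j - q)) (by omega) (by omega) (by omega) (by omega) hij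
      omega
  · intro i hi
    split_ifs with h4 h5 h5
    · exact h.src i hi
    · omega
    · obtain rfl : i = q := by omega
      rw [h.lsrc_inv (by omega), show N - 1 - (i - i) + 1 = N by omega, h.right, State.bar_bar]
    · rw [h.lsrc_inv (by omega), show N - 1 - (i - q) + 1 = N - (i - q) by omega]
  · intro i hi
    split_ifs with h4 h5 h5
    · exact h.tgt i hi
    · omega
    · omega
    · rw [h.ltgt_inv (by omega), show N - 1 - (i - q) = N - (i + 1 - q) by omega]
  · intro a
    obtain ⟨i, hi, rfl⟩ := h.cover a
    rcases Nat.lt_or_ge i q with h4 | h4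
    · exact ⟨i, hi, by rw [if_pos h4]⟩
    · refine ⟨N - 1 - (i - q), by omega, ?_⟩
      rw [if_neg (by omega), show N - 1 - (N - 1 - (i - q) - q) = i by omega]
      rfl

/-- Reversing a loop reverses its first letter, because the first and the last letter have the same
direction. So both loops can be made to start and end with direct arrows. -/
theorem exists_dir (h : BarbellWalk P W st p q N) : ∃ (W : ℕ → Letter V)
    (st : ℕ → State V), BarbellWalk P W st p q N ∧
    (W 0).dir = true ∧ (W q).dir = true := by
  have key : ∃ (W : ℕ → Letter V) (st : ℕ → State V), BarbellWalk P W st p q N ∧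
      (W 0).dir = true := by
    cases hd : (W 0).dir with
    | true => exact ⟨_, _, h, hd⟩
    | false =>
      refine ⟨_, _, h.flipLeft, ?_⟩
      have h1 := h.one_le
      simp [show 0 < p by omega, ← h.left_dir, hd]
  clear h
  obtain ⟨W, st, h, hd⟩ := key
  cases hd' : (W q).dir with
  | true => exact ⟨_, _, h, hd, hd'⟩
  | false =>
    refine ⟨_, _, h.flipRight, ?_, ?_⟩
    · have h1 := h.one_le
      have h2 := h.le
      simp [show 0 < q by omega, hd]
    · simp [← h.right_dir, hd']

theorem isGeneralizedBarbell (h : BarbellWalk P W st p q N) [Fintype V] (k : Type w) [Field k]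
    (hV : ∀ x : V, ∃ a : Quiver.Total V, a.left = x ∨ a.right = x)
    (hl : (W 0).dir = true) (hr : (W q).dir = true)
    (hP : ∀ p w, w ≠ [] → P.Walk p w p → ¬ ∀ l ∈ w, l.dir = true) :
    IsGeneralizedBarbell (P.ideal k) := by
  have h1 := h.one_le
  have h2 := h.le
  have h3 := h.lt
  have hsrc : ∀ i < N, (W i).src = (st i).1 := fun i hi => by rw [← h.src i hi, P.lsrc_fst]
  have htgt : ∀ i < N, (W i).tgt = (st (i + 1)).1 := fun i hi => by rw [← h.tgt i hi, P.ltgt_fst]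
  have hmk : ∀ m : Letter V, m.dir = true → m = ⟨m.arrow, true⟩ := by
    rintro ⟨a, d⟩ rfl
    rfl
  have hver := Word.vertices_eq h1 h2 h3 hsrc htgt
  have hall : Word.seg W 0 p ++ Word.seg W p q ++ Word.seg W q N = Word.seg W 0 N := by
    rw [Word.seg_append (Nat.zero_le _) h2, Word.seg_append (Nat.zero_le _) h3.le]
  have w1 := (h.walk (Nat.zero_le p) (by omega)).isWalk
  have w3 := (h.walk h3.le le_rfl).isWalk
  rw [h.left] at w1
  rw [h.right] at w3
  refine ⟨(st p).1, (st q).1, Word.seg W 0 p, Word.seg W p q, Word.seg W q N,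
    (W (p - 1)).arrow, (W 0).arrow, (W (N - 1)).arrow, (W q).arrow, w1,
    (h.walk h2 h3.le).isWalk, w3, ?_, ?_, ?_, ?_, ?_, ?_, ?_, ?_, ?_, ?_, ?_, ?_⟩
  · rw [Word.seg_eq_cons (by omega : 0 < p), ← hmk _ hl]
    rfl
  · rw [Word.getLast?_seg (by omega), ← hmk _ (h.left_dir ▸ hl)]
  · rw [Word.seg_eq_cons h3, ← hmk _ hr]
    rfl
  · rw [Word.getLast?_seg h3, ← hmk _ (h.right_dir ▸ hr)]
  · rw [hver]
    refine List.Nodup.map_on ?_ (List.nodup_range' ..)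
    intro i hi j hj hij
    rw [List.mem_range'_1] at hi hj
    exact h.inj i j hi.1 (by omega) hj.1 (by omega) hij
  · intro z
    rw [hver, List.mem_map]
    have key : ∃ i ≤ N, (st i).1 = z := by
      obtain ⟨a, ha⟩ := hV z
      obtain ⟨i, hi, rfl⟩ := h.cover a
      have e1 := hsrc i hi
      have e2 := htgt i hi
      cases hd : (W i).dir <;> simp only [Letter.src, Letter.tgt, hd, if_true, if_false,
        Bool.false_eq_true] at e1 e2 <;> rcases ha with rfl | rfl
      · exact ⟨_, hi, e2.symm⟩
      · exact ⟨_, hi.le, e1.symm⟩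
      · exact ⟨_, hi.le, e1.symm⟩
      · exact ⟨_, hi, e2.symm⟩
    obtain ⟨i, hi, rfl⟩ := key
    rcases Nat.eq_zero_or_pos i with rfl | hpos
    · exact ⟨p, by rw [List.mem_range'_1]; omega, by rw [h.left]; rfl⟩
    · rcases Nat.lt_or_ge i N with h4 | h4
      · exact ⟨i, by rw [List.mem_range'_1]; omega, rfl⟩
      · exact ⟨q, by rw [List.mem_range'_1]; omega, by rw [show i = N by omega, h.right]; rfl⟩
  · rw [hall, Word.seg, List.map_map]
    refine List.Nodup.map_on ?_ (List.nodup_range' ..)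
    intro i hi j hj hij
    rw [List.mem_range'_1] at hi hj
    exact h.arrow_inj (by omega) (by omega) hij
  · intro a
    obtain ⟨i, hi, rfl⟩ := h.cover a
    rw [hall]
    exact List.mem_map_of_mem (Word.mem_seg.2 ⟨i, Nat.zero_le i, hi, rfl⟩)
  · exact h.ideal_eq k hl hr
  · exact Polarization.isString_iff.2 ⟨Word.seg_ne_nil (by omega), _, _, h.walk (Nat.zero_le p) (by omega)⟩
  · exact Polarization.isString_iff.2 ⟨Word.seg_ne_nil h3, _, _, h.walk h3.le le_rfl⟩
  -- If the two loops compose to a string, the bar states agree and the concatenation is a closed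
  -- walk; being serial and containing a direct letter, it would be a directed one.
  · rintro ⟨hstr, hser⟩
    obtain ⟨-, s, t, hw⟩ := Polarization.isString_iff.1 hstr
    obtain ⟨r, hw1, hw2⟩ := (P.walk_append).1 hw
    have e1 : s = st 0 := hw1.start_unique (Word.seg_ne_nil (by omega))
      (h.walk (Nat.zero_le p) (by omega))
    subst e1
    have e2 := hw1.end_unique (h.walk (Nat.zero_le p) (by omega))
    have e3 := hw2.start_unique (Word.seg_ne_nil h3) (h.walk h3.le le_rfl)
    have e4 := hw2.end_unique (e3 ▸ h.walk h3.le le_rfl)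
    refine hP (st 0) _ (by simp [Word.seg_ne_nil (W := W) h3]) ?_ (hser.resolve_right fun hs => ?_)
    · convert hw using 1
      rw [h.left, ← e2, e3, e4, h.right]
    · have := hs (W q) (by
        rw [List.mem_append]
        exact Or.inr (Word.mem_seg.2 ⟨q, le_rfl, h3, rfl⟩))
      rw [hr] at this
      cases this

end BarbellWalk

/-! ### Construction of polarizations -/

/-- A polarization can be prescribed along a family of letters that runs once through each arrow. -/
theorem exists_polarization {V : Type u} [Quiver.{v} V] {ι : Type*} (W : ι → Letter V)
    (s t : ι → State V) (hsrc : ∀ i, (W i).src = (s i).1) (htgt : ∀ i, (W i).tgt = (t i).1)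
    (hb : Function.Bijective fun i => (W i).arrow) (hs : Function.Injective s)
    (ht : Function.Injective t) (hst : ∀ i j, s i = (t j).bar → (W i).dir = (W j).dir) :
    ∃ P : Polarization V, ∀ i, P.lsrc (W i) = s i ∧ P.ltgt (W i) = t i := by
  let e : ι ≃ Quiver.Total V := Equiv.ofBijective _ hb
  have he : ∀ i, e i = (W i).arrow := fun i => rfl
  -- `A` and `B` are the prescribed sides at which the arrow itself starts and ends. Letters of
  -- opposite directions cannot collide by `hst`.
  let A : ι → State V := fun i => if (W i).dir then s i else (t i).bar
  let B : ι → State V := fun i => if (W i).dir then (t i).bar else s i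
  have hA : ∀ i, (e i).left = (A i).1 := by
    intro i
    have h1 := hsrc i
    have h2 := htgt i
    rw [he]
    cases hd : (W i).dir <;> simp only [Letter.src, Letter.tgt, A, hd, if_true, if_false,
      Bool.false_eq_true, State.bar_fst] at h1 h2 ⊢ <;> assumption
  have hB : ∀ i, (e i).right = (B i).1 := by
    intro i
    have h1 := hsrc i
    have h2 := htgt i
    rw [he]
    cases hd : (W i).dir <;> simp only [Letter.src, Letter.tgt, B, hd, if_true, if_false,
      Bool.false_eq_true, State.bar_fst] at h1 h2 ⊢ <;> assumption
  have hAinj : Function.Injective A := by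
    intro i j hij
    cases hd : (W i).dir <;> cases hd' : (W j).dir <;>
      simp only [A, hd, hd', if_true, if_false, Bool.false_eq_true] at hij
    · exact ht (State.bar_inj.1 hij)
    · have := hst j i hij.symm
      simp [hd, hd'] at this
    · have := hst i j hij
      simp [hd, hd'] at this
    · exact hs hij
  have hBinj : Function.Injective B := by
    intro i j hij
    cases hd : (W i).dir <;> cases hd' : (W j).dir <;>
      simp only [B, hd, hd', if_true, if_false, Bool.false_eq_true] at hij
    · exact hs hij
    · have := hst i j hij
      simp [hd, hd'] at this
    · have := hst j i hij.symm
      simp [hd, hd'] at this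
    · exact ht (State.bar_inj.1 hij)
  let P : Polarization V :=
    { srcSign := fun a => (A (e.symm a)).2
      tgtSign := fun a => (B (e.symm a)).2
      src_inj := by
        intro a b h1 h2
        obtain ⟨i, rfl⟩ := e.surjective a
        obtain ⟨j, rfl⟩ := e.surjective b
        rw [hA, hA] at h1
        rw [e.symm_apply_apply, e.symm_apply_apply] at h2
        rw [hAinj (Prod.ext h1 h2)]
      tgt_inj := by
        intro a b h1 h2
        obtain ⟨i, rfl⟩ := e.surjective a
        obtain ⟨j, rfl⟩ := e.surjective b
        rw [hB, hB] at h1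
        rw [e.symm_apply_apply, e.symm_apply_apply] at h2
        rw [hBinj (Prod.ext h1 h2)] }
  have hPA : ∀ i, ((W i).arrow.left, P.srcSign (W i).arrow) = A i := fun i =>
    Prod.ext (hA i) (by rw [← he]; exact congrArg (fun j => (A j).2) (e.symm_apply_apply i))
  have hPB : ∀ i, ((W i).arrow.right, P.tgtSign (W i).arrow) = B i := fun i =>
    Prod.ext (hB i) (by rw [← he]; exact congrArg (fun j => (B j).2) (e.symm_apply_apply i))
  refine ⟨P, fun i => ?_⟩
  cases hd : (W i).dir <;> simp only [Polarization.lsrc, Polarization.ltgt, Letter.inv_dir,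
    Letter.inv_arrow, hd, hPA, hPB, A, B, if_true, if_false, Bool.false_eq_true, Bool.not_true,
    Bool.not_false, State.bar_bar, and_self]

/-! ### Walks on vertices -/

namespace Word

variable {V : Type u} [Quiver.{v} V]

theorem IsWalk.append {x y z : V} {w w' : Word V} (h : IsWalk x w y) (h' : IsWalk y w' z) :
    IsWalk x (w ++ w') z := by
  induction w generalizing x with
  | nil =>
    obtain rfl : x = y := h
    exact h'
  | cons l w ih => exact ⟨h.1, ih h.2⟩

theorem IsWalk.end_unique {x y z : V} {w : Word V} (h : IsWalk x w y) (h' : IsWalk x w z) :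
    y = z := by
  induction w generalizing x with
  | nil => exact h.symm.trans h'
  | cons l w ih => exact ih h.2 h'.2

theorem IsWalk.exists_vertices {x y : V} {w : Word V} (h : IsWalk x w y) :
    ∃ u : ℕ → V, u 0 = x ∧ ∀ i l, w[i]? = some l → l.src = u i ∧ l.tgt = u (i + 1) := by
  induction w generalizing x with
  | nil => exact ⟨fun _ => x, rfl, by simp⟩
  | cons m w ih =>
    obtain ⟨u, hu, hw⟩ := ih h.2
    refine ⟨fun i => Nat.casesOn i x u, rfl, fun i l hi => ?_⟩
    cases i with
    | zero =>
      obtain rfl : m = l := by simpa using hi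
      exact ⟨h.1, hu.symm⟩
    | succ i => exact hw i l (by simpa using hi)

theorem isWalk_seg {W : ℕ → Letter V} {u : ℕ → V} {i j : ℕ} (hij : i ≤ j)
    (hsrc : ∀ m < j, (W m).src = u m) (htgt : ∀ m < j, (W m).tgt = u (m + 1)) :
    IsWalk (u i) (seg W i j) (u j) := by
  induction j, hij using Nat.le_induction with
  | base => simp [seg, IsWalk]
  | succ j hij ih =>
    rw [← seg_append hij (Nat.le_succ j), seg_eq_cons (Nat.lt_succ_self j)]
    refine (ih (fun m h => hsrc m (by omega)) fun m h => htgt m (by omega)).append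
      ⟨hsrc j (by omega), ?_⟩
    simpa [seg, IsWalk] using htgt j (by omega)

theorem seg_getD (w : Word V) (d : Letter V) {i j : ℕ} (hj : j ≤ w.length) :
    seg (fun m => w.getD m d) i j = (w.take j).drop i := by
  refine List.ext_getElem (by simp [seg, hj]) fun m h1 h2 => ?_
  simp only [seg, List.length_map, List.length_range'] at h1
  simp [seg, List.getElem_range', List.getD_eq_getElem?_getD,
    List.getElem?_eq_getElem (show i + m < w.length by omega)]

/-- A directed walk is a path. -/
theorem IsWalk.exists_path {x y : V} {w : Word V} (h : IsWalk x w y) (hw : ∀ l ∈ w, l.dir = true) :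
    ∃ p : Quiver.Path x y, p.length = w.length := by
  induction w generalizing x with
  | nil =>
    obtain rfl : x = y := h
    exact ⟨Quiver.Path.nil, rfl⟩
  | cons l w ih =>
    obtain ⟨p, hp⟩ := ih h.2 fun m hm => hw m (List.mem_cons_of_mem _ hm)
    obtain ⟨⟨a, b, e⟩, d⟩ := l
    obtain rfl : d = true := hw _ List.mem_cons_self
    obtain rfl : a = x := h.1
    change Quiver.Path b y at p
    change p.length = w.length at hp
    refine ⟨e.toPath.comp p, ?_⟩
    rw [Quiver.Path.length_comp, hp, List.length_cons, Quiver.Path.length_toPath, add_comm]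

end Word

theorem isConnectedQuiver_of_seq {V : Type u} [Quiver.{v} V] {W : ℕ → Letter V} {u : ℕ → V} {N : ℕ}
    (hsrc : ∀ m < N, (W m).src = u m) (htgt : ∀ m < N, (W m).tgt = u (m + 1))
    (hu : ∀ x, ∃ i ≤ N, u i = x) : IsConnectedQuiver V := by
  have key : ∀ i ≤ N, Nonempty (@Quiver.Path (Quiver.Symmetrify V) _ (u 0) (u i)) := by
    intro i
    induction i with
    | zero => exact fun _ => ⟨Quiver.Path.nil⟩
    | succ i ih =>
      intro hi
      obtain ⟨p⟩ := ih (by omega)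
      have h1 := hsrc i (by omega)
      have h2 := htgt i (by omega)
      rw [← h1] at p
      rw [← h2]
      generalize W i = l at p
      obtain ⟨⟨a, b, e⟩, d⟩ := l
      cases d
      · exact ⟨@Quiver.Path.cons (Quiver.Symmetrify V) _ _ b a p (Sum.inr e)⟩
      · exact ⟨@Quiver.Path.cons (Quiver.Symmetrify V) _ _ a b p (Sum.inl e)⟩
  refine ⟨⟨u 0⟩, fun x y => ?_⟩
  obtain ⟨i, hi, rfl⟩ := hu x
  obtain ⟨j, hj, rfl⟩ := hu y
  obtain ⟨p⟩ := key i hi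
  obtain ⟨r⟩ := key j hj
  exact ⟨p.reverse.comp r⟩

/-! ### Recognition of cycles and barbells -/

theorem IsAcyclicAffineA.exists_cycleWalk {V : Type u} [Quiver.{v} V] {n : ℕ}
    (h : IsAcyclicAffineA V n) : ∃ (P : Polarization V) (W : ZMod (n + 1) → Letter V)
      (st : ZMod (n + 1) → State V), CycleWalk P W st ∧ ∀ x, ∃ z, (st z).1 = x := by
  obtain ⟨⟨φ, ψ, hφψ⟩, -⟩ := h
  have hW : ∀ z, ∃ l : Letter V, l.arrow = ψ z ∧ l.src = φ z ∧ l.tgt = φ (z + 1) := by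
    intro z
    rcases hφψ z with h | h
    · exact ⟨⟨ψ z, true⟩, rfl, h.1, h.2⟩
    · exact ⟨⟨ψ z, false⟩, rfl, h.2, h.1⟩
  choose W ha hs ht using hW
  have hφ : Function.Injective fun z => (φ z, true) :=
    fun z z' hz => φ.injective (congrArg Prod.fst hz)
  have hb : (fun z => (W z).arrow) = ψ := funext ha
  -- All letters leave on one side and enter on the other, so there are no relations.
  obtain ⟨P, hP⟩ := exists_polarization W (fun z => (φ z, true)) (fun z => (φ (z + 1), true)) hs ht
    (hb ▸ ψ.bijective) hφ (fun z z' hz => add_right_cancel (hφ hz))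
    (fun z z' hz => by simpa using congrArg Prod.snd hz)
  refine ⟨P, W, fun z => (φ z, true), ⟨fun z => (hP z).1, fun z => (hP z).2, φ.injective,
    fun a => ?_⟩, φ.surjective⟩
  obtain ⟨z, rfl⟩ := ψ.surjective a
  exact ⟨z, ha z⟩

theorem CycleWalk.exists_walk {V : Type u} [Quiver.{v} V] {P : Polarization V} {n : ℕ}
    {W : ZMod (n + 1) → Letter V} {st : ZMod (n + 1) → State V} (h : CycleWalk P W st) :
    ∃ s w, w ≠ [] ∧ P.Walk s w s := by
  have := P.walk_seg (W := fun i : ℕ => W i) (st := fun i : ℕ => st i) (Nat.zero_le (n + 1))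
    (fun m _ _ => h.src m) (fun m _ _ => by rw [h.tgt, Nat.cast_succ])
  rw [ZMod.natCast_self, Nat.cast_zero] at this
  exact ⟨_, _, Word.seg_ne_nil (Nat.succ_pos n), this⟩

theorem CycleWalk.isConnectedQuiver {V : Type u} [Quiver.{v} V] {P : Polarization V} {n : ℕ}
    {W : ZMod (n + 1) → Letter V} {st : ZMod (n + 1) → State V} (h : CycleWalk P W st)
    (hst : ∀ x, ∃ z, (st z).1 = x) : IsConnectedQuiver V := by
  refine isConnectedQuiver_of_seq (W := fun i : ℕ => W i) (u := fun i : ℕ => (st i).1) (N := n + 1)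
    (fun m _ => by rw [← h.src, P.lsrc_fst])
    (fun m _ => by rw [Nat.cast_succ, ← h.tgt, P.ltgt_fst]) fun x => ?_
  obtain ⟨z, rfl⟩ := hst x
  exact ⟨z.val, (ZMod.val_lt z).le, by rw [ZMod.natCast_zmod_val]⟩

/-- Left loop, bar, right loop, and back along the bar. -/
theorem BarbellWalk.exists_walk {V : Type u} [Quiver.{v} V] {P : Polarization V}
    {W : ℕ → Letter V} {st : ℕ → State V} {p q N : ℕ} (h : BarbellWalk P W st p q N) :
    ∃ s w, w ≠ [] ∧ P.Walk s w s := by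
  have h3 := h.lt
  have h1 := h.walk (Nat.zero_le N) le_rfl
  have h2 := (h.walk h.le h3.le).inv
  rw [h.right] at h1
  rw [← h.left] at h2
  exact ⟨_, _, by simp [Word.seg_ne_nil (show 0 < N by omega)], h1.append h2⟩

theorem IsGeneralizedBarbell.exists_barbellWalk {V : Type u} [Quiver.{v} V] [Fintype V] {k : Type w}
    [Field k] {I : TwoSidedIdeal (PathAlgebra k V)} (h : IsGeneralizedBarbell I) :
    ∃ (P : Polarization V) (W : ℕ → Letter V) (st : ℕ → State V) (p q N : ℕ),
      BarbellWalk P W st p q N ∧ I = P.ideal k ∧ (W 0).dir = true ∧ (W q).dir = true ∧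
      ¬ (p = q ∧ ∀ i < N, (W i).dir = true) ∧ ∀ x, ∃ i ≤ N, (st i).1 = x := by
  obtain ⟨x, y, CL, b, CR, α, β, γ, δ, hCL, hb, hCR, hβ, hα, hδ, hγ, hnd, hcov, hand, hacov, hI,
    -, -, hser⟩ := h
  obtain ⟨u, hu0, hu⟩ := ((hCL.append hb).append hCR).exists_vertices
  -- The default letter only fills the times from `N` on, which play no role.
  obtain ⟨W, hW⟩ : ∃ W : ℕ → Letter V, W = fun i => (CL ++ b ++ CR).getD i ⟨α, true⟩ := ⟨_, rfl⟩
  obtain ⟨p, hp⟩ : ∃ p, p = CL.length := ⟨_, rfl⟩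
  obtain ⟨q, hq⟩ : ∃ q, q = CL.length + b.length := ⟨_, rfl⟩
  obtain ⟨N, hN⟩ : ∃ N, N = CL.length + b.length + CR.length := ⟨_, rfl⟩
  have h1 : 1 ≤ p := by
    rw [hp, Nat.one_le_iff_ne_zero, Ne, List.length_eq_zero_iff]
    rintro rfl
    simp at hβ
  have h2 : p ≤ q := by omega
  have h3 : q < N := by
    have : CR.length ≠ 0 := by
      rw [Ne, List.length_eq_zero_iff]
      rintro rfl
      simp at hδ
    omega
  have hlen : (CL ++ b ++ CR).length = N := by simp [hN, add_assoc]
  have sL : Word.seg W 0 p = CL := by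
    rw [hW, Word.seg_getD _ _ (by omega), hp]
    simp
  have sb : Word.seg W p q = b := by
    rw [hW, Word.seg_getD _ _ (by omega), hp, hq, List.take_append_of_le_length (by simp),
      List.take_of_length_le (by simp)]
    simp
  have sR : Word.seg W q N = CR := by
    rw [hW, Word.seg_getD _ _ (by omega), ← hlen, List.take_length, hq, ← List.length_append,
      List.drop_left]
  have sA : CL ++ b ++ CR = Word.seg W 0 N := by
    rw [hW, Word.seg_getD _ _ (by omega), ← hlen, List.take_length, List.drop_zero]
  have hsome : ∀ i < N, (CL ++ b ++ CR)[i]? = some (W i) := fun i hi => by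
    rw [hW]
    simp only [List.getD_eq_getElem?_getD]
    rw [List.getElem?_eq_getElem (by omega), Option.getD_some]
  have hsrc : ∀ i < N, (W i).src = u i := fun i hi => (hu i _ (hsome i hi)).1
  have htgt : ∀ i < N, (W i).tgt = u (i + 1) := fun i hi => (hu i _ (hsome i hi)).2
  have hwalk : ∀ i j, i ≤ j → j ≤ N → Word.IsWalk (u i) (Word.seg W i j) (u j) :=
    fun i j hij hj => Word.isWalk_seg hij (fun m hm => hsrc m (by omega))
      fun m hm => htgt m (by omega)
  have hup : u p = x := by
    have := hwalk 0 p (Nat.zero_le p) (by omega)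
    rw [sL, hu0] at this
    exact this.end_unique hCL
  have huq : u q = y := by
    have := hwalk p q h2 h3.le
    rw [sb, hup] at this
    exact this.end_unique hb
  have huN : u N = y := by
    have := hwalk q N h3.le le_rfl
    rw [sR, huq] at this
    exact this.end_unique hCR
  have hver := Word.vertices_eq h1 h2 h3 hsrc htgt
  rw [sL, sb, sR, hup] at hver
  rw [hver] at hnd hcov
  have e0 : W 0 = ⟨β, true⟩ := by
    rw [← sL, Word.seg_eq_cons (by omega)] at hβ
    exact Option.some.inj hβ
  have e1 : W (p - 1) = ⟨α, true⟩ := by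
    rw [← sL, Word.getLast?_seg (by omega)] at hα
    exact Option.some.inj hα
  have e2 : W q = ⟨δ, true⟩ := by
    rw [← sR, Word.seg_eq_cons h3] at hδ
    exact Option.some.inj hδ
  have e3 : W (N - 1) = ⟨γ, true⟩ := by
    rw [← sR, Word.getLast?_seg h3] at hγ
    exact Option.some.inj hγ
  -- The side switches at time `p`, where the left loop is left, and once more at time `N`, so that
  -- the loops come back on the opposite side of their start.
  obtain ⟨st, hst⟩ : ∃ st : ℕ → State V, st = fun i => (u i, decide (i < p ∨ i = N)) := ⟨_, rfl⟩
  have hstu : ∀ i, (st i).1 = u i := fun i => by rw [hst]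
  have hS : BarbellStates st p q N := by
    refine ⟨h1, h2, h3, ?_, ?_, ?_⟩
    · simp [hst, State.bar, hu0, hup, show 0 < p by omega, show p ≠ N by omega]
    · simp [hst, State.bar, huN, huq, show ¬ q < p by omega, show q ≠ N by omega]
    · intro i j hi hi' hj hj' hij
      rw [hstu, hstu] at hij
      exact List.inj_on_of_nodup_map hnd (by rw [List.mem_range'_1]; omega)
        (by rw [List.mem_range'_1]; omega) hij
  rw [sA] at hand hacov
  rw [Word.seg, List.map_map] at hand
  have hcover : ∀ a, ∃ i < N, (W i).arrow = a := by
    intro a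
    obtain ⟨l, hl, rfl⟩ := List.mem_map.1 (hacov a)
    obtain ⟨i, -, hi, rfl⟩ := Word.mem_seg.1 hl
    exact ⟨i, hi, rfl⟩
  obtain ⟨P, hP⟩ := exists_polarization (fun i : Fin N => W i) (fun i => st i)
    (fun i => st (i + 1)) (fun i => by rw [hsrc i i.2, hstu]) (fun i => by rw [htgt i i.2, hstu])
    ⟨fun i j hij => Fin.ext (List.inj_on_of_nodup_map hand (by rw [List.mem_range'_1]; omega)
        (by rw [List.mem_range'_1]; omega) hij),
      fun a => let ⟨i, hi, ha⟩ := hcover a; ⟨⟨i, hi⟩, ha⟩⟩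
    (fun i j hij => Fin.ext (hS.start_inj i.2 j.2 hij))
    (fun i j hij => Fin.ext (by
      have := hS.end_inj (by omega) (by omega) (by omega) (by omega) hij
      omega))
    (fun i j hij => by
      have hc := hS.cross i.2 (j := j + 1) (by omega) (by omega) hij
      rcases hc with ⟨hi, hj⟩ | ⟨hi, hj⟩
      · rw [hi, show (j : ℕ) = p - 1 by omega, e0, e1]
      · rw [hi, show (j : ℕ) = N - 1 by omega, e2, e3])
  have hB : BarbellWalk P W st p q N :=
    { hS with
      src := fun i hi => (hP ⟨i, hi⟩).1
      tgt := fun i hi => (hP ⟨i, hi⟩).2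
      cover := hcover }
  have d0 : (W 0).dir = true := by rw [e0]
  have dq : (W q).dir = true := by rw [e2]
  have hid := hB.ideal_eq k d0 dq
  refine ⟨P, W, st, p, q, N, hB, ?_, d0, dq, ?_, ?_⟩
  · rw [hI, hid, e0, e1, e2, e3]
  · rintro ⟨rfl, hdir⟩
    apply hser
    have hseg : CL ++ CR = Word.seg W 0 N := by
      rw [← sL, ← sR, Word.seg_append (Nat.zero_le _) h3.le]
    rw [hseg, hI]
    refine ⟨?_, Or.inl fun l hl => ?_⟩
    · have := (Polarization.isString_iff (P := P) (k := k)).2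
        ⟨Word.seg_ne_nil (W := W) (show 0 < N by omega), _, _, hB.walk (Nat.zero_le N) le_rfl⟩
      rwa [hid, e0, e1, e2, e3] at this
    · obtain ⟨i, -, hi, rfl⟩ := Word.mem_seg.1 hl
      exact hdir i hi
  · intro z
    obtain ⟨i, hi, rfl⟩ := List.mem_map.1 (hcov z)
    rw [List.mem_range'_1] at hi
    exact ⟨i, by omega, hstu i⟩

end

end BoundQuiver

/-! ### The classification -/

theorem BoundQuiver.Polarization.isGentle_and_isFullyReduced {k : Type w} [Field k] {V : Type u}
    [Quiver.{v} V] [Fintype V] {P : Polarization V} (hV : IsConnectedQuiver V)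
    (hcov : P.Covering) (hwalk : ∃ s w, w ≠ [] ∧ P.Walk s w s)
    (hdir : ∀ p w, w ≠ [] → P.Walk p w p → ¬ ∀ l ∈ w, l.dir = true) :
    IsGentle (P.ideal k) ∧ IsFullyReduced (P.ideal k) := by
  obtain ⟨s, w, hne, hw⟩ := hwalk
  have hinc : ∀ x : V, ∃ a : Quiver.Total V, a.left = x ∨ a.right = x := by
    obtain ⟨l, -⟩ := List.exists_mem_of_ne_nil w hne
    exact hV.exists_incident l.arrow
  exact ⟨Polarization.isGentle_ideal hV hdir,
    ⟨Polarization.isRepInfinite_of_walk k hw hne,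
      fun _ hb => hcov.weakReductionIdeal_eq_bot hinc hb⟩,
    fun _ hb => hcov.reductionIdeal_eq_bot hb⟩

theorem mainTheorem12 {k : Type w} [Field k] {V : Type u} [Quiver.{v} V] [Fintype V]
    [Finite (Quiver.Total V)] (I : TwoSidedIdeal (BoundQuiver.PathAlgebra k V)) :
    (BoundQuiver.IsGentle I ∧ BoundQuiver.IsFullyReduced I) ↔
      (((∃ n : ℕ, BoundQuiver.IsAcyclicAffineA V n) ∧ I = ⊥) ∨
        BoundQuiver.IsGeneralizedBarbell I) := by
  constructor
  · rintro ⟨hg, hf⟩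
    obtain ⟨P, rfl⟩ := hg.exists_polarization
    -- Representation-infiniteness is used here only to obtain a closed walk.
    have hwalk : ∃ s w, w ≠ [] ∧ P.Walk s w s := by
      by_contra hcon
      refine BoundQuiver.not_isRepInfinite k (fun p w hw => ?_) hf.1.1
      by_contra hne
      exact hcon ⟨p, w, hne, hw⟩
    obtain ⟨s, w, hne, hw⟩ := hwalk
    have hinc : ∀ x : V, ∃ a : Quiver.Total V, a.left = x ∨ a.right = x := by
      obtain ⟨l, -⟩ := List.exists_mem_of_ne_nil w hne
      exact hg.1.exists_incident l.arrow
    have hdir : ∀ p w, w ≠ [] → P.Walk p w p → ¬ ∀ l ∈ w, l.dir = true :=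
      fun p w hne hw => BoundQuiver.IsAdmissible.not_directed hg.2.1 hne hw
    rcases (BoundQuiver.Polarization.covering_of_reductionIdeal hf.2).cycle_or_barbell hw hne with
      ⟨n, W, st, h⟩ | ⟨W, st, p, q, N, h⟩
    · exact Or.inl ⟨⟨n, h.isAcyclicAffineA k hinc hdir⟩, h.ideal_eq_bot k⟩
    · obtain ⟨W, st, h, hl, hr⟩ := h.exists_dir
      exact Or.inr (h.isGeneralizedBarbell k hinc hl hr hdir)
  · rintro (⟨⟨n, hA⟩, rfl⟩ | hB)
    · obtain ⟨P, W, st, h, hst⟩ := hA.exists_cycleWalk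
      rw [← h.ideal_eq_bot k]
      refine BoundQuiver.Polarization.isGentle_and_isFullyReduced (h.isConnectedQuiver hst)
        h.covering h.exists_walk fun s w hne hw hdir => hne ?_
      -- A directed closed walk would be an oriented cycle of `V`.
      obtain ⟨r, hr⟩ := hw.isWalk.exists_path hdir
      rw [← List.length_eq_zero_iff, ← hr, hA.2]
    · obtain ⟨P, W, st, p, q, N, h, rfl, hl, hr, hd, hst⟩ := hB.exists_barbellWalk
      refine BoundQuiver.Polarization.isGentle_and_isFullyReduced ?_ h.covering h.exists_walk
        fun s w hne hw => h.not_directed hl hr hd hne hw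
      exact BoundQuiver.isConnectedQuiver_of_seq (W := W) (u := fun i => (st i).1) (N := N)
        (fun m hm => by rw [← h.src m hm, P.lsrc_fst])
        (fun m hm => by rw [← h.tgt m hm, P.ltgt_fst]) hst
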